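/- Let $N\ge 1$, $0<\sigma<1$, and let $\Omega\subset\mathbb{R}^N$ be a bounded open set (for instance a bounded domain with Lipschitz boundary). For $0<\alpha<1$ let $$I_\alpha u(x)=\gamma_{N,\alpha}\int_{\mathbb{R}^N}\frac{u(y)}{|x-y|^{N-\alpha}}\,dy,\qquad \gamma_{N,\alpha}=\frac{\Gamma(\frac{N-\alpha}{2})}{\pi^{N/2}\,2^\alpha\,\Gamma(\frac{\alpha}{2})},$$ be the Riesz potential and let $D^\sigma u=D(I_{1-\sigma}u)$ (distributional gradient) be the Riesz fractional gradient. Functions on $\Omega$ are extended by zero to $\mathbb{R}^N$. Let $H^\sigma_0(\Omega)$ be the closure of $C^\infty_c(\Omega)$ in the norm $(\|u\|_{L^2(\mathbb{R}^N)}^2+\|D^\sigma u\|_{L^2(\mathbb{R}^N)^N}^2)^{1/2}$ (on $H^\sigma_0(\Omega)$ equivalent to $\|D^\sigma u\|_{L^2(\mathbb{R}^N)^N}$), and put $$\Upsilon^\sigma_\infty(\Omega)=\{v\in H^\sigma_0(\Omega): D^\sigma v\in L^\infty(\mathbb{R}^N)^N\},\qquad \mathbb{K}^\sigma_g=\{v\in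 H^\sigma_0(\Omega): |D^\sigma v|\le g\ \text{a.e. in }\mathbb{R}^N\}.$$ Let $A:\mathbb{R}^N\to\mathbb{R}^{N\times N}$ be measurable, not necessarily symmetric, such that for some $a_*,a^*>0$, for a.e. $x$ and all $\xi,\eta\in\mathbb{R}^N$, $a_*|\xi|^2\le A(x)\xi\cdot\xi$ and $A(x)\xi\cdot\eta\le a^*|\xi||\eta|$. Let $\nu>0$, let $g\in L^\infty(\mathbb{R}^N)$ with $g\ge\nu$ a.e., and let $f\in L^{2^\#}(\Omega)$, where $2^\#=\frac{2N}{N+2\sigma}$ if $\sigma<\frac N2$, $2^\#$ is any fixed number in $(1,\infty)$ if $\sigma=\frac N2$, and $2^\#=1$ if $\sigma>\frac N2$. For $\lambda\in L^\infty(\mathbb{R}^N)'$, $h\in L^\infty(\mathbb{R}^N)$ and $a\in L^\infty(\mathbb{R}^N)^N$ define $\lambda h\in L^\infty(\mathbb{R}^N)'$ by $\langle\lambda h,w\rangle=\langle\lambda,hw\rangle$ and $\lambda a\in (L^\infty(\mathbb{R}^N)^N)'$ by $\langle\lambda a,b\rangle=\langle\lambda,a\cdot b\rangle$; $\lambda\ge0$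 means $\langle\lambda,w\rangle\ge0$ for all $w\ge 0$. Then there exist $\lambda\in L^\infty(\mathbb{R}^N)'$ and $u\in\Upsilon^\sigma_\infty(\Omega)$ such that, for every $v\in\Upsilon^\sigma_\infty(\Omega)$, the functions $fv$ and $AD^\sigma u\cdot D^\sigma v$ are integrable on $\Omega$ and $\mathbb{R}^N$ respectively and $$\langle\lambda D^\sigma u,D^\sigma v\rangle+\int_{\mathbb{R}^N}AD^\sigma u\cdot D^\sigma v=\int_\Omega fv;$$ $$|D^\sigma u|\le g\ \text{ a.e. in }\mathbb{R}^N,\qquad \lambda\ge0,\qquad \lambda(|D^\sigma u|-g)=0\ \text{ in }L^\infty(\mathbb{R}^N)';$$ and, moreover, $u$ solves the variational inequality $$u\in\mathbb{K}^\sigma_g:\qquad\int_{\mathbb{R}^N}AD^\sigma u\cdot D^\sigma(v-u)\ge\int_\Omega f(v-u)\qquad\text{for all }v\in\mathbb{K}^\sigma_g.$$ -/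

import Mathlib

open MeasureTheory Filter Topology Set
open scoped ENNReal ContDiff RealInnerProductSpace

noncomputable section

namespace FracGrad

/-- Euclidean space `ℝ^N`. -/
abbrev RN (N : ℕ) : Type := EuclideanSpace ℝ (Fin N)

variable {N : ℕ}

/-- The normalising constant `γ_{N,α} = Γ((N-α)/2) / (π^{N/2} 2^α Γ(α/2))`. -/
def rieszConst (N : ℕ) (α : ℝ) : ℝ :=
  Real.Gamma (((N : ℝ) - α) / 2) /
    (Real.pi ^ ((N : ℝ) / 2) * (2 : ℝ) ^ α * Real.Gamma (α / 2))

/-- The Riesz potential `I_α u (x) = γ_{N,α} ∫ u(y) / |x-y|^{N-α} dy`. -/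
def rieszPotential (α : ℝ) (u : RN N → ℝ) (x : RN N) : ℝ :=
  rieszConst N α * ∫ y, u y / ‖x - y‖ ^ ((N : ℝ) - α)

/-- The Riesz potential of `u` is well defined as a locally integrable function: the defining
integral converges absolutely at almost every point, and the resulting function is locally
integrable. -/
def HasRieszPotential (α : ℝ) (u : RN N → ℝ) : Prop :=
  (∀ᵐ x : RN N, Integrable (fun y => u y / ‖x - y‖ ^ ((N : ℝ) - α))) ∧
    LocallyIntegrable (rieszPotential α u) volume

/-- `φ ∈ C_c^∞(U)`. -/
def IsTest (U : Set (RN N)) (φ : RN N → ℝ) : Prop :=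
  ContDiff ℝ ∞ φ ∧ HasCompactSupport φ ∧ tsupport φ ⊆ U

/-- The locally integrable field `F` is the distributional gradient of `I_{1-σ} u`, that is,
`∫ (I_{1-σ} u) ∂_j φ = - ∫ F_j φ` for all `φ ∈ C_c^∞(ℝ^N)` and all `j`. -/
def IsFracGrad (σ : ℝ) (u : RN N → ℝ) (F : RN N → RN N) : Prop :=
  HasRieszPotential (1 - σ) u ∧ LocallyIntegrable F volume ∧
    ∀ φ : RN N → ℝ, IsTest univ φ → ∀ j : Fin N,
      ∫ x, rieszPotential (1 - σ) u x * fderiv ℝ φ x (EuclideanSpace.single j 1)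
        = - ∫ x, F x j * φ x

open Classical in
/-- The Riesz fractional gradient `D^σ u = D (I_{1-σ} u)`, a representative of its a.e. class
(with value `0` if the distribution `D^σ u` is not a locally integrable field). -/
def fracGrad (σ : ℝ) (u : RN N → ℝ) : RN N → RN N :=
  if h : ∃ F, IsFracGrad σ u F then h.choose else 0

/-- `u ∈ H^σ_0(Ω)`: the (extended by zero) function `u ∈ L²(ℝ^N)` has a fractional gradient
`D^σ u ∈ L²(ℝ^N)^N`, and is the limit of a sequence of functions `φ_n ∈ C_c^∞(Ω)` in the norm
`(‖u‖²_{L²} + ‖D^σ u‖²_{L²})^{1/2}`. -/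
def MemH0 (σ : ℝ) (Ω : Set (RN N)) (u : RN N → ℝ) : Prop :=
  MemLp u 2 volume ∧ (∃ F, IsFracGrad σ u F) ∧ MemLp (fracGrad σ u) 2 volume ∧
    ∃ φ : ℕ → RN N → ℝ, (∀ n, IsTest Ω (φ n)) ∧
      Tendsto (fun n => eLpNorm (φ n - u) 2 volume) atTop (𝓝 0) ∧
      Tendsto (fun n => eLpNorm (fracGrad σ (φ n) - fracGrad σ u) 2 volume) atTop (𝓝 0)

/-- `u ∈ Υ^σ_∞(Ω)`: `u ∈ H^σ_0(Ω)` and `D^σ u ∈ L^∞(ℝ^N)^N`. -/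
def MemUpsilon (σ : ℝ) (Ω : Set (RN N)) (u : RN N → ℝ) : Prop :=
  MemH0 σ Ω u ∧ MemLp (fracGrad σ u) ∞ volume

/-- `u ∈ K^σ_g`: `u ∈ H^σ_0(Ω)` and `|D^σ u| ≤ g` a.e. in `ℝ^N`. -/
def MemK (σ : ℝ) (Ω : Set (RN N)) (g : RN N → ℝ) (u : RN N → ℝ) : Prop :=
  MemH0 σ Ω u ∧ ∀ᵐ x : RN N, ‖fracGrad σ u x‖ ≤ g x

/-- The element of `L^∞(ℝ^N)^N` given by `D^σ u`, for `u ∈ Υ^σ_∞(Ω)`. -/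
def MemUpsilon.gradLinf {σ : ℝ} {Ω : Set (RN N)} {u : RN N → ℝ} (hu : MemUpsilon σ Ω u) :
    Lp (RN N) ∞ (volume : Measure (RN N)) :=
  hu.2.toLp (fracGrad σ u)

/-- The dual `L^∞(ℝ^N)'`. -/
abbrev LinfDual (N : ℕ) : Type := StrongDual ℝ (Lp ℝ ∞ (volume : Measure (RN N)))

/-- The dual `(L^∞(ℝ^N)^N)'`. -/
abbrev LinfVecDual (N : ℕ) : Type := StrongDual ℝ (Lp (RN N) ∞ (volume : Measure (RN N)))

/-- For `μ ∈ L^∞(ℝ^N)'` and `h ∈ L^∞(ℝ^N)`, the product `μ h ∈ L^∞(ℝ^N)'`, given by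
`⟨μ h, w⟩ = ⟨μ, h w⟩`. -/
def LinfDual.mul (μ : LinfDual N) (h : Lp ℝ ∞ (volume : Measure (RN N))) : LinfDual N :=
  μ.comp ((ContinuousLinearMap.mul ℝ ℝ).holderL volume ∞ ∞ ∞ h)

/-- For `μ ∈ L^∞(ℝ^N)'` and `a ∈ L^∞(ℝ^N)^N`, the product `μ a ∈ (L^∞(ℝ^N)^N)'`, given by
`⟨μ a, b⟩ = ⟨μ, a · b⟩`. -/
def LinfDual.mulVec (μ : LinfDual N) (a : Lp (RN N) ∞ (volume : Measure (RN N))) :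
    LinfVecDual N :=
  μ.comp ((innerSL ℝ (E := RN N)).holderL volume ∞ ∞ ∞ a)

/-- Positivity in `L^∞(ℝ^N)'`: `⟨μ, w⟩ ≥ 0` whenever `w ≥ 0` a.e. -/
def LinfDual.IsNonneg (μ : LinfDual N) : Prop :=
  ∀ w : Lp ℝ ∞ (volume : Measure (RN N)), 0 ≤ w → 0 ≤ μ w

/-- The integrand `A D^σ u · D^σ v`. -/
def formDensity (σ : ℝ) (A : RN N → Matrix (Fin N) (Fin N) ℝ) (u v : RN N → ℝ) (x : RN N) : ℝ :=
  ⟪Matrix.toEuclideanLin (A x) (fracGrad σ u x), fracGrad σ v x⟫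

/-- `A` is a measurable, bounded and (uniformly) positive definite matrix field, not necessarily
symmetric: for some `a_*, a^* > 0`, for a.e. `x` and all `ξ, η`,
`a_* |ξ|² ≤ A(x) ξ · ξ` and `A(x) ξ · η ≤ a^* |ξ| |η|`. -/
def IsBoundedPosDef (A : RN N → Matrix (Fin N) (Fin N) ℝ) : Prop :=
  (∀ i j, AEMeasurable (fun x => A x i j) volume) ∧
    ∃ aLow aUp : ℝ, 0 < aLow ∧ 0 < aUp ∧ ∀ᵐ x : RN N, ∀ ξ η : RN N,
      aLow * ‖ξ‖ ^ 2 ≤ ⟪Matrix.toEuclideanLin (A x) ξ, ξ⟫ ∧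
        ⟪Matrix.toEuclideanLin (A x) ξ, η⟫ ≤ aUp * ‖ξ‖ * ‖η‖

/-- `u` solves the variational inequality: `u ∈ K^σ_g` and
`∫ A D^σ u · D^σ (v - u) ≥ ∫_Ω f (v - u)` for all `v ∈ K^σ_g`. -/
def SolvesVI (σ : ℝ) (Ω : Set (RN N)) (A : RN N → Matrix (Fin N) (Fin N) ℝ)
    (f g u : RN N → ℝ) : Prop :=
  MemK σ Ω g u ∧ ∀ v : RN N → ℝ, MemK σ Ω g v →
    ∫ x in Ω, f x * (v x - u x) ≤ ∫ x, formDensity σ A u (v - u) x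

/-- `r` is an admissible value of the exponent `2^#`: it is `2N/(N+2σ)` if `σ < N/2`, the conjugate
exponent of an arbitrary finite `q > 1` (so any finite `r > 1`) if `σ = N/2`, and `1` if
`σ > N/2`. -/
def IsTwoSharp (N : ℕ) (σ r : ℝ) : Prop :=
  (2 * σ < N ∧ r = 2 * N / (N + 2 * σ)) ∨ (2 * σ = N ∧ 1 < r) ∨ (N < 2 * σ ∧ r = 1)

end FracGrad

end

noncomputable section

namespace FracGrad

variable {N : ℕ}

/-! ### The Riesz kernel -/

/-! The variational inequality says that `u` maximises the linear functional T v = ∫_Ω f v − ∫ A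
D^σu·D^σv over the constraint |D^σv|² ≤ g². Symmetry of A plays no role, because u is frozen in the
first slot. The constraint is convex with values in L^∞, where the uniformly negative functions form
an open cone, and v = 0 satisfies it with margin ν² (Slater's condition). Hahn–Banach separation in
L^∞ × ℝ then yields a nonnegative multiplier in the dual of L^∞ (`exists_multiplier_aux`).
Perturbing u to u + tv in the Lagrangian inequality gives the equation, and v = u gives
complementarity for g² − |D^σu|². Since g + |D^σu| ≥ ν, complementarity passes to |D^σu| − g
(`LinfDual.mul_eq_zero`).

It remains to find u. The closure of the graph {(φ, D^σφ)} over test functions in L² × L² is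
identified with H^σ_0(Ω) (`memH0_of_mem_closure`, `MemH0.exists_pair`); admissible pairs form a
closed convex set there. The form sees only the gradient component, so it is monotone but not
coercive on pairs, and `exists_vi_of_monotone` solves the inequality by adding ε times the identity
and letting ε → 0, given an a priori bound.

That bound, and the meaning of ∫_Ω f v for merely integrable f, both come from one estimate: on
bounded Ω, |D^σv| ≤ M forces |v| ≤ C M. With α = 1 − σ, the Riesz potential of y e^{−|y|²} is x ρ(x)
with ρ > 0 radial and (1 + |x|)ρ integrable. For a test function, H(t) = ∫ φ(x₀ + t x) ρ(x) dx
satisfies, by self-adjointness and homogeneity of I_α, H'(t) = t^{−α} ∫ D^σφ(x₀ + t x)·x e^{−|x|²}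
dx, so |H'(t)| ≤ c M t^{σ−1}. Integrating from 0 to T compares φ(x₀)∫ρ with H(T), which is at most
ρ(0) T^{−N}‖φ‖₁. Mollification extends this to weak gradients, and for T large the L¹ norm is
absorbed. No Sobolev or Poincaré inequality is needed. -/

theorem integrable_indicator_ball_norm_rpow (hN : 1 ≤ N) {s : ℝ} (hsN : s < N) :
    Integrable ((Metric.ball (0 : RN N) 1).indicator fun z => ‖z‖ ^ (-s)) volume := by
  rw [integrable_indicator_iff measurableSet_ball]
  refine integrableOn_ball_of_norm_le_rpow (C := 1) (α := s) ?_ ?_ (ae_of_all _ fun x => ?_)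
    (by fun_prop : Measurable fun z : RN N => ‖z‖ ^ (-s)).aestronglyMeasurable
  · simpa using hN
  · simpa using hsN
  · rw [Real.norm_of_nonneg (by positivity), one_mul]

/-- The mass of the Riesz kernel `‖z‖ ^ (-s)` on the unit ball. -/
def kernelMass (N : ℕ) (s : ℝ) : ℝ :=
  ∫ z : RN N, (Metric.ball (0 : RN N) 1).indicator (fun z => ‖z‖ ^ (-s)) z

/-- Splitting at the unit sphere: inside, the bound M meets the integrable singularity; outside, the
kernel is at most 1 and the value itself is kept. -/
theorem div_norm_rpow_le {s : ℝ} (hs : 0 < s) {M : ℝ} {z : RN N} {t : ℝ} (hM : |t| ≤ M) :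
    |t / ‖z‖ ^ s| ≤
      M * (Metric.ball (0 : RN N) 1).indicator (fun z => ‖z‖ ^ (-s)) z + |t| := by
  have hM0 : 0 ≤ M := (abs_nonneg t).trans hM
  rw [abs_div, abs_of_nonneg (by positivity : 0 ≤ ‖z‖ ^ s)]
  by_cases hz : z ∈ Metric.ball (0 : RN N) 1
  · rw [indicator_of_mem hz, Real.rpow_neg (norm_nonneg _), div_eq_mul_inv]
    have : 0 ≤ (‖z‖ ^ s)⁻¹ := by positivity
    nlinarith [mul_le_mul_of_nonneg_right hM this, abs_nonneg t]
  · rw [indicator_of_notMem hz, mul_zero, zero_add]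
    have h1 : 1 ≤ ‖z‖ := by simpa using hz
    exact div_le_self (abs_nonneg _) (Real.one_le_rpow h1 hs.le)

theorem integrable_div_norm_rpow (hN : 1 ≤ N) {s : ℝ} (hs : 0 < s) (hsN : s < N)
    {ψ : RN N → ℝ} (hψ : Integrable ψ) {M : ℝ} (hM : ∀ᵐ y, |ψ y| ≤ M) (x : RN N) :
    Integrable (fun y => ψ y / ‖x - y‖ ^ s) ∧
      ∫ y, |ψ y / ‖x - y‖ ^ s| ≤ M * kernelMass N s + ∫ y, |ψ y| := by
  have hk := (integrable_indicator_ball_norm_rpow hN hsN).comp_sub_left x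
  have hd : Integrable (fun y => M * (Metric.ball (0 : RN N) 1).indicator
      (fun z => ‖z‖ ^ (-s)) (x - y) + |ψ y|) := (hk.const_mul M).add hψ.abs
  have hb : ∀ᵐ y, |ψ y / ‖x - y‖ ^ s| ≤ M * (Metric.ball (0 : RN N) 1).indicator
      (fun z => ‖z‖ ^ (-s)) (x - y) + |ψ y| := by
    filter_upwards [hM] with y hy using div_norm_rpow_le hs hy
  have hm : AEStronglyMeasurable (fun y => ψ y / ‖x - y‖ ^ s) volume :=
    hψ.aestronglyMeasurable.div₀ (by fun_prop : Measurable fun y : RN N => ‖x - y‖ ^ s).aestronglyMeasurable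
  have hi : Integrable (fun y => ψ y / ‖x - y‖ ^ s) := hd.mono' hm hb
  refine ⟨hi, (integral_mono_ae hi.abs hd hb).trans ?_⟩
  rw [integral_add (hk.const_mul M) hψ.abs, integral_const_mul,
    integral_sub_left_eq_self (fun y => (Metric.ball (0 : RN N) 1).indicator
      (fun z => ‖z‖ ^ (-s)) y) volume x]
  rfl

/-- Fubini is justified by integrating first in the variable of the bounded factor ψ, where the
bound is uniform; then only integrability of u is left to use. -/
theorem integrable_prod_div_norm_rpow (hN : 1 ≤ N) {s : ℝ} (hs : 0 < s) (hsN : s < N)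
    {u ψ : RN N → ℝ} (hu : Integrable u) (hψ : Integrable ψ) {M : ℝ} (hM : ∀ᵐ y, |ψ y| ≤ M) :
    Integrable (fun p : RN N × RN N => u p.2 / ‖p.1 - p.2‖ ^ s * ψ p.1)
      (volume.prod volume) := by
  have hm : AEStronglyMeasurable (fun p : RN N × RN N => u p.2 / ‖p.1 - p.2‖ ^ s * ψ p.1)
      (volume.prod volume) :=
    (hu.aestronglyMeasurable.comp_snd.div₀ (by fun_prop : Measurable
      fun p : RN N × RN N => ‖p.1 - p.2‖ ^ s).aestronglyMeasurable).mul
      hψ.aestronglyMeasurable.comp_fst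
  have key : ∀ x y : RN N, u y / ‖x - y‖ ^ s * ψ x = u y * (ψ x / ‖y - x‖ ^ s) := fun x y => by
    rw [norm_sub_rev]; ring
  have hj := integrable_div_norm_rpow hN hs hsN hψ hM
  refine (integrable_prod_iff' hm).2 ⟨ae_of_all _ fun y => ?_, ?_⟩
  · simp only [key]
    exact (hj y).1.const_mul _
  · refine (hu.abs.mul_const (M * kernelMass N s + ∫ y, |ψ y|)).mono'
      hm.norm.prod_swap.integral_prod_right' (ae_of_all _ fun y => ?_)
    rw [Real.norm_of_nonneg (integral_nonneg fun _ => norm_nonneg _)]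
    simp only [key, Real.norm_eq_abs]
    simp_rw [abs_mul (u y)]
    rw [integral_const_mul]
    exact mul_le_mul_of_nonneg_left (hj y).2 (abs_nonneg _)

/-! ### The Riesz potential of integrable functions -/

theorem ae_integrable_div_norm_rpow (hN : 1 ≤ N) {s : ℝ} (hs : 0 < s) (hsN : s < N)
    {u : RN N → ℝ} (hu : Integrable u) :
    ∀ᵐ x : RN N, Integrable (fun y => u y / ‖x - y‖ ^ s) := by
  have h : ∀ n : ℕ, ∀ᵐ x : RN N, x ∈ Metric.ball (0 : RN N) n →
      Integrable (fun y => u y / ‖x - y‖ ^ s) := by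
    intro n
    have hψ : Integrable ((Metric.ball (0 : RN N) n).indicator fun _ => (1 : ℝ)) :=
      (integrable_indicator_iff measurableSet_ball).2
        (integrableOn_const measure_ball_lt_top.ne)
    have := integrable_prod_div_norm_rpow hN hs hsN hu hψ (M := 1) (ae_of_all _ fun y => by
      by_cases hy : y ∈ Metric.ball (0 : RN N) n <;> simp [indicator, hy])
    filter_upwards [this.prod_right_ae] with x hx hxn
    simpa [indicator_of_mem hxn] using hx
  filter_upwards [ae_all_iff.2 h] with x hx
  obtain ⟨n, hn⟩ := exists_nat_gt ‖x‖
  exact hx n (by simpa using hn)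

theorem integrableOn_rieszPotential (hN : 1 ≤ N) {α : ℝ} (hα : 0 < α) (hαN : α < N)
    {u ψ : RN N → ℝ} (hu : Integrable u) (hψ : Integrable ψ) {M : ℝ} (hM : ∀ᵐ y, |ψ y| ≤ M) :
    Integrable (fun x => rieszPotential α u x * ψ x) := by
  have := (integrable_prod_div_norm_rpow hN (s := (N : ℝ) - α) (by linarith) (by linarith)
    hu hψ hM).integral_prod_left
  simp only [integral_mul_const] at this
  simpa only [rieszPotential, mul_assoc] using this.const_mul (rieszConst N α)

theorem hasRieszPotential_of_integrable (hN : 1 ≤ N) {α : ℝ} (hα : 0 < α) (hαN : α < N)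
    {u : RN N → ℝ} (hu : Integrable u) : HasRieszPotential α u := by
  refine ⟨ae_integrable_div_norm_rpow hN (by linarith) (by linarith) hu, ?_⟩
  rw [locallyIntegrable_iff]
  intro K hK
  have hψ : Integrable (K.indicator fun _ => (1 : ℝ)) (volume : Measure (RN N)) :=
    (integrable_indicator_iff hK.measurableSet).2 (integrableOn_const hK.measure_lt_top.ne)
  have := integrableOn_rieszPotential hN hα hαN hu hψ (M := 1) (ae_of_all _ fun y => by
      by_cases hy : y ∈ K <;> simp [indicator, hy])
  rw [← integrable_indicator_iff hK.measurableSet]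
  refine this.congr (ae_of_all _ fun x => ?_)
  by_cases hx : x ∈ K <;> simp [indicator, hx]

/-- Self-adjointness of I_α, from the symmetry of the kernel, in the pairing of L¹ with L¹ ∩ L^∞. -/
theorem integral_rieszPotential_mul (hN : 1 ≤ N) {α : ℝ} (hα : 0 < α) (hαN : α < N)
    {u ψ : RN N → ℝ} (hu : Integrable u) (hψ : Integrable ψ) {M : ℝ} (hM : ∀ᵐ y, |ψ y| ≤ M) :
    ∫ x, rieszPotential α u x * ψ x = ∫ x, u x * rieszPotential α ψ x := by
  have hi := integrable_prod_div_norm_rpow hN (s := (N : ℝ) - α) (by linarith) (by linarith)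
    hu hψ hM
  have := integral_integral_swap
    (f := fun x y => u y / ‖x - y‖ ^ ((N : ℝ) - α) * ψ x) hi
  simp only [integral_mul_const] at this
  simp only [rieszPotential, mul_assoc, integral_const_mul, this]
  rw [← integral_const_mul]
  refine integral_congr_ae (ae_of_all _ fun y => ?_)
  simp only
  rw [mul_left_comm, ← integral_const_mul (u y)]
  congr 1
  refine integral_congr_ae (ae_of_all _ fun x => ?_)
  simp only
  rw [norm_sub_rev]; ring

theorem rieszConst_pos {α : ℝ} (hα : 0 < α) (hαN : α < N) : 0 < rieszConst N α := by
  have h1 : 0 < Real.Gamma (((N : ℝ) - α) / 2) := Real.Gamma_pos_of_pos (by linarith)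
  have h2 : 0 < Real.Gamma (α / 2) := Real.Gamma_pos_of_pos (by linarith)
  have := Real.pi_pos
  unfold rieszConst
  positivity

theorem abs_rieszPotential_le (hN : 1 ≤ N) {α : ℝ} (hα : 0 < α) (hαN : α < N)
    {ψ : RN N → ℝ} (hψ : Integrable ψ) {M : ℝ} (hM : ∀ᵐ y, |ψ y| ≤ M) (x : RN N) :
    |rieszPotential α ψ x| ≤
      rieszConst N α * (M * kernelMass N (N - α) + ∫ y, |ψ y|) := by
  have h := integrable_div_norm_rpow hN (s := (N : ℝ) - α) (by linarith) (by linarith) hψ hM x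
  have hc := (rieszConst_pos (N := N) hα hαN).le
  rw [rieszPotential, abs_mul, abs_of_nonneg hc]
  exact mul_le_mul_of_nonneg_left ((abs_integral_le_integral_abs).trans h.2) hc

theorem rieszPotential_congr_ae {α : ℝ} {u v : RN N → ℝ} (h : u =ᵐ[volume] v) :
    rieszPotential α u = rieszPotential α v := by
  funext x
  simp only [rieszPotential]
  congr 1
  refine integral_congr_ae ?_
  filter_upwards [h] with y hy
  simp only [hy]

end FracGrad
end

noncomputable section

namespace FracGrad

variable {N : ℕ}

/-! ### Test functions and their fractional gradients -/

/-- The partial derivative `∂_j φ`. -/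
def pderiv (j : Fin N) (φ : RN N → ℝ) (x : RN N) : ℝ :=
  fderiv ℝ φ x (EuclideanSpace.single j 1)

theorem IsTest.continuous {U : Set (RN N)} {φ : RN N → ℝ} (h : IsTest U φ) : Continuous φ :=
  h.1.continuous

theorem IsTest.integrable {U : Set (RN N)} {φ : RN N → ℝ} (h : IsTest U φ) : Integrable φ :=
  h.continuous.integrable_of_hasCompactSupport h.2.1

theorem IsTest.memLp {U : Set (RN N)} {φ : RN N → ℝ} (h : IsTest U φ) (p : ℝ≥0∞) :
    MemLp φ p volume :=
  h.continuous.memLp_of_hasCompactSupport h.2.1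

theorem IsTest.exists_abs_le {U : Set (RN N)} {φ : RN N → ℝ} (h : IsTest U φ) :
    ∃ M, ∀ x, |φ x| ≤ M := by
  obtain ⟨M, hM⟩ := h.2.1.exists_bound_of_continuous h.continuous
  exact ⟨M, hM⟩

theorem IsTest.isTest_pderiv {U : Set (RN N)} {φ : RN N → ℝ} (h : IsTest U φ) (j : Fin N) :
    IsTest U (pderiv j φ) := by
  refine ⟨(h.1.fderiv_right (m := ∞) (by simp)).clm_apply contDiff_const,
    h.2.1.fderiv_apply ℝ _, (tsupport_fderiv_apply_subset ℝ _).trans h.2.2⟩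

theorem isTest_zero (U : Set (RN N)) : IsTest U (0 : RN N → ℝ) :=
  ⟨contDiff_const, HasCompactSupport.zero, by simp [tsupport]⟩

theorem IsTest.add {U : Set (RN N)} {φ ψ : RN N → ℝ} (hφ : IsTest U φ) (hψ : IsTest U ψ) :
    IsTest U (φ + ψ) :=
  ⟨hφ.1.add hψ.1, hφ.2.1.add hψ.2.1,
    (tsupport_add φ ψ).trans (union_subset hφ.2.2 hψ.2.2)⟩

theorem IsTest.smul {U : Set (RN N)} {φ : RN N → ℝ} (c : ℝ) (hφ : IsTest U φ) :
    IsTest U (c • φ) :=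
  ⟨contDiff_const.smul hφ.1, hφ.2.1.mul_left (f := fun _ => c),
    (tsupport_smul_subset_right (fun _ => c) φ).trans hφ.2.2⟩

/-! ### Riesz potentials of test functions: derivatives, decay and square integrability. -/

theorem locallyIntegrable_norm_rpow (hN : 1 ≤ N) {s : ℝ} (hsN : s < N) :
    LocallyIntegrable (fun z : RN N => ‖z‖ ^ (-s)) volume := by
  refine locallyIntegrable_of_norm_le_rpow (C := 1) (α := s) (by simpa using hN)
    (by simpa using hsN) (ae_of_all _ fun x => ?_)
    (by fun_prop : Measurable fun z : RN N => ‖z‖ ^ (-s)).aestronglyMeasurable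
  rw [Real.norm_of_nonneg (by positivity), one_mul]

open scoped Convolution in
theorem rieszPotential_eq_convolution (α : ℝ) (φ : RN N → ℝ) :
    rieszPotential α φ = fun x => rieszConst N α *
      ((fun z : RN N => ‖z‖ ^ (-((N : ℝ) - α))) ⋆[ContinuousLinearMap.mul ℝ ℝ, volume] φ) x := by
  funext x
  rw [rieszPotential, convolution_eq_swap]
  congr 1
  refine integral_congr_ae (ae_of_all _ fun y => ?_)
  simp only [ContinuousLinearMap.mul_apply']
  rw [Real.rpow_neg (norm_nonneg _), mul_comm, div_eq_mul_inv]

/-- I_α φ is a convolution with a locally integrable kernel, so every derivative can be placed on φ.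
-/
theorem IsTest.hasFDerivAt_rieszPotential (hN : 1 ≤ N) {α : ℝ} (hα : 0 < α)
    {U : Set (RN N)} {φ : RN N → ℝ} (h : IsTest U φ) (x : RN N) :
    DifferentiableAt ℝ (rieszPotential α φ) x ∧
      ∀ j, pderiv j (rieszPotential α φ) x = rieszPotential α (pderiv j φ) x := by
  have hk := locallyIntegrable_norm_rpow hN (s := (N : ℝ) - α) (by linarith)
  have hd := (h.2.1.hasFDerivAt_convolution_right (ContinuousLinearMap.mul ℝ ℝ) hk
    (h.1.of_le (by simp)) x).const_mul (rieszConst N α)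
  rw [← rieszPotential_eq_convolution] at hd
  refine ⟨hd.differentiableAt, fun j => ?_⟩
  rw [pderiv, hd.fderiv, rieszPotential_eq_convolution]
  simp only [_root_.smul_apply, smul_eq_mul]
  rw [convolution_precompR_apply _ hk (h.2.1.fderiv ℝ) (h.1.continuous_fderiv (by simp))]
  rfl

theorem IsTest.continuous_rieszPotential (hN : 1 ≤ N) {α : ℝ} (hα : 0 < α)
    {U : Set (RN N)} {φ : RN N → ℝ} (h : IsTest U φ) : Continuous (rieszPotential α φ) :=
  continuous_iff_continuousAt.2 fun x => (h.hasFDerivAt_rieszPotential hN hα x).1.continuousAt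

theorem IsTest.integral_pderiv_eq_zero {U : Set (RN N)} {φ : RN N → ℝ} (h : IsTest U φ)
    (j : Fin N) : ∫ x, pderiv j φ x = 0 := by
  have := integral_mul_fderiv_eq_neg_fderiv_mul_of_integrable (μ := (volume : Measure (RN N)))
    (f := fun _ => (1 : ℝ)) (g := φ) (v := EuclideanSpace.single j 1) (by simp)
    (by simpa [pderiv] using! (h.isTest_pderiv j).integrable) (by simpa using h.integrable)
    (fun _ _ => by fun_prop) (fun x _ => (h.1.differentiable (by simp)).differentiableAt)
  simpa [pderiv] using this

/-- The classical fractional gradient `(I_α ∂_j φ)_j`. -/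
def testGrad (α : ℝ) (φ : RN N → ℝ) (x : RN N) : RN N :=
  WithLp.toLp 2 fun j => rieszPotential α (pderiv j φ) x

@[simp] theorem testGrad_apply (α : ℝ) (φ : RN N → ℝ) (x : RN N) (j : Fin N) :
    testGrad α φ x j = rieszPotential α (pderiv j φ) x := rfl

theorem locallyIntegrable_piLp_iff {F : RN N → RN N} :
    LocallyIntegrable F volume ↔ ∀ j, LocallyIntegrable (fun x => F x j) volume := by
  simp only [locallyIntegrable_iff, IntegrableOn, integrable_piLp_iff]
  exact ⟨fun h j K hK => h K hK j, fun h K hK j => h j K hK⟩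

theorem IsTest.isFracGrad (hN : 1 ≤ N) {σ : ℝ} (hσ0 : 0 < σ) (hσ1 : σ < 1)
    {U : Set (RN N)} {φ : RN N → ℝ} (h : IsTest U φ) :
    IsFracGrad σ φ (testGrad (1 - σ) φ) := by
  have hα : 0 < 1 - σ := by linarith
  have hαN : 1 - σ < N := by
    have : (1 : ℝ) ≤ N := by exact_mod_cast hN
    linarith
  refine ⟨hasRieszPotential_of_integrable hN hα hαN h.integrable, ?_, fun ψ hψ j => ?_⟩
  · rw [locallyIntegrable_piLp_iff]
    exact fun j => (hasRieszPotential_of_integrable hN hα hαN (h.isTest_pderiv j).integrable).2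
  · obtain ⟨M, hM⟩ := hψ.exists_abs_le
    obtain ⟨M', hM'⟩ := (hψ.isTest_pderiv j).exists_abs_le
    have hd := h.hasFDerivAt_rieszPotential hN hα
    have e : ∀ x, fderiv ℝ (rieszPotential (1 - σ) φ) x (EuclideanSpace.single j 1)
        = rieszPotential (1 - σ) (pderiv j φ) x := fun x => (hd x).2 j
    have := integral_mul_fderiv_eq_neg_fderiv_mul_of_integrable (μ := (volume : Measure (RN N)))
      (f := rieszPotential (1 - σ) φ) (g := ψ) (v := EuclideanSpace.single j 1)
      ((integrableOn_rieszPotential hN hα hαN (h.isTest_pderiv j).integrable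
        hψ.integrable (ae_of_all _ hM)).congr (ae_of_all _ fun x => by simp only [e]))
      (integrableOn_rieszPotential hN hα hαN h.integrable
        (hψ.isTest_pderiv j).integrable (ae_of_all _ hM'))
      (integrableOn_rieszPotential hN hα hαN h.integrable hψ.integrable (ae_of_all _ hM))
      (fun x _ => (hd x).1) (fun x _ => (hψ.1.differentiable (by simp)).differentiableAt)
    simp only [e] at this
    exact this

theorem abs_rpow_neg_sub_le {s m a b : ℝ} (hs : 0 < s) (hm : 0 < m) (ha : m ≤ a) (hb : m ≤ b) :
    |a ^ (-s) - b ^ (-s)| ≤ s * m ^ (-s - 1) * |a - b| := by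
  refine (convex_Ici m).norm_image_sub_le_of_norm_hasDerivWithin_le
    (f := fun t : ℝ => t ^ (-s)) (f' := fun t : ℝ => -s * t ^ (-s - 1)) (fun x hx => ?_)
    (fun x hx => ?_) hb ha
  · exact (Real.hasDerivAt_rpow_const (Or.inl (hm.trans_le hx).ne')).hasDerivWithinAt
  · have hx0 : 0 < x := hm.trans_le hx
    rw [norm_mul, norm_neg, Real.norm_of_nonneg hs.le, Real.norm_of_nonneg (by positivity)]
    exact mul_le_mul_of_nonneg_left
      (Real.rpow_le_rpow_of_nonpos hm hx (by linarith)) hs.le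

/-- Since ∂_jφ has mean zero, the kernel may be replaced by its difference with ‖x‖^{−(N−α)}, and
the mean value inequality gains one power of decay over the kernel itself. -/
theorem IsTest.exists_rieszPotential_pderiv_le (hN : 1 ≤ N) {α : ℝ} (hα : 0 < α) (hαN : α < N)
    {U : Set (RN N)} {φ : RN N → ℝ} (h : IsTest U φ) (j : Fin N) :
    ∃ C, ∀ x, |rieszPotential α (pderiv j φ) x| ≤ C * (1 + ‖x‖) ^ (-(N - α + 1)) := by
  have hp := h.isTest_pderiv j
  obtain ⟨M, hM⟩ := hp.exists_abs_le
  obtain ⟨R, hR1, hR⟩ : ∃ R : ℝ, 1 ≤ R ∧ ∀ y, pderiv j φ y ≠ 0 → ‖y‖ ≤ R := by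
    obtain ⟨R, hR⟩ := hp.2.1.isCompact.isBounded.exists_norm_le
    exact ⟨max R 1, le_max_right _ _,
      fun y hy => (hR y (subset_tsupport _ hy)).trans (le_max_left _ _)⟩
  set s : ℝ := N - α with hs
  have hs0 : 0 < s := by rw [hs]; linarith
  have hsN : s < N := by rw [hs]; linarith
  set c := rieszConst N α
  have hc : 0 < c := rieszConst_pos hα hαN
  set I := ∫ y, |pderiv j φ y|
  have hI : 0 ≤ I := integral_nonneg fun _ => abs_nonneg _
  set B := c * (M * kernelMass N s + I)
  have hB : ∀ x, |rieszPotential α (pderiv j φ) x| ≤ B :=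
    abs_rieszPotential_le hN hα hαN hp.integrable (ae_of_all _ hM)
  have hB0 : 0 ≤ B := (abs_nonneg _).trans (hB 0)
  -- The first summand handles ‖x‖ < 2R through the sup bound B. The second handles ‖x‖ ≥ 2R, where
  -- both distances are at least ‖x‖/2, and ‖x‖/2 ≥ (1 + ‖x‖)/4 because R ≥ 1.
  refine ⟨B * (1 + 2 * R) ^ (s + 1) + c * (s * R * I) * 4 ^ (s + 1), fun x => ?_⟩
  have hx1 : 0 < 1 + ‖x‖ := by positivity
  have hR0 : 0 < R := by linarith
  rw [add_mul]
  rcases lt_or_ge ‖x‖ (2 * R) with hx | hx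
  · have h1 : B ≤ B * (1 + 2 * R) ^ (s + 1) * (1 + ‖x‖) ^ (-(s + 1)) := by
      rw [mul_assoc]
      refine le_mul_of_one_le_right hB0 ?_
      rw [Real.rpow_neg hx1.le, ← div_eq_mul_inv, one_le_div (by positivity)]
      exact Real.rpow_le_rpow hx1.le (by linarith) (by linarith)
    have h2 : 0 ≤ c * (s * R * I) * 4 ^ (s + 1) * (1 + ‖x‖) ^ (-(s + 1)) := by positivity
    linarith [hB x]
  · have hx0 : 0 < ‖x‖ := by linarith
    have hi := (integrable_div_norm_rpow hN hs0 hsN hp.integrable (ae_of_all _ hM) x).1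
    have e : rieszPotential α (pderiv j φ) x
        = c * ∫ y, pderiv j φ y * (‖x - y‖ ^ (-s) - ‖x‖ ^ (-s)) := by
      rw [rieszPotential]
      congr 1
      simp only [mul_sub, ← hs]
      have e1 : ∀ y, pderiv j φ y * ‖x - y‖ ^ (-s)
          = pderiv j φ y / ‖x - y‖ ^ s := fun y => by
        rw [Real.rpow_neg (norm_nonneg _), div_eq_mul_inv]
      simp only [e1]
      rw [integral_sub hi (hp.integrable.mul_const _), integral_mul_const,
        h.integral_pderiv_eq_zero, zero_mul, sub_zero]
    have hb : ∀ y, |pderiv j φ y * (‖x - y‖ ^ (-s) - ‖x‖ ^ (-s))|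
        ≤ |pderiv j φ y| * (s * (‖x‖ / 2) ^ (-s - 1) * R) := fun y => by
      rw [abs_mul]
      by_cases hy : pderiv j φ y = 0
      · simp [hy]
      · have hyR := hR y hy
        refine mul_le_mul_of_nonneg_left ?_ (abs_nonneg _)
        have h1 := norm_sub_norm_le x y
        refine (abs_rpow_neg_sub_le hs0 (m := ‖x‖ / 2) (by linarith) (by linarith)
          (by linarith)).trans ?_
        refine mul_le_mul_of_nonneg_left ?_ (by positivity)
        have := abs_norm_sub_norm_le (x - y) x
        refine this.trans ?_
        simpa using hyR
    have hi2 : ∫ y, |pderiv j φ y| * (s * (‖x‖ / 2) ^ (-s - 1) * R)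
        = I * (s * (‖x‖ / 2) ^ (-s - 1) * R) := integral_mul_const _ _
    have h3 : (‖x‖ / 2) ^ (-s - 1) ≤ 4 ^ (s + 1) * (1 + ‖x‖) ^ (-(s + 1)) := by
      have : ((1 + ‖x‖) / 4) ^ (-(s + 1)) = 4 ^ (s + 1) * (1 + ‖x‖) ^ (-(s + 1)) := by
        rw [Real.div_rpow hx1.le (by norm_num), Real.rpow_neg (by norm_num : (0 : ℝ) ≤ 4),
          div_inv_eq_mul, mul_comm]
      rw [← this, show -s - 1 = -(s + 1) by ring]
      exact Real.rpow_le_rpow_of_nonpos (by positivity) (by linarith) (by linarith)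
    have h4 : |rieszPotential α (pderiv j φ) x|
        ≤ c * (I * (s * (‖x‖ / 2) ^ (-s - 1) * R)) := by
      rw [e, abs_mul, abs_of_pos hc, ← hi2]
      refine mul_le_mul_of_nonneg_left (abs_integral_le_integral_abs.trans ?_) hc.le
      refine integral_mono_of_nonneg (ae_of_all _ fun _ => abs_nonneg _)
        (hp.integrable.abs.mul_const _) (ae_of_all _ hb)
    have h5 : c * (I * (s * (‖x‖ / 2) ^ (-s - 1) * R))
        ≤ c * (s * R * I) * 4 ^ (s + 1) * (1 + ‖x‖) ^ (-(s + 1)) := by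
      have := mul_le_mul_of_nonneg_left h3 (by positivity : 0 ≤ c * (s * R * I))
      calc _ = c * (s * R * I) * (‖x‖ / 2) ^ (-s - 1) := by ring
        _ ≤ _ := this
        _ = _ := by ring
    have h6 : 0 ≤ B * (1 + 2 * R) ^ (s + 1) * (1 + ‖x‖) ^ (-(s + 1)) := by positivity
    linarith

/-- The decay exponent N − α + 1 exceeds N exactly because α < 1; a bounded integrable function is
square integrable. -/
theorem IsTest.memLp_testGrad (hN : 1 ≤ N) {α : ℝ} (hα : 0 < α) (hα1 : α < 1)
    {U : Set (RN N)} {φ : RN N → ℝ} (h : IsTest U φ) : MemLp (testGrad α φ) 2 volume := by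
  have hαN : α < N := by
    have : (1 : ℝ) ≤ N := by exact_mod_cast hN
    linarith
  rw [memLp_piLp_iff]
  intro j
  obtain ⟨C, hC⟩ := h.exists_rieszPotential_pderiv_le hN hα hαN j
  obtain ⟨M, hM⟩ := (h.isTest_pderiv j).exists_abs_le
  have hB := abs_rieszPotential_le hN hα hαN (h.isTest_pderiv j).integrable (ae_of_all _ hM)
  have hm := ((h.isTest_pderiv j).continuous_rieszPotential hN hα).aestronglyMeasurable
    (μ := (volume : Measure (RN N)))
  have hi : Integrable (rieszPotential α (pderiv j φ)) :=
    ((integrable_one_add_norm (μ := (volume : Measure (RN N))) (r := (N : ℝ) - α + 1)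
      (by rw [finrank_euclideanSpace_fin]; linarith)).const_mul C).mono' hm (ae_of_all _ hC)
  refine (memLp_two_iff_integrable_sq hm).2 ?_
  simp only [sq]
  exact hi.bdd_mul hm (ae_of_all _ hB)

/-! ### Uniqueness and duality for the weak fractional gradient. -/

theorem IsFracGrad.ae_eq {σ : ℝ} {u : RN N → ℝ} {F G : RN N → RN N}
    (hF : IsFracGrad σ u F) (hG : IsFracGrad σ u G) : F =ᵐ[volume] G := by
  have : ∀ j, ∀ᵐ x, F x j = G x j := fun j =>
    ae_eq_of_integral_contDiff_smul_eq (locallyIntegrable_piLp_iff.1 hF.2.1 j)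
      (locallyIntegrable_piLp_iff.1 hG.2.1 j) fun φ hφ hφc => by
        have h1 := hF.2.2 φ ⟨hφ, hφc, subset_univ _⟩ j
        have h2 := hG.2.2 φ ⟨hφ, hφc, subset_univ _⟩ j
        simp only [smul_eq_mul, mul_comm (φ _)]
        linarith
  filter_upwards [ae_all_iff.2 this] with x hx
  ext j
  exact hx j

theorem fracGrad_spec {σ : ℝ} {u : RN N → ℝ} (h : ∃ F, IsFracGrad σ u F) :
    IsFracGrad σ u (fracGrad σ u) := by
  rw [fracGrad, dif_pos h]
  exact h.choose_spec

theorem IsFracGrad.fracGrad_ae_eq {σ : ℝ} {u : RN N → ℝ} {F : RN N → RN N}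
    (hF : IsFracGrad σ u F) : fracGrad σ u =ᵐ[volume] F :=
  (fracGrad_spec ⟨F, hF⟩).ae_eq hF

/-- For integrable `u`, the weak gradient of `I_{1-σ} u` can be tested on the `u` side. -/
theorem isFracGrad_iff_of_integrable (hN : 1 ≤ N) {σ : ℝ} (hσ0 : 0 < σ) (hσ1 : σ < 1)
    {u : RN N → ℝ} (hu : Integrable u) {F : RN N → RN N} (hF : LocallyIntegrable F volume) :
    IsFracGrad σ u F ↔ ∀ φ : RN N → ℝ, IsTest univ φ → ∀ j : Fin N,
      ∫ x, u x * testGrad (1 - σ) φ x j = - ∫ x, F x j * φ x := by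
  have hα : 0 < 1 - σ := by linarith
  have hαN : 1 - σ < N := by
    have : (1 : ℝ) ≤ N := by exact_mod_cast hN
    linarith
  have key : ∀ φ : RN N → ℝ, IsTest univ φ → ∀ j : Fin N,
      ∫ x, rieszPotential (1 - σ) u x * fderiv ℝ φ x (EuclideanSpace.single j 1)
        = ∫ x, u x * testGrad (1 - σ) φ x j := fun φ hφ j => by
    obtain ⟨M, hM⟩ := (hφ.isTest_pderiv j).exists_abs_le
    exact integral_rieszPotential_mul hN hα hαN hu (hφ.isTest_pderiv j).integrable (ae_of_all _ hM)
  refine ⟨fun h φ hφ j => (key φ hφ j).symm.trans (h.2.2 φ hφ j), fun h =>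
    ⟨hasRieszPotential_of_integrable hN hα hαN hu, hF,
      fun φ hφ j => (key φ hφ j).trans (h φ hφ j)⟩⟩

end FracGrad
end

noncomputable section

namespace FracGrad

variable {N : ℕ}

/-! ### Gaussian integrals and subordination of the Riesz kernel -/

theorem integrable_exp_neg_mul_norm_sq {b : ℝ} (hb : 0 < b) :
    Integrable (fun x : RN N => Real.exp (-b * ‖x‖ ^ 2)) := by
  refine Integrable.of_integral_ne_zero ?_
  rw [GaussianFourier.integral_rexp_neg_mul_sq_norm hb]
  have := Real.pi_pos
  positivity

/-- Half of the Gaussian exponent absorbs the factor r, since √b r ≤ 1 + b r²/2 ≤ e^{b r²/2}. -/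
theorem norm_mul_exp_le {b : ℝ} (hb : 0 < b) (r : ℝ) :
    r * Real.exp (-b * r ^ 2) ≤ (√b)⁻¹ * Real.exp (-(b / 2) * r ^ 2) := by
  have hs : 0 < √b := Real.sqrt_pos.2 hb
  have h1 : √b * r ≤ Real.exp (b / 2 * r ^ 2) := by
    have h2 := Real.add_one_le_exp (b / 2 * r ^ 2)
    have h3 : (√b * r) ^ 2 = b * r ^ 2 := by rw [mul_pow, Real.sq_sqrt hb.le]
    nlinarith [sq_nonneg (√b * r - 1)]
  have h4 : Real.exp (-(b / 2) * r ^ 2) = Real.exp (b / 2 * r ^ 2) * Real.exp (-b * r ^ 2) := by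
    rw [← Real.exp_add]; congr 1; ring
  rw [h4, inv_mul_eq_div, le_div_iff₀ hs]
  nlinarith [mul_le_mul_of_nonneg_right h1 (Real.exp_pos (-b * r ^ 2)).le]

theorem integrable_norm_mul_exp {b : ℝ} (hb : 0 < b) :
    Integrable (fun x : RN N => ‖x‖ * Real.exp (-b * ‖x‖ ^ 2)) := by
  refine ((integrable_exp_neg_mul_norm_sq (half_pos hb)).const_mul (√b)⁻¹).mono'
    (by fun_prop) (ae_of_all _ fun x => ?_)
  rw [Real.norm_of_nonneg (by positivity)]
  exact norm_mul_exp_le hb _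

theorem abs_apply_le_norm (x : RN N) (j : Fin N) : |x j| ≤ ‖x‖ := PiLp.norm_apply_le x j

theorem integrable_apply_mul_exp {b : ℝ} (hb : 0 < b) (j : Fin N) :
    Integrable (fun x : RN N => x j * Real.exp (-b * ‖x‖ ^ 2)) := by
  refine (integrable_norm_mul_exp hb).mono' (by fun_prop) (ae_of_all _ fun x => ?_)
  rw [norm_mul, Real.norm_of_nonneg (Real.exp_pos _).le]
  exact mul_le_mul_of_nonneg_right (abs_apply_le_norm x j) (Real.exp_pos _).le

theorem integral_apply_mul_exp (b : ℝ) (j : Fin N) :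
    ∫ x : RN N, x j * Real.exp (-b * ‖x‖ ^ 2) = 0 := by
  have := integral_neg_eq_self (fun x : RN N => x j * Real.exp (-b * ‖x‖ ^ 2)) volume
  simp only [PiLp.neg_apply, norm_neg, neg_mul, integral_neg] at this
  simp only [neg_mul]
  linarith

/-- Completing the square about θx with θ = τ/(τ+1) turns the exponent into −θ‖x‖² − (τ+1)‖z‖². The
odd part integrates to zero and only the shift θ x_j survives. -/
theorem integral_apply_mul_exp_mul_exp {τ : ℝ} (hτ : 0 < τ) (x : RN N) (j : Fin N) :
    ∫ y : RN N, y j * Real.exp (-1 * ‖y‖ ^ 2) * Real.exp (-τ * ‖x - y‖ ^ 2)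
      = x j * (τ / (τ + 1) * (Real.pi / (τ + 1)) ^ ((N : ℝ) / 2)
          * Real.exp (-(τ / (τ + 1)) * ‖x‖ ^ 2)) := by
  have hτ1 : 0 < τ + 1 := by linarith
  set θ := τ / (τ + 1) with hθ
  have hθτ : θ * (τ + 1) = τ := div_mul_cancel₀ _ hτ1.ne'
  rw [← integral_add_right_eq_self _ (θ • x)]
  have e : ∀ z : RN N, (z + θ • x) j * Real.exp (-1 * ‖z + θ • x‖ ^ 2)
      * Real.exp (-τ * ‖x - (z + θ • x)‖ ^ 2)
      = Real.exp (-θ * ‖x‖ ^ 2) * (z j * Real.exp (-(τ + 1) * ‖z‖ ^ 2))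
        + θ * x j * Real.exp (-θ * ‖x‖ ^ 2) * Real.exp (-(τ + 1) * ‖z‖ ^ 2) := fun z => by
    have h1 : ‖z + θ • x‖ ^ 2 = ‖z‖ ^ 2 + 2 * θ * ⟪z, x⟫ + θ ^ 2 * ‖x‖ ^ 2 := by
      rw [norm_add_sq_real, inner_smul_right, norm_smul, mul_pow, Real.norm_eq_abs, sq_abs]
      ring
    have h2 : ‖x - (z + θ • x)‖ ^ 2
        = ‖z‖ ^ 2 - 2 * (1 - θ) * ⟪z, x⟫ + (1 - θ) ^ 2 * ‖x‖ ^ 2 := by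
      have : x - (z + θ • x) = (1 - θ) • x - z := by module
      rw [this, norm_sub_sq_real, inner_smul_left, norm_smul, mul_pow, Real.norm_eq_abs, sq_abs,
        real_inner_comm]
      simp only [RCLike.conj_to_real]
      ring
    have h3 : -1 * ‖z + θ • x‖ ^ 2 + -τ * ‖x - (z + θ • x)‖ ^ 2
        = -θ * ‖x‖ ^ 2 + -(τ + 1) * ‖z‖ ^ 2 := by
      rw [h1, h2]
      linear_combination (2 * ⟪z, x⟫ * (-1) + (-1) * θ * ‖x‖ ^ 2 + 2 * ‖x‖ ^ 2 - ‖x‖^2) * hθτ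
    rw [mul_assoc, ← Real.exp_add, h3, Real.exp_add]
    simp only [PiLp.add_apply, PiLp.smul_apply, smul_eq_mul]
    ring
  simp only [e]
  rw [integral_add ((integrable_apply_mul_exp hτ1 j).const_mul _)
    ((integrable_exp_neg_mul_norm_sq hτ1).const_mul _), integral_const_mul, integral_const_mul,
    integral_apply_mul_exp, GaussianFourier.integral_rexp_neg_mul_sq_norm hτ1]
  simp only [finrank_euclideanSpace_fin]
  ring

/-- Subordination: the Riesz kernel r^{−s} is a superposition of Gaussians. -/
theorem integral_rpow_mul_exp_neg_mul_sq {s r : ℝ} (hs : 0 < s) (hr : 0 < r) :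
    ∫ τ in Ioi (0 : ℝ), τ ^ (s / 2 - 1) * Real.exp (-τ * r ^ 2)
      = Real.Gamma (s / 2) / r ^ s := by
  have := Real.integral_rpow_mul_exp_neg_mul_Ioi (half_pos hs) (pow_pos hr 2)
  have e : ∀ τ : ℝ, -τ * r ^ 2 = -(r ^ 2 * τ) := fun τ => by ring
  simp only [e]
  rw [this, ← Real.rpow_natCast r 2, one_div, Real.inv_rpow (by positivity), ← Real.rpow_mul hr.le,
    inv_mul_eq_div]
  congr 2
  push_cast
  ring

theorem integrableOn_rpow_mul_exp_neg_mul_sq {s r : ℝ} (hs : 0 < s) (hr : 0 < r) :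
    IntegrableOn (fun τ : ℝ => τ ^ (s / 2 - 1) * Real.exp (-τ * r ^ 2)) (Ioi 0) := by
  refine Integrable.of_integral_ne_zero ?_
  rw [integral_rpow_mul_exp_neg_mul_sq hs hr]
  have := Real.Gamma_pos_of_pos (half_pos hs)
  positivity

theorem integrableOn_rpow_mul_add_one_rpow {a b : ℝ} (ha : -1 < a) (hb : 0 ≤ b)
    (hab : a - b < -1) :
    IntegrableOn (fun τ : ℝ => τ ^ a * (τ + 1) ^ (-b)) (Ioi 0) := by
  have hm : Measurable (fun τ : ℝ => τ ^ a * (τ + 1) ^ (-b)) := by fun_prop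
  rw [← Ioc_union_Ioi_eq_Ioi zero_le_one]
  refine IntegrableOn.union ?_ ?_
  · have h1 : IntegrableOn (fun τ : ℝ => τ ^ a) (Ioc 0 1) :=
      (intervalIntegrable_iff_integrableOn_Ioc_of_le zero_le_one).1
        (intervalIntegral.intervalIntegrable_rpow' ha)
    refine Integrable.mono' h1 hm.aestronglyMeasurable
      ((ae_restrict_iff' measurableSet_Ioc).2 (ae_of_all _ fun τ hτ => ?_))
    have hτ0 := hτ.1
    rw [Real.norm_of_nonneg (by positivity)]
    exact mul_le_of_le_one_right (by positivity)
      (Real.rpow_le_one_of_one_le_of_nonpos (by linarith) (by linarith))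
  · have h1 : IntegrableOn (fun τ : ℝ => τ ^ (a - b)) (Ioi 1) :=
      integrableOn_Ioi_rpow_of_lt hab one_pos
    refine Integrable.mono' h1 hm.aestronglyMeasurable
      ((ae_restrict_iff' measurableSet_Ioi).2 (ae_of_all _ fun τ hτ => ?_))
    have hτ0 : 0 < τ := one_pos.trans hτ
    rw [Real.norm_of_nonneg (by positivity), sub_eq_add_neg, Real.rpow_add hτ0]
    exact mul_le_mul_of_nonneg_left
      (Real.rpow_le_rpow_of_nonpos hτ0 (by linarith) (neg_nonpos.2 hb)) (by positivity)

/-- The weight of the subordination formula for `heatProfile`. -/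
def heatWeight (N : ℕ) (α τ : ℝ) : ℝ :=
  τ ^ (((N : ℝ) - α) / 2 - 1) * (τ / (τ + 1) * (Real.pi / (τ + 1)) ^ ((N : ℝ) / 2))

/-- The radial function `ρ` with `I_α (y_j e^{-|y|²}) (x) = x_j ρ(x)`. -/
def heatProfile (α : ℝ) (x : RN N) : ℝ :=
  rieszConst N α / Real.Gamma (((N : ℝ) - α) / 2) *
    ∫ τ in Ioi (0 : ℝ), heatWeight N α τ * Real.exp (-(τ / (τ + 1)) * ‖x‖ ^ 2)

theorem heatWeight_pos {α τ : ℝ} (hτ : 0 < τ) : 0 < heatWeight N α τ := by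
  have := Real.pi_pos
  unfold heatWeight
  positivity

theorem measurable_heatWeight (α : ℝ) : Measurable (heatWeight N α) := by
  unfold heatWeight
  fun_prop

theorem integrableOn_heatWeight {α : ℝ} (hα : 0 < α) (hαN : α < N) :
    IntegrableOn (heatWeight N α) (Ioi 0) := by
  have h := (integrableOn_rpow_mul_add_one_rpow (a := ((N : ℝ) - α) / 2) (b := 1 + (N : ℝ) / 2)
    (by linarith) (by positivity) (by linarith)).const_mul (Real.pi ^ ((N : ℝ) / 2))
  refine IntegrableOn.congr_fun h (fun τ hτ => ?_) measurableSet_Ioi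
  have hτ0 : (0 : ℝ) < τ := hτ
  have hτ1 : 0 < τ + 1 := by linarith
  simp only [heatWeight]
  rw [Real.div_rpow Real.pi_pos.le hτ1.le, Real.rpow_neg hτ1.le, Real.rpow_add hτ1,
    Real.rpow_one, Real.rpow_sub_one hτ0.ne']
  field_simp

/-- This is the mass, at parameter τ, of the Gaussian majorant in `integrable_prod_heatWeight`. The
power of τ on the right is integrable at 0 because α < 1, and the product is integrable at infinity
because α > 0. -/
theorem heatWeight_mul_gaussian_eq {α τ : ℝ} (hτ : 0 < τ) :
    heatWeight N α τ * (2 * (√(τ / (τ + 1)))⁻¹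
        * (Real.pi / (τ / (τ + 1) / 2)) ^ ((N : ℝ) / 2))
      = 2 * Real.pi ^ ((N : ℝ) / 2) * (2 * Real.pi) ^ ((N : ℝ) / 2)
        * (τ ^ (-(α + 1) / 2) * (τ + 1) ^ (-(1 / 2 : ℝ))) := by
  have hτ1 : 0 < τ + 1 := by linarith
  have hpi := Real.pi_pos
  have e1 : Real.pi / (τ / (τ + 1) / 2) = 2 * Real.pi * (τ + 1) / τ := by field_simp
  have e2 : τ / (τ + 1) = τ ^ (1 : ℝ) * (τ + 1) ^ (-1 : ℝ) := by
    rw [Real.rpow_one, Real.rpow_neg_one]; rfl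
  have e3 : (√(τ / (τ + 1)))⁻¹ = τ ^ (-(1 / 2) : ℝ) * (τ + 1) ^ (1 / 2 : ℝ) := by
    rw [Real.sqrt_eq_rpow, Real.div_rpow hτ.le hτ1.le, Real.rpow_neg hτ.le]
    field_simp
  rw [heatWeight, e1, e3, e2, Real.div_rpow hpi.le hτ1.le,
    Real.div_rpow (by positivity) hτ.le, Real.mul_rpow (by positivity) hτ1.le]
  have e4 : τ ^ (-(α + 1) / 2) = τ ^ (((N : ℝ) - α) / 2 - 1) * τ ^ (1 : ℝ)
      * τ ^ (-(1 / 2) : ℝ) * τ ^ (-((N : ℝ) / 2)) := by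
    rw [← Real.rpow_add hτ, ← Real.rpow_add hτ, ← Real.rpow_add hτ]
    congr 1; ring
  have e5 : (τ + 1) ^ (-(1 / 2 : ℝ)) = (τ + 1) ^ (-1 : ℝ) * (τ + 1) ^ (-((N : ℝ) / 2))
      * (τ + 1) ^ (1 / 2 : ℝ) * (τ + 1) ^ ((N : ℝ) / 2) := by
    rw [← Real.rpow_add hτ1, ← Real.rpow_add hτ1, ← Real.rpow_add hτ1]
    congr 1; ring
  rw [e4, e5, Real.rpow_neg hτ.le ((N : ℝ) / 2), Real.rpow_neg hτ1.le ((N : ℝ) / 2)]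
  ring

/-- This makes ρ and its first moment integrable. The factor 1 + ‖x‖ costs 2(√θ)⁻¹ and half of the
exponent, after which the integral is taken in x before τ. -/
theorem integrable_prod_heatWeight {α : ℝ} (hα : 0 < α) (hα1 : α < 1) :
    Integrable (fun p : RN N × ℝ => (1 + ‖p.1‖) *
      (heatWeight N α p.2 * Real.exp (-(p.2 / (p.2 + 1)) * ‖p.1‖ ^ 2)))
      (volume.prod (volume.restrict (Ioi 0))) := by
  set D : RN N × ℝ → ℝ := fun p => heatWeight N α p.2 * (2 * (√(p.2 / (p.2 + 1)))⁻¹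
    * Real.exp (-(p.2 / (p.2 + 1) / 2) * ‖p.1‖ ^ 2))
  have hw := measurable_heatWeight (N := N) α
  have hDm : Measurable D := by
    have : Measurable fun p : RN N × ℝ => heatWeight N α p.2 := hw.comp measurable_snd
    fun_prop
  have hpos : ∀ᵐ τ ∂(volume.restrict (Ioi (0 : ℝ))), 0 < τ :=
    ae_restrict_mem measurableSet_Ioi
  have hD : Integrable D (volume.prod (volume.restrict (Ioi 0))) := by
    refine (integrable_prod_iff' hDm.aestronglyMeasurable).2 ⟨?_, ?_⟩
    · filter_upwards [hpos] with τ hτ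
      simp only [D]
      exact ((integrable_exp_neg_mul_norm_sq (by positivity)).const_mul _).const_mul _
    · have h := (integrableOn_rpow_mul_add_one_rpow (a := -(α + 1) / 2) (b := 1 / 2)
        (by linarith) (by positivity) (by linarith)).const_mul
        (2 * Real.pi ^ ((N : ℝ) / 2) * (2 * Real.pi) ^ ((N : ℝ) / 2))
      refine Integrable.congr h ?_
      filter_upwards [hpos] with τ hτ
      have hwτ := heatWeight_pos (N := N) (α := α) hτ
      rw [← heatWeight_mul_gaussian_eq hτ]
      have e : ∀ x : RN N, ‖D (x, τ)‖ = D (x, τ) := fun x => by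
        rw [Real.norm_of_nonneg]
        simp only [D]
        positivity
      simp only [e, D]
      rw [integral_const_mul, integral_const_mul,
        GaussianFourier.integral_rexp_neg_mul_sq_norm (by positivity)]
      simp only [finrank_euclideanSpace_fin]
  have hm : Measurable (fun p : RN N × ℝ => (1 + ‖p.1‖) *
      (heatWeight N α p.2 * Real.exp (-(p.2 / (p.2 + 1)) * ‖p.1‖ ^ 2))) := by
    have : Measurable fun p : RN N × ℝ => heatWeight N α p.2 := hw.comp measurable_snd
    fun_prop
  refine hD.mono' hm.aestronglyMeasurable ?_
  have hpos' : ∀ᵐ p ∂((volume : Measure (RN N)).prod (volume.restrict (Ioi (0 : ℝ)))),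
      0 < p.2 := Measure.quasiMeasurePreserving_snd.ae hpos
  filter_upwards [hpos'] with p hp
  have hwτ := heatWeight_pos (N := N) (α := α) hp
  set θ := p.2 / (p.2 + 1) with hθ
  have hθ0 : 0 < θ := by positivity
  have hθ1 : θ ≤ 1 := by rw [hθ, div_le_one (by linarith)]; linarith
  have hs1 : 1 ≤ (√θ)⁻¹ := (one_le_inv₀ (Real.sqrt_pos.2 hθ0)).2 (Real.sqrt_le_one.2 hθ1)
  have h1 : Real.exp (-θ * ‖p.1‖ ^ 2) ≤ (√θ)⁻¹ * Real.exp (-(θ / 2) * ‖p.1‖ ^ 2) := by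
    have : Real.exp (-θ * ‖p.1‖ ^ 2) ≤ Real.exp (-(θ / 2) * ‖p.1‖ ^ 2) :=
      Real.exp_le_exp.2 (by nlinarith [sq_nonneg ‖p.1‖])
    exact this.trans (le_mul_of_one_le_left (Real.exp_pos _).le hs1)
  have h2 := norm_mul_exp_le hθ0 ‖p.1‖
  rw [Real.norm_of_nonneg (by positivity)]
  calc (1 + ‖p.1‖) * (heatWeight N α p.2 * Real.exp (-θ * ‖p.1‖ ^ 2))
      = heatWeight N α p.2 * (Real.exp (-θ * ‖p.1‖ ^ 2)
          + ‖p.1‖ * Real.exp (-θ * ‖p.1‖ ^ 2)) := by ring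
    _ ≤ heatWeight N α p.2 * (2 * (√θ)⁻¹ * Real.exp (-(θ / 2) * ‖p.1‖ ^ 2)) :=
        mul_le_mul_of_nonneg_left (by linarith) hwτ.le

theorem integrableOn_heatWeight_mul_exp {α : ℝ} (hα : 0 < α) (hαN : α < N) (x : RN N) :
    IntegrableOn (fun τ => heatWeight N α τ * Real.exp (-(τ / (τ + 1)) * ‖x‖ ^ 2)) (Ioi 0) := by
  refine Integrable.mono' (integrableOn_heatWeight hα hαN)
    ((measurable_heatWeight α).mul (by fun_prop)).aestronglyMeasurable
    ((ae_restrict_iff' measurableSet_Ioi).2 (ae_of_all _ fun τ hτ => ?_))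
  have hτ0 : 0 < τ := hτ
  have hwτ := heatWeight_pos (N := N) (α := α) hτ0
  rw [Real.norm_of_nonneg (by positivity)]
  refine mul_le_of_le_one_right hwτ.le (Real.exp_le_one_iff.2 ?_)
  have : 0 < τ / (τ + 1) := by positivity
  nlinarith [sq_nonneg ‖x‖]

theorem heatProfile_const_pos {α : ℝ} (hα : 0 < α) (hαN : α < N) :
    0 < rieszConst N α / Real.Gamma (((N : ℝ) - α) / 2) :=
  div_pos (rieszConst_pos hα hαN) (Real.Gamma_pos_of_pos (by linarith))

theorem heatProfile_pos {α : ℝ} (hα : 0 < α) (hαN : α < N) (x : RN N) : 0 < heatProfile α x := by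
  refine mul_pos (heatProfile_const_pos hα hαN) ?_
  rw [setIntegral_pos_iff_support_of_nonneg_ae
    ((ae_restrict_iff' measurableSet_Ioi).2 (ae_of_all _ fun τ hτ =>
      mul_nonneg (heatWeight_pos hτ).le (Real.exp_pos _).le))
    (integrableOn_heatWeight_mul_exp hα hαN x)]
  refine lt_of_lt_of_le (b := volume (Ioi (0 : ℝ))) (by simp) (measure_mono fun τ hτ => ⟨?_, hτ⟩)
  exact (mul_pos (heatWeight_pos hτ) (Real.exp_pos _)).ne'

theorem heatProfile_le {α : ℝ} (hα : 0 < α) (hαN : α < N) (x : RN N) :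
    heatProfile α x ≤ heatProfile α (0 : RN N) := by
  refine mul_le_mul_of_nonneg_left (setIntegral_mono_on (integrableOn_heatWeight_mul_exp hα hαN x)
    (integrableOn_heatWeight_mul_exp hα hαN 0) measurableSet_Ioi fun τ hτ => ?_)
    (heatProfile_const_pos hα hαN).le
  have hτ0 : 0 < τ := hτ
  refine mul_le_mul_of_nonneg_left (Real.exp_le_exp.2 ?_) (heatWeight_pos hτ).le
  have : 0 < τ / (τ + 1) := by positivity
  simp only [norm_zero]
  nlinarith [sq_nonneg ‖x‖]

theorem integrable_one_add_norm_mul_heatProfile {α : ℝ} (hα : 0 < α) (hα1 : α < 1) :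
    Integrable (fun x : RN N => (1 + ‖x‖) * heatProfile α x) := by
  have := (integrable_prod_heatWeight (N := N) hα hα1).integral_prod_left.const_mul
    (rieszConst N α / Real.Gamma (((N : ℝ) - α) / 2))
  simp only [integral_const_mul] at this
  refine this.congr (ae_of_all _ fun x => ?_)
  simp only [heatProfile]
  ring

theorem aestronglyMeasurable_heatProfile {α : ℝ} (hα : 0 < α) (hα1 : α < 1) :
    AEStronglyMeasurable (heatProfile α : RN N → ℝ) volume := by
  have h := (integrable_one_add_norm_mul_heatProfile (N := N) hα hα1).aestronglyMeasurable
  refine ((by fun_prop : Measurable fun x : RN N => (1 + ‖x‖)⁻¹).aestronglyMeasurable.mul h).congr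
    (ae_of_all _ fun x => ?_)
  have : 1 + ‖x‖ ≠ 0 := by positivity
  simp only [Pi.mul_apply]
  field_simp

theorem integrable_norm_mul_heatProfile {α : ℝ} (hα : 0 < α) (hα1 : α < 1) (hαN : α < N) :
    Integrable (fun x : RN N => ‖x‖ * heatProfile α x) := by
  refine (integrable_one_add_norm_mul_heatProfile hα hα1).mono'
    (continuous_norm.aestronglyMeasurable.mul (aestronglyMeasurable_heatProfile hα hα1))
    (ae_of_all _ fun x => ?_)
  have := heatProfile_pos hα hαN x
  rw [Real.norm_of_nonneg (by positivity)]
  nlinarith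

theorem integrable_heatProfile {α : ℝ} (hα : 0 < α) (hα1 : α < 1) (hαN : α < N) :
    Integrable (heatProfile α : RN N → ℝ) := by
  refine (integrable_one_add_norm_mul_heatProfile hα hα1).mono'
    (aestronglyMeasurable_heatProfile hα hα1) (ae_of_all _ fun x => ?_)
  have := heatProfile_pos hα hαN x
  rw [Real.norm_of_nonneg (by positivity)]
  nlinarith [mul_nonneg (norm_nonneg x) this.le]

theorem integral_heatProfile_pos {α : ℝ} (hα : 0 < α) (hα1 : α < 1) (hαN : α < N) :
    0 < ∫ x : RN N, heatProfile α x := by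
  rw [integral_pos_iff_support_of_nonneg (fun x => (heatProfile_pos hα hαN x).le)
    (integrable_heatProfile hα hα1 hαN)]
  have : Function.support (heatProfile α : RN N → ℝ) = univ :=
    eq_univ_of_forall fun x => (heatProfile_pos hα hαN x).ne'
  rw [this]
  exact Measure.measure_univ_pos.2 (NeZero.ne _)

/-- The field `y_j e^{-|y|²}`. -/
def gaussMoment (j : Fin N) (y : RN N) : ℝ := y j * Real.exp (-1 * ‖y‖ ^ 2)

theorem integrable_gaussMoment (j : Fin N) : Integrable (gaussMoment j) :=
  integrable_apply_mul_exp one_pos j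

theorem abs_gaussMoment_le (j : Fin N) (y : RN N) : |gaussMoment j y| ≤ 1 := by
  rw [gaussMoment, abs_mul, abs_of_pos (Real.exp_pos _)]
  have h1 := mul_le_mul_of_nonneg_right (abs_apply_le_norm y j) (Real.exp_pos (-1 * ‖y‖ ^ 2)).le
  have h2 := norm_mul_exp_le one_pos ‖y‖
  have h3 : Real.exp (-(1 / 2) * ‖y‖ ^ 2) ≤ 1 :=
    Real.exp_le_one_iff.2 (by nlinarith [sq_nonneg ‖y‖])
  simp only [Real.sqrt_one, inv_one, one_mul] at h2
  linarith

/-- The kernel is written as a superposition of Gaussians and the integrals are exchanged. The field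
y e^{−|y|²} thus has a potential of the form x ρ(x), which paired with ∇φ is a radial derivative
weighted by ρ. -/
theorem rieszPotential_gaussMoment (hN : 1 ≤ N) {α : ℝ} (hα : 0 < α) (hαN : α < N)
    (j : Fin N) (x : RN N) :
    rieszPotential α (gaussMoment j) x = x j * heatProfile α x := by
  set s : ℝ := N - α with hs
  have hs0 : 0 < s := by rw [hs]; linarith
  have hsN : s < N := by rw [hs]; linarith
  have hΓ : 0 < Real.Gamma (s / 2) := Real.Gamma_pos_of_pos (half_pos hs0)
  -- Subordination fails at y = x; that point is null because the dimension is at least 1.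
  have hne : ∀ᵐ y : RN N, 0 < ‖x - y‖ := by
    have : Nontrivial (RN N) := Module.nontrivial_of_finrank_pos (R := ℝ)
      (by rw [finrank_euclideanSpace_fin]; exact hN)
    filter_upwards [compl_mem_ae_iff.2 (measure_singleton x)] with y hy
    exact norm_pos_iff.2 (sub_ne_zero.2 fun h => hy (by simp [h]))
  set f : RN N → ℝ → ℝ := fun y τ =>
    gaussMoment j y * (τ ^ (s / 2 - 1) * Real.exp (-τ * ‖x - y‖ ^ 2))
  have hfm : AEStronglyMeasurable (Function.uncurry f)
      (volume.prod (volume.restrict (Ioi 0))) := by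
    refine Measurable.aestronglyMeasurable ?_
    simp only [f, Function.uncurry_def, gaussMoment]
    fun_prop
  have hi := integrable_div_norm_rpow hN hs0 hsN (integrable_gaussMoment j)
    (ae_of_all _ (abs_gaussMoment_le j)) x
  have hf : Integrable (Function.uncurry f) (volume.prod (volume.restrict (Ioi 0))) := by
    refine (integrable_prod_iff hfm).2 ⟨?_, ?_⟩
    · filter_upwards [hne] with y hy
      simp only [f, Function.uncurry_apply_pair]
      exact (integrableOn_rpow_mul_exp_neg_mul_sq hs0 hy).const_mul _
    · refine (hi.1.abs.const_mul (Real.Gamma (s / 2))).congr ?_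
      filter_upwards [hne] with y hy
      have : ∀ τ ∈ Ioi (0 : ℝ), ‖Function.uncurry f (y, τ)‖
          = |gaussMoment j y| * (τ ^ (s / 2 - 1) * Real.exp (-τ * ‖x - y‖ ^ 2)) := fun τ hτ => by
        have hτ0 : 0 < τ := hτ
        simp only [f, Function.uncurry_apply_pair, norm_mul, Real.norm_eq_abs]
        rw [abs_of_nonneg (by positivity : 0 ≤ τ ^ (s / 2 - 1)), abs_of_pos (Real.exp_pos _)]
      rw [setIntegral_congr_fun measurableSet_Ioi this, integral_const_mul,
        integral_rpow_mul_exp_neg_mul_sq hs0 hy, abs_div,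
        abs_of_nonneg (by positivity : 0 ≤ ‖x - y‖ ^ s)]
      ring
  have h1 : ∫ y, gaussMoment j y / ‖x - y‖ ^ s
      = (Real.Gamma (s / 2))⁻¹ * ∫ y, ∫ τ in Ioi (0 : ℝ), f y τ := by
    rw [← integral_const_mul]
    refine integral_congr_ae ?_
    filter_upwards [hne] with y hy
    simp only [f]
    rw [integral_const_mul, integral_rpow_mul_exp_neg_mul_sq hs0 hy]
    field_simp
  have h2 : ∀ τ ∈ Ioi (0 : ℝ), ∫ y, f y τ
      = x j * (heatWeight N α τ * Real.exp (-(τ / (τ + 1)) * ‖x‖ ^ 2)) := fun τ hτ => by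
    have := integral_apply_mul_exp_mul_exp hτ x j
    have e : ∀ y, f y τ = τ ^ (s / 2 - 1) *
        (y j * Real.exp (-1 * ‖y‖ ^ 2) * Real.exp (-τ * ‖x - y‖ ^ 2)) := fun y => by
      simp only [f, gaussMoment]; ring
    simp only [e]
    rw [integral_const_mul, this, heatWeight]
    ring
  rw [rieszPotential, ← hs, h1, integral_integral_swap hf,
    setIntegral_congr_fun measurableSet_Ioi h2, integral_const_mul, heatProfile]
  ring

end FracGrad
end

noncomputable section

namespace FracGrad

variable {N : ℕ}

/-! ### Uniform bounds from bounds on the fractional gradient -/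

/-- Adding K t^β/β makes H nondecreasing; the bound on the derivative may blow up at 0, but its
primitive is continuous there. -/
theorem sub_le_of_abs_deriv_le_rpow {H H' : ℝ → ℝ} {K β T : ℝ} (hβ : 0 < β) (hT : 0 ≤ T)
    (hH : ∀ t, HasDerivAt H (H' t) t) (hb : ∀ t, 0 < t → |H' t| ≤ K * t ^ (β - 1)) :
    H 0 - H T ≤ K * (T ^ β / β) := by
  have hc : ContinuousOn (fun t => H t + K * (t ^ β / β)) (Icc 0 T) := by
    refine ContinuousOn.add (fun t _ => (hH t).continuousAt.continuousWithinAt) ?_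
    exact (((Real.continuous_rpow_const hβ.le).div_const β).const_mul K).continuousOn
  have hd : ∀ t, 0 < t → HasDerivAt (fun t => H t + K * (t ^ β / β))
      (H' t + K * t ^ (β - 1)) t := fun t ht => by
    have := (((Real.hasDerivAt_rpow_const (p := β) (Or.inl ht.ne')).div_const β).const_mul K)
    exact ((hH t).add this).congr_deriv (by field_simp)
  have hm : MonotoneOn (fun t => H t + K * (t ^ β / β)) (Icc 0 T) := by
    refine monotoneOn_of_deriv_nonneg (convex_Icc 0 T) hc ?_ ?_
    · intro t ht
      rw [interior_Icc] at ht
      exact (hd t ht.1).differentiableAt.differentiableWithinAt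
    · intro t ht
      rw [interior_Icc] at ht
      rw [(hd t ht.1).deriv]
      linarith [neg_abs_le (H' t), hb t ht.1]
  have := hm (left_mem_Icc.2 hT) (right_mem_Icc.2 hT) hT
  simp only [Real.zero_rpow hβ.ne', zero_div, mul_zero, add_zero] at this
  linarith

theorem rieszPotential_comp_add_smul (α : ℝ) (ψ : RN N → ℝ) (x₀ x : RN N) {t : ℝ} (ht : 0 < t) :
    rieszPotential α (fun y => ψ (x₀ + t • y)) x
      = t ^ (-α) * rieszPotential α ψ (x₀ + t • x) := by
  set k : RN N → ℝ := fun z => ψ z / ‖x₀ + t • x - z‖ ^ ((N : ℝ) - α) with hk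
  have h1 : ∫ y, k (x₀ + t • y) = (t ^ N)⁻¹ * ∫ z, k z := by
    have := Measure.integral_comp_smul (volume : Measure (RN N)) (fun w => k (x₀ + w)) t
    rw [this, integral_add_left_eq_self k x₀, finrank_euclideanSpace_fin, smul_eq_mul,
      abs_of_pos (by positivity)]
  have h2 : ∀ y, ψ (x₀ + t • y) / ‖x - y‖ ^ ((N : ℝ) - α)
      = t ^ ((N : ℝ) - α) * k (x₀ + t • y) := fun y => by
    have : x₀ + t • x - (x₀ + t • y) = t • (x - y) := by module
    simp only [hk, this]
    rw [norm_smul, Real.norm_of_nonneg ht.le, Real.mul_rpow ht.le (norm_nonneg _)]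
    have : t ^ ((N : ℝ) - α) ≠ 0 := by positivity
    rw [← mul_div_assoc, mul_div_mul_left _ _ this]
  simp only [rieszPotential, h2]
  rw [integral_const_mul, h1, Real.rpow_sub ht, Real.rpow_natCast, Real.rpow_neg ht.le]
  field_simp
  rfl

theorem fderiv_apply_eq_sum (φ : RN N → ℝ) (y x : RN N) :
    fderiv ℝ φ y x = ∑ j, pderiv j φ y * x j := by
  conv_lhs => rw [← (EuclideanSpace.basisFun (Fin N) ℝ).sum_repr x]
  rw [map_sum]
  refine Finset.sum_congr rfl fun j _ => ?_
  simp [pderiv, mul_comm]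

theorem inner_eq_sum (x y : RN N) : ⟪x, y⟫ = ∑ j, x j * y j := by
  simp [PiLp.inner_apply, mul_comm]

theorem IsTest.comp_add_smul {φ : RN N → ℝ} (h : IsTest univ φ) (x₀ : RN N) {t : ℝ} (ht : t ≠ 0) :
    IsTest univ fun y => φ (x₀ + t • y) :=
  ⟨h.1.comp (by fun_prop), h.2.1.comp_homeomorph
    ((Homeomorph.smulOfNeZero t ht).trans (Homeomorph.addLeft x₀)), subset_univ _⟩

/-- The left side is the derivative of t ↦ ∫ φ(x₀ + t x) ρ(x) dx. Self-adjointness moves I_α from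
the Gaussian moments to the derivatives of φ, and homogeneity produces t^{−α}. -/
theorem IsTest.integral_fderiv_mul_heatProfile (hN : 1 ≤ N) {α : ℝ} (hα : 0 < α) (hαN : α < N)
    {φ : RN N → ℝ} (h : IsTest univ φ) (x₀ : RN N) {t : ℝ} (ht : 0 < t) :
    ∫ x, fderiv ℝ φ (x₀ + t • x) x * heatProfile α x
      = t ^ (-α) * ∫ x, ⟪testGrad α φ (x₀ + t • x), x⟫ * Real.exp (-1 * ‖x‖ ^ 2) := by
  have hψ : ∀ j, IsTest univ fun y => pderiv j φ (x₀ + t • y) := fun j =>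
    (h.isTest_pderiv j).comp_add_smul x₀ ht.ne'
  have h1 : ∀ j, Integrable (fun x => rieszPotential α (gaussMoment j) x
      * pderiv j φ (x₀ + t • x)) := fun j => by
    obtain ⟨M, hM⟩ := (hψ j).exists_abs_le
    exact integrableOn_rieszPotential hN hα hαN (integrable_gaussMoment j) (hψ j).integrable
      (ae_of_all _ hM)
  have h2 : ∀ j, Integrable (fun x => rieszPotential α (fun y => pderiv j φ (x₀ + t • y)) x
      * gaussMoment j x) := fun j =>
    integrableOn_rieszPotential hN hα hαN (hψ j).integrable (integrable_gaussMoment j)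
      (ae_of_all _ (abs_gaussMoment_le j))
  have e1 : ∀ x, fderiv ℝ φ (x₀ + t • x) x * heatProfile α x
      = ∑ j, rieszPotential α (gaussMoment j) x * pderiv j φ (x₀ + t • x) := fun x => by
    rw [fderiv_apply_eq_sum, Finset.sum_mul]
    refine Finset.sum_congr rfl fun j _ => ?_
    rw [rieszPotential_gaussMoment hN hα hαN]
    ring
  have e2 : ∀ x, t ^ (-α) * (⟪testGrad α φ (x₀ + t • x), x⟫ * Real.exp (-1 * ‖x‖ ^ 2))
      = ∑ j, rieszPotential α (fun y => pderiv j φ (x₀ + t • y)) x * gaussMoment j x := fun x => by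
    rw [inner_eq_sum, Finset.sum_mul, Finset.mul_sum]
    refine Finset.sum_congr rfl fun j _ => ?_
    rw [rieszPotential_comp_add_smul α _ x₀ x ht, testGrad_apply, gaussMoment]
    ring
  rw [← integral_const_mul]
  simp only [e1, e2]
  rw [integral_finsetSum _ fun j _ => h1 j, integral_finsetSum _ fun j _ => h2 j]
  refine Finset.sum_congr rfl fun j _ => ?_
  rw [integral_rieszPotential_mul hN hα hαN (hψ j).integrable (integrable_gaussMoment j)
    (ae_of_all _ (abs_gaussMoment_le j))]
  simp only [mul_comm]

theorem IsTest.hasDerivAt_integral_mul_heatProfile {α : ℝ} (hα : 0 < α) (hα1 : α < 1)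
    (hαN : α < N) {φ : RN N → ℝ} (h : IsTest univ φ) (x₀ : RN N) (t : ℝ) :
    HasDerivAt (fun t : ℝ => ∫ x, φ (x₀ + t • x) * heatProfile α x)
      (∫ x, fderiv ℝ φ (x₀ + t • x) x * heatProfile α x) t := by
  obtain ⟨M, hM⟩ := h.exists_abs_le
  obtain ⟨L, hL⟩ := (h.2.1.fderiv ℝ).exists_bound_of_continuous (h.1.continuous_fderiv (by simp))
  have hρm := aestronglyMeasurable_heatProfile (N := N) hα hα1
  have hφc : Continuous φ := h.continuous
  have hdc : Continuous (fderiv ℝ φ) := h.1.continuous_fderiv (by simp)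
  have hm : ∀ t : ℝ, AEStronglyMeasurable (fun x => φ (x₀ + t • x) * heatProfile α x) volume :=
    fun t => (by fun_prop : Continuous fun x => φ (x₀ + t • x)).aestronglyMeasurable.mul hρm
  refine (hasDerivAt_integral_of_dominated_loc_of_deriv_le (s := univ)
    (F' := fun t x => fderiv ℝ φ (x₀ + t • x) x * heatProfile α x)
    (bound := fun x => L * (‖x‖ * heatProfile α x)) univ_mem (Eventually.of_forall hm) ?_ ?_ ?_
    ((integrable_norm_mul_heatProfile hα hα1 hαN).const_mul L) ?_).2
  · exact (integrable_heatProfile hα hα1 hαN).bdd_mul (c := M)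
      (by fun_prop : Continuous fun x => φ (x₀ + t • x)).aestronglyMeasurable
      (ae_of_all _ fun x => hM _)
  · exact (by fun_prop : Continuous fun x => fderiv ℝ φ (x₀ + t • x) x).aestronglyMeasurable.mul hρm
  · refine ae_of_all _ fun x t _ => ?_
    have hρ := heatProfile_pos hα hαN x
    rw [norm_mul, Real.norm_of_nonneg hρ.le, ← mul_assoc]
    refine mul_le_mul_of_nonneg_right ?_ hρ.le
    exact (ContinuousLinearMap.le_opNorm _ _).trans
      (mul_le_mul_of_nonneg_right (hL _) (norm_nonneg _))
  · refine ae_of_all _ fun x t _ => ?_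
    have h1 : HasDerivAt (fun t : ℝ => x₀ + t • x) x t := by
      simpa using! ((hasDerivAt_id t).smul_const x).const_add x₀
    exact (((h.1.differentiable (by simp)).differentiableAt.hasFDerivAt).comp_hasDerivAt t
      h1).mul_const _

theorem IsTest.testGrad_smul {U : Set (RN N)} {φ : RN N → ℝ} (h : IsTest U φ) (α c : ℝ) :
    testGrad α (c • φ) = c • testGrad α φ := by
  have : ∀ j, pderiv j (c • φ) = fun y => c * pderiv j φ y := fun j => by
    funext y
    rw [pderiv, fderiv_const_smul (h.1.differentiable (by simp)).differentiableAt]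
    rfl
  funext x
  ext j
  simp only [testGrad_apply, this, rieszPotential, Pi.smul_apply, PiLp.smul_apply, smul_eq_mul,
    mul_div_assoc, integral_const_mul]
  ring

/-- A test function is bounded by the supremum of its fractional gradient, up to its `L¹` norm. -/
theorem exists_test_bound (hN : 1 ≤ N) {σ : ℝ} (hσ0 : 0 < σ) (hσ1 : σ < 1) :
    ∃ C, 0 ≤ C ∧ ∀ φ : RN N → ℝ, IsTest univ φ → ∀ M, (∀ x, ‖testGrad (1 - σ) φ x‖ ≤ M) →
      ∀ T, 0 < T → ∀ x, |φ x| ≤ C * ((T ^ N)⁻¹ * (∫ y, |φ y|) + T ^ σ * M) := by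
  have hα : 0 < 1 - σ := by linarith
  have hα1 : 1 - σ < 1 := by linarith
  have hαN : 1 - σ < N := by
    have : (1 : ℝ) ≤ N := by exact_mod_cast hN
    linarith
  set m := ∫ x : RN N, heatProfile (1 - σ) x with hm
  have hm0 : 0 < m := integral_heatProfile_pos hα hα1 hαN
  set b := heatProfile (1 - σ) (0 : RN N)
  have hb : 0 < b := heatProfile_pos hα hαN 0
  set G := ∫ x : RN N, ‖x‖ * Real.exp (-1 * ‖x‖ ^ 2)
  have hG : 0 ≤ G := integral_nonneg fun x => by positivity
  -- one-sided bound
  have key : ∀ φ : RN N → ℝ, IsTest univ φ → ∀ M, (∀ x, ‖testGrad (1 - σ) φ x‖ ≤ M) →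
      ∀ T, 0 < T → ∀ x, m * φ x ≤ b * ((T ^ N)⁻¹ * (∫ y, |φ y|)) + M * G * (T ^ σ / σ) := by
    intro φ hφ M hM T hT x₀
    have hd := hφ.hasDerivAt_integral_mul_heatProfile hα hα1 hαN x₀
    -- The exponent −(1 − σ) equals σ − 1, so the exponent β of the comparison lemma is σ.
    have h1 := sub_le_of_abs_deriv_le_rpow (K := M * G) hσ0 hT.le hd fun t ht => by
      rw [hφ.integral_fderiv_mul_heatProfile hN hα hαN x₀ ht, abs_mul,
        abs_of_pos (by positivity : 0 < t ^ (-(1 - σ))), mul_comm, neg_sub]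
      refine mul_le_mul_of_nonneg_right ?_ (by positivity)
      rw [← integral_const_mul]
      refine abs_integral_le_integral_abs.trans (integral_mono_of_nonneg
        (ae_of_all _ fun _ => abs_nonneg _) ((integrable_norm_mul_exp one_pos).const_mul M)
        (ae_of_all _ fun x => ?_))
      simp only
      rw [abs_mul, abs_of_pos (Real.exp_pos _), ← mul_assoc]
      exact mul_le_mul_of_nonneg_right ((abs_real_inner_le_norm _ _).trans
        (mul_le_mul_of_nonneg_right (hM _) (norm_nonneg _))) (Real.exp_pos _).le
    simp only [zero_smul, add_zero] at h1
    rw [integral_const_mul, ← hm, mul_comm] at h1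
    -- At scale T the profile is bounded by its value at 0, and the dilation contributes T^{−N}.
    have h2 : ∫ x, φ (x₀ + T • x) * heatProfile (1 - σ) x ≤ b * ((T ^ N)⁻¹ * (∫ y, |φ y|)) := by
      have h3 := Measure.integral_comp_smul (volume : Measure (RN N)) (fun w => |φ (x₀ + w)|) T
      rw [integral_add_left_eq_self (fun y => |φ y|) x₀, finrank_euclideanSpace_fin, smul_eq_mul,
        abs_of_pos (by positivity)] at h3
      rw [← h3, ← integral_const_mul]
      have ht := (hφ.comp_add_smul x₀ hT.ne')
      obtain ⟨L, hL⟩ := ht.exists_abs_le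
      refine integral_mono_ae ((integrable_heatProfile hα hα1 hαN).bdd_mul (c := L)
        ht.continuous.aestronglyMeasurable (ae_of_all _ hL)) (ht.integrable.abs.const_mul b)
        (ae_of_all _ fun x => ?_)
      have hρ := heatProfile_pos hα hαN x
      have h4 := heatProfile_le hα hαN x
      calc φ (x₀ + T • x) * heatProfile (1 - σ) x
          ≤ |φ (x₀ + T • x)| * heatProfile (1 - σ) x :=
            mul_le_mul_of_nonneg_right (le_abs_self _) hρ.le
        _ ≤ |φ (x₀ + T • x)| * b := mul_le_mul_of_nonneg_left h4 (abs_nonneg _)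
        _ = b * |φ (x₀ + T • x)| := mul_comm _ _
    linarith
  clear_value m b G
  refine ⟨max (b / m) (G / σ / m), le_max_of_le_left (div_pos hb hm0).le,
    fun φ hφ M hM T hT x => ?_⟩
  have hM0 : 0 ≤ M := (norm_nonneg _).trans (hM 0)
  have hI : 0 ≤ ∫ y, |φ y| := integral_nonneg fun _ => abs_nonneg _
  have h1 := key φ hφ M hM T hT x
  -- The lower bound is the upper bound for −φ.
  have hneg : IsTest univ ((-1 : ℝ) • φ) := hφ.smul (-1)
  have hgneg : ∀ x, ‖testGrad (1 - σ) ((-1 : ℝ) • φ) x‖ ≤ M := fun x => by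
    rw [hφ.testGrad_smul, Pi.smul_apply, neg_one_smul, norm_neg]
    exact hM x
  have h2 := key _ hneg M hgneg T hT x
  simp only [Pi.smul_apply, smul_eq_mul, neg_mul, one_mul, abs_neg] at h2
  have h3 : m * |φ x| ≤ b * ((T ^ N)⁻¹ * (∫ y, |φ y|)) + M * G * (T ^ σ / σ) := by
    rcases abs_cases (φ x) with h | h <;> rw [h.1] <;> linarith
  have h4 : |φ x| ≤ b / m * ((T ^ N)⁻¹ * (∫ y, |φ y|)) + G / σ / m * (T ^ σ * M) := by
    rw [mul_comm] at h3
    have := (le_div_iff₀ hm0).2 h3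
    calc _ ≤ _ := this
      _ = _ := by field_simp
  rw [mul_add]
  refine h4.trans (add_le_add ?_ ?_)
  · exact mul_le_mul_of_nonneg_right (le_max_left _ _) (by positivity)
  · exact mul_le_mul_of_nonneg_right (le_max_right _ _) (by positivity)

end FracGrad
end

noncomputable section

namespace FracGrad

variable {N : ℕ}

/-! ### Mollification -/

open scoped Convolution

theorem isTest_convolution {u η : RN N → ℝ} (hu : Integrable u) (huc : HasCompactSupport u)
    (hη : IsTest univ η) : IsTest univ (u ⋆[ContinuousLinearMap.mul ℝ ℝ, volume] η) :=
  ⟨hη.2.1.contDiff_convolution_right _ hu.locallyIntegrable hη.1, huc.convolution _ hη.2.1,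
    subset_univ _⟩

theorem pderiv_convolution {u η : RN N → ℝ} (hu : Integrable u) (hη : IsTest univ η)
    (j : Fin N) (x : RN N) :
    pderiv j (u ⋆[ContinuousLinearMap.mul ℝ ℝ, volume] η) x
      = ∫ z, u z * pderiv j η (x - z) := by
  rw [pderiv, (hη.2.1.hasFDerivAt_convolution_right _ hu.locallyIntegrable
    (hη.1.of_le (by simp)) x).fderiv, convolution_precompR_apply _ hu.locallyIntegrable
    (hη.2.1.fderiv ℝ) (hη.1.continuous_fderiv (by simp))]
  rfl

theorem IsTest.comp_sub_left {η : RN N → ℝ} (h : IsTest univ η) (x : RN N) :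
    IsTest univ fun w => η (x - w) :=
  ⟨h.1.comp (by fun_prop), h.2.1.comp_homeomorph (Homeomorph.subLeft x), subset_univ _⟩

theorem IsTest.pderiv_comp_sub_left {η : RN N → ℝ} (h : IsTest univ η) (j : Fin N) (x w : RN N) :
    pderiv j (fun w => η (x - w)) w = - pderiv j η (x - w) := by
  have h1 : HasFDerivAt (fun w => η (x - w)) (-(fderiv ℝ η (x - w))) w := by
    simpa using! ((h.1.differentiable (by simp)).differentiableAt.hasFDerivAt).comp w
      ((hasFDerivAt_id w).const_sub x)
  rw [pderiv, h1.fderiv]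
  rfl

/-- D^σ commutes with mollification: the duality formula for u is tested with w ↦ η(x − w), and
Fubini identifies the result with the potential of ∂_j(u ∗ η). -/
theorem testGrad_convolution (hN : 1 ≤ N) {σ : ℝ} (hσ0 : 0 < σ) (hσ1 : σ < 1)
    {u η : RN N → ℝ} {F : RN N → RN N} (hu : Integrable u)
    (hη : IsTest univ η) (hF : IsFracGrad σ u F) (x : RN N) (j : Fin N) :
    testGrad (1 - σ) (u ⋆[ContinuousLinearMap.mul ℝ ℝ, volume] η) x j
      = ∫ z, F z j * η (x - z) := by
  have hNr : (1 : ℝ) ≤ N := by exact_mod_cast hN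
  set α := 1 - σ with hα
  set s : ℝ := N - α with hs
  have hs0 : 0 < s := by linarith
  have hsN : s < N := by linarith
  set D := pderiv j η with hD
  have hDt : IsTest univ D := hη.isTest_pderiv j
  obtain ⟨M, hM⟩ := hDt.exists_abs_le
  set f : RN N → RN N → ℝ := fun y z => u z * (D (y - z) / ‖x - y‖ ^ s) with hf
  have hj : ∀ z, Integrable (fun y => D (y - z) / ‖x - y‖ ^ s) ∧
      ∫ y, |D (y - z) / ‖x - y‖ ^ s| ≤ M * kernelMass N s + ∫ y, |D y| := fun z => by
    have := integrable_div_norm_rpow hN hs0 hsN (hDt.integrable.comp_sub_right z)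
      (ae_of_all _ fun y => hM (y - z)) x
    rwa [integral_sub_right_eq_self (fun y => |D y|) z] at this
  have hfm : AEStronglyMeasurable (Function.uncurry f) (volume.prod volume) := by
    have hDc := hDt.continuous
    exact hu.aestronglyMeasurable.comp_snd.mul (by fun_prop : Measurable
      fun p : RN N × RN N => D (p.1 - p.2) / ‖x - p.1‖ ^ s).aestronglyMeasurable
  have hfi : Integrable (Function.uncurry f) (volume.prod volume) := by
    refine (integrable_prod_iff' hfm).2 ⟨ae_of_all _ fun z => (hj z).1.const_mul (u z), ?_⟩
    refine (hu.abs.mul_const (M * kernelMass N s + ∫ y, |D y|)).mono'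
      hfm.norm.prod_swap.integral_prod_right' (ae_of_all _ fun z => ?_)
    rw [Real.norm_of_nonneg (integral_nonneg fun _ => norm_nonneg _)]
    simp only [Function.uncurry_apply_pair, hf, Real.norm_eq_abs]
    simp_rw [abs_mul (u z)]
    rw [integral_const_mul]
    exact mul_le_mul_of_nonneg_left (hj z).2 (abs_nonneg _)
  have hx := (isFracGrad_iff_of_integrable hN hσ0 hσ1 hu hF.2.1).1 hF _ (hη.comp_sub_left x) j
  have e : ∀ z, testGrad (1 - σ) (fun w => η (x - w)) z j
      = - (rieszConst N α * ∫ y, D (y - z) / ‖x - y‖ ^ s) := fun z => by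
    rw [testGrad_apply, rieszPotential, ← hα, ← hs, ← mul_neg, ← integral_neg]
    congr 1
    rw [← integral_sub_left_eq_self _ volume (x + z)]
    refine integral_congr_ae (ae_of_all _ fun y => ?_)
    simp only [hη.pderiv_comp_sub_left]
    rw [show x - (x + z - y) = y - z by abel, show z - (x + z - y) = y - x by abel,
      norm_sub_rev y x, neg_div]
  rw [← neg_eq_iff_eq_neg] at hx
  rw [← hx, testGrad_apply, rieszPotential, ← hs]
  have e2 : ∀ y, pderiv j (u ⋆[ContinuousLinearMap.mul ℝ ℝ, volume] η) y / ‖x - y‖ ^ s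
      = ∫ z, f y z := fun y => by
    rw [pderiv_convolution hu hη, ← integral_div]
    simp only [hf, mul_div_assoc, hD]
  simp only [e2, e]
  rw [integral_integral_swap hfi, ← integral_neg, ← integral_const_mul]
  refine integral_congr_ae (ae_of_all _ fun z => ?_)
  simp only [hf]
  rw [integral_const_mul]
  ring

/-- Convolution with a probability density preserves the bound M on the gradient and does not
increase the L¹ norm, so the estimate for test functions passes to almost every limit point of the
mollifications. -/
theorem abs_le_of_isFracGrad_bound (hN : 1 ≤ N) {σ : ℝ} (hσ0 : 0 < σ) (hσ1 : σ < 1) :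
    ∃ C, 0 ≤ C ∧ ∀ (u : RN N → ℝ) (F : RN N → RN N) (M : ℝ), Integrable u → HasCompactSupport u →
      IsFracGrad σ u F → (∀ᵐ x, ‖F x‖ ≤ M) → ∀ T, 0 < T →
      ∀ᵐ x, |u x| ≤ C * ((T ^ N)⁻¹ * (∫ y, |u y|) + T ^ σ * M) := by
  obtain ⟨C, hC0, hC⟩ := exists_test_bound hN hσ0 hσ1
  refine ⟨C, hC0, fun u F M hu huc hF hM T hT => ?_⟩
  -- The outer radius stays twice the inner one; almost everywhere convergence for merely integrable
  -- u needs this ratio bounded.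
  let φ : ℕ → ContDiffBump (0 : RN N) := fun n =>
    ⟨1 / (n + 2), 2 / (n + 2), by positivity, by gcongr; norm_num⟩
  have hlim := ContDiffBump.ae_convolution_tendsto_right_of_locallyIntegrable
    (μ := (volume : Measure (RN N))) (φ := φ) (l := atTop) (K := 2) (g := u) ?_ ?_
    hu.locallyIntegrable
  rotate_left
  · have h1 : Tendsto (fun n : ℕ => ((n : ℝ) + 2)) atTop atTop :=
      tendsto_atTop_add_const_right _ _ tendsto_natCast_atTop_atTop
    exact h1.const_div_atTop 2
  · refine Eventually.of_forall fun n => le_of_eq ?_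
    simp only [φ]
    ring
  have hb : ∀ n x, |(u ⋆[ContinuousLinearMap.mul ℝ ℝ, volume] (φ n).normed volume) x|
      ≤ C * ((T ^ N)⁻¹ * (∫ y, |u y|) + T ^ σ * M) := by
    intro n x
    set η := (φ n).normed (volume : Measure (RN N))
    have hη0 : ∀ x, 0 ≤ η x := (φ n).nonneg_normed
    have hη1 : ∫ x, η x = 1 := (φ n).integral_normed
    have hη : IsTest univ η := ⟨(φ n).contDiff_normed, (φ n).hasCompactSupport_normed,
      subset_univ _⟩
    have hT' := isTest_convolution hu huc hη
    have hFm : AEStronglyMeasurable F volume := hF.2.1.aestronglyMeasurable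
    have hgrad : ∀ x, ‖testGrad (1 - σ) (u ⋆[ContinuousLinearMap.mul ℝ ℝ, volume] η) x‖ ≤ M := by
      intro x
      have hi : Integrable (fun z => η (x - z) • F z) :=
        (hη.integrable.comp_sub_left x).smul_bdd M hFm hM
      have he : testGrad (1 - σ) (u ⋆[ContinuousLinearMap.mul ℝ ℝ, volume] η) x
          = ∫ z, η (x - z) • F z := by
        ext j
        rw [testGrad_convolution hN hσ0 hσ1 hu hη hF, eval_integral_piLp
          (integrable_piLp_iff.1 hi)]
        simp only [PiLp.smul_apply, smul_eq_mul, mul_comm]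
      rw [he]
      have h1 : ∫ z, η (x - z) * M = M := by
        rw [integral_mul_const, integral_sub_left_eq_self η volume x, hη1, one_mul]
      rw [← h1]
      refine norm_integral_le_of_norm_le ((hη.integrable.comp_sub_left x).mul_const M) ?_
      filter_upwards [hM] with z hz
      rw [norm_smul, Real.norm_of_nonneg (hη0 _)]
      exact mul_le_mul_of_nonneg_left hz (hη0 _)
    refine (hC _ hT' M hgrad T hT x).trans ?_
    have h2 : ∫ y, |(u ⋆[ContinuousLinearMap.mul ℝ ℝ, volume] η) y| ≤ ∫ y, |u y| := by
      have h3 : ∫ y, ((fun z => |u z|) ⋆[ContinuousLinearMap.mul ℝ ℝ, volume] η) y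
          = ∫ y, |u y| := by
        rw [integral_convolution _ hu.abs hη.integrable, hη1]
        simp
      rw [← h3]
      refine integral_mono_of_nonneg (ae_of_all _ fun _ => abs_nonneg _)
        (hu.abs.integrable_convolution _ hη.integrable) (ae_of_all _ fun y => ?_)
      refine abs_integral_le_integral_abs.trans (le_of_eq ?_)
      refine integral_congr_ae (ae_of_all _ fun z => ?_)
      simp only [ContinuousLinearMap.mul_apply', abs_mul, abs_of_nonneg (hη0 _)]
    gcongr
  filter_upwards [hlim] with x hx
  refine le_of_tendsto hx.abs (Eventually.of_forall fun n => ?_)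
  have : ((φ n).normed volume ⋆[ContinuousLinearMap.lsmul ℝ ℝ, volume] u) x
      = (u ⋆[ContinuousLinearMap.mul ℝ ℝ, volume] (φ n).normed volume) x := by
    rw [convolution_lsmul_swap, convolution_def]
    simp only [smul_eq_mul, ContinuousLinearMap.mul_apply', mul_comm]
  rw [this]
  exact hb n x

theorem IsFracGrad.congr_ae {σ : ℝ} {u v : RN N → ℝ} {F G : RN N → RN N}
    (h : IsFracGrad σ u F) (huv : u =ᵐ[volume] v) (hFG : F =ᵐ[volume] G) : IsFracGrad σ v G := by
  obtain ⟨⟨h1, h2⟩, h3, h4⟩ := h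
  rw [rieszPotential_congr_ae huv] at h2 h4
  refine ⟨⟨?_, h2⟩, h3.congr hFG, fun φ hφ j => ?_⟩
  · filter_upwards [h1] with x hx
    refine hx.congr ?_
    filter_upwards [huv] with y hy
    rw [hy]
  · rw [h4 φ hφ j]
    congr 1
    refine integral_congr_ae ?_
    filter_upwards [hFG] with x hx
    rw [hx]

/-- Functions vanishing outside a bounded set are bounded by the supremum of their fractional
gradient. -/
theorem exists_abs_le_mul_of_isFracGrad (hN : 1 ≤ N) {σ : ℝ} (hσ0 : 0 < σ) (hσ1 : σ < 1)
    {Ω : Set (RN N)} (hΩo : IsOpen Ω) (hΩb : Bornology.IsBounded Ω) :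
    ∃ C, 0 ≤ C ∧ ∀ (u : RN N → ℝ) (F : RN N → RN N) (M : ℝ), Integrable u →
      (∀ᵐ x, x ∉ Ω → u x = 0) → IsFracGrad σ u F → (∀ᵐ x, ‖F x‖ ≤ M) →
      ∀ᵐ x, |u x| ≤ C * M := by
  obtain ⟨C, hC0, hC⟩ := abs_le_of_isFracGrad_bound hN hσ0 hσ1
  set V := volume.real Ω with hV
  have hV0 : 0 ≤ V := measureReal_nonneg
  set T := max 1 (2 * C * V) with hTdef
  have hT1 : 1 ≤ T := le_max_left _ _
  have hT0 : 0 < T := by linarith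
  -- T is chosen so that the L¹ term, once estimated by |Ω| times the supremum, reappears with
  -- factor at most 1/2 and is absorbed.
  have hTN : C * V * (T ^ N)⁻¹ ≤ 1 / 2 := by
    have h1 : T ≤ T ^ N := le_self_pow₀ hT1 (by omega)
    have h2 : 2 * C * V ≤ T := le_max_right _ _
    rw [← div_eq_mul_inv, div_le_iff₀ (by positivity)]
    linarith
  clear_value T
  refine ⟨C * ((T ^ N)⁻¹ * (2 * C * V * T ^ σ) + T ^ σ), by positivity,
    fun u F M hu hu0 hF hM => ?_⟩
  have hM0 : 0 ≤ M := by
    obtain ⟨x, hx⟩ := hM.exists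
    exact (norm_nonneg _).trans hx
  set v := Ω.indicator u with hv
  have huv : u =ᵐ[volume] v := by
    filter_upwards [hu0] with x hx
    by_cases hxΩ : x ∈ Ω
    · rw [hv, indicator_of_mem hxΩ]
    · rw [hv, indicator_of_notMem hxΩ, hx hxΩ]
  have hvi : Integrable v := hu.indicator hΩo.measurableSet
  have hvc : HasCompactSupport v := HasCompactSupport.of_support_subset_isCompact
    hΩb.isCompact_closure (support_indicator_subset.trans subset_closure)
  have hb := hC v F M hvi hvc (hF.congr_ae huv (ae_eq_refl F)) hM T hT0
  set I := ∫ y, |v y| with hI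
  have hI1 : I ≤ V * (C * ((T ^ N)⁻¹ * I + T ^ σ * M)) := by
    have h1 : I = ∫ y in Ω, |v y| := by
      rw [setIntegral_eq_integral_of_forall_compl_eq_zero]
      intro x hx
      rw [hv, indicator_of_notMem hx, abs_zero]
    have h2 : ∫ y in Ω, |v y| ≤ ∫ y in Ω, C * ((T ^ N)⁻¹ * I + T ^ σ * M) :=
      integral_mono_ae hvi.abs.restrict (integrableOn_const hΩb.measure_lt_top.ne)
        (ae_restrict_of_ae hb)
    rw [setIntegral_const, smul_eq_mul] at h2
    linarith
  have hI0 : 0 ≤ I := integral_nonneg fun _ => abs_nonneg _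
  have hI2 : I ≤ 2 * C * V * T ^ σ * M := by
    nlinarith [mul_le_mul_of_nonneg_right hTN hI0]
  filter_upwards [hb, huv] with x hx hxv
  rw [hxv]
  refine hx.trans ?_
  have : C * ((T ^ N)⁻¹ * (2 * C * V * T ^ σ) + T ^ σ) * M
      = C * ((T ^ N)⁻¹ * (2 * C * V * T ^ σ * M) + T ^ σ * M) := by ring
  rw [this]
  gcongr

end FracGrad
end

noncomputable section

namespace FracGrad

/-! ### Variational inequalities in Hilbert spaces -/

/-- The squared norms are nondecreasing and bounded, hence Cauchy, and their increments control the
distances. -/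
theorem cauchySeq_of_norm_sub_sq_le {E : Type*} [NormedAddCommGroup E] {u : ℕ → E} {R : ℝ} (hR : ∀ n, ‖u n‖ ≤ R)
    (hu : ∀ n m, n ≤ m → ‖u n - u m‖ ^ 2 ≤ ‖u m‖ ^ 2 - ‖u n‖ ^ 2) : CauchySeq u := by
  have hmono : Monotone fun n => ‖u n‖ ^ 2 := fun n m h => by
    have := hu n m h
    simp only
    nlinarith [sq_nonneg ‖u n - u m‖]
  have hbdd : BddAbove (range fun n => ‖u n‖ ^ 2) := by
    refine ⟨R ^ 2, ?_⟩
    rintro _ ⟨n, rfl⟩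
    exact pow_le_pow_left₀ (norm_nonneg _) (hR n) 2
  have hc := (tendsto_atTop_ciSup hmono hbdd).cauchySeq
  refine Metric.cauchySeq_iff'.2 fun ε hε => ?_
  obtain ⟨n₀, hn₀⟩ := Metric.cauchySeq_iff'.1 hc (ε ^ 2) (by positivity)
  refine ⟨n₀, fun n hn => ?_⟩
  rw [dist_comm, dist_eq_norm]
  refine lt_of_pow_lt_pow_left₀ 2 hε.le ?_
  refine (hu n₀ n hn).trans_lt ((le_abs_self _).trans_lt ?_)
  simpa [Real.dist_eq] using hn₀ n hn

section VariationalInequality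

variable {E : Type*} [NormedAddCommGroup E] [InnerProductSpace ℝ E]

/-- `L` is affine on the convex set `K`. -/
def IsAffineOn (K : Set E) (L : E → ℝ) : Prop :=
  ∀ v ∈ K, ∀ w ∈ K, ∀ t : ℝ, 0 ≤ t → t ≤ 1 → L ((1 - t) • v + t • w) = (1 - t) * L v + t * L w

/-- The minimiser of ‖v − z‖²/2 − L v over K. L is only affine and continuous on K, as befits v ↦ ∫
f v with f merely integrable, so it need not be represented by a vector of E; strong convexity makes
minimising sequences Cauchy. -/
theorem exists_prox [CompleteSpace E] {K : Set E} {L : E → ℝ} (hKc : IsClosed K)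
    (hKx : Convex ℝ K) (hK : K.Nonempty) (hLa : IsAffineOn K L) (hLc : ContinuousOn L K) {M : ℝ}
    (hLb : ∀ v ∈ K, L v ≤ M) (z : E) :
    ∃ v ∈ K, ∀ w ∈ K, ⟪z - v, w - v⟫ + (L w - L v) ≤ 0 := by
  set J : E → ℝ := fun v => ‖v - z‖ ^ 2 / 2 - L v with hJ
  have hbdd : BddBelow (J '' K) := by
    refine ⟨-M, ?_⟩
    rintro _ ⟨v, hv, rfl⟩
    have := hLb v hv
    simp only [hJ]
    nlinarith [sq_nonneg ‖v - z‖]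
  set d := sInf (J '' K)
  have hd : ∀ v ∈ K, d ≤ J v := fun v hv => csInf_le hbdd (mem_image_of_mem J hv)
  have hcomb : ∀ v ∈ K, ∀ w ∈ K, ∀ t : ℝ, 0 ≤ t → t ≤ 1 →
      d ≤ (1 - t) * J v + t * J w - t * (1 - t) / 2 * ‖w - v‖ ^ 2 := fun v hv w hw t h0 h1 => by
    have hmem : (1 - t) • v + t • w ∈ K := hKx hv hw (by linarith) h0 (by ring)
    refine (hd _ hmem).trans (le_of_eq ?_)
    simp only [hJ]
    rw [hLa v hv w hw t h0 h1]
    have e1 : (1 - t) • v + t • w - z = (v - z) + t • (w - v) := by module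
    have e2 : w - z = (v - z) + (w - v) := by abel
    rw [e1, e2, norm_add_sq_real, norm_add_sq_real, inner_smul_right, norm_smul, mul_pow,
      Real.norm_eq_abs, sq_abs]
    ring
  have hseq : ∀ n : ℕ, ∃ v ∈ K, J v < d + 1 / (n + 1) := fun n => by
    obtain ⟨_, ⟨v, hv, rfl⟩, h⟩ := exists_lt_of_csInf_lt (hK.image J)
      (lt_add_of_pos_right d (Nat.one_div_pos_of_nat (α := ℝ) (n := n)))
    exact ⟨v, hv, h⟩
  choose v hvK hvJ using hseq
  have hdist : ∀ n m, ‖v m - v n‖ ^ 2 ≤ 4 * (1 / ((n : ℝ) + 1)) + 4 * (1 / ((m : ℝ) + 1)) :=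
    fun n m => by
    have := hcomb _ (hvK n) _ (hvK m) (1 / 2) (by norm_num) (by norm_num)
    linarith [hvJ n, hvJ m]
  have h0 : Tendsto (fun n : ℕ => 1 / ((n : ℝ) + 1)) atTop (𝓝 0) :=
    tendsto_one_div_add_atTop_nhds_zero_nat
  have hcau : CauchySeq v := by
    refine Metric.cauchySeq_iff'.2 fun ε hε => ?_
    obtain ⟨n₀, hn₀⟩ := eventually_atTop.1 (h0.eventually_lt_const
      (show (0 : ℝ) < ε ^ 2 / 8 by positivity))
    refine ⟨n₀, fun n hn => ?_⟩
    rw [dist_eq_norm]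
    refine lt_of_pow_lt_pow_left₀ 2 hε.le ?_
    linarith [hdist n₀ n, hn₀ n hn, hn₀ n₀ le_rfl]
  obtain ⟨u, hu⟩ := cauchySeq_tendsto_of_complete hcau
  have huK : u ∈ K := hKc.mem_of_tendsto hu (Eventually.of_forall hvK)
  have hJu : J u ≤ d := by
    have h1 : Tendsto (fun n => J (v n)) atTop (𝓝 (J u)) := by
      have hL : Tendsto (fun n => L (v n)) atTop (𝓝 (L u)) :=
        (hLc u huK).tendsto.comp (tendsto_nhdsWithin_iff.2 ⟨hu, Eventually.of_forall hvK⟩)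
      exact (((hu.sub_const z).norm.pow 2).div_const 2).sub hL
    have h2 : Tendsto (fun n : ℕ => d + 1 / ((n : ℝ) + 1)) atTop (𝓝 (d + 0)) := h0.const_add d
    rw [add_zero] at h2
    exact le_of_tendsto_of_tendsto' h1 h2 fun n => (hvJ n).le
  refine ⟨u, huK, fun w hw => ?_⟩
  -- Minimality along the segment from u to w, divided by t; letting t → 0 gives the first-order
  -- condition.
  have hkey : ∀ t : ℝ, 0 < t → t ≤ 1 → ⟪z - u, w - u⟫ + (L w - L u) ≤ t * (‖w - u‖ ^ 2 / 2) :=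
    fun t h0 h1 => by
    have := hcomb u huK w hw t h0.le h1
    have h2 : 0 ≤ t * (J w - J u - (1 - t) / 2 * ‖w - u‖ ^ 2) := by nlinarith
    have h3 := nonneg_of_mul_nonneg_right h2 h0
    have h4 : J w - J u = ‖w - u‖ ^ 2 / 2 - ⟪z - u, w - u⟫ - (L w - L u) := by
      simp only [hJ]
      have e2 : w - z = (w - u) - (z - u) := by abel
      rw [e2, norm_sub_sq_real, ← norm_neg (u - z), neg_sub, real_inner_comm]
      ring
    rw [h4] at h3
    linarith
  have hlim : Tendsto (fun t : ℝ => t * (‖w - u‖ ^ 2 / 2)) (𝓝[>] 0) (𝓝 0) := by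
    have : Tendsto (fun t : ℝ => t * (‖w - u‖ ^ 2 / 2)) (𝓝 0) (𝓝 (0 * (‖w - u‖ ^ 2 / 2))) :=
      tendsto_id.mul_const _
    rw [zero_mul] at this
    exact this.mono_left nhdsWithin_le_nhds
  refine ge_of_tendsto hlim ?_
  filter_upwards [Ioc_mem_nhdsGT (zero_lt_one' ℝ)] with t ht using hkey t ht.1 ht.2

/-- Stampacchia's argument: the proximal map P of ρL is nonexpansive, u ↦ P(u − ρBu) is a
contraction for small ρ, and its fixed point solves the inequality. -/
theorem exists_vi_of_coercive [CompleteSpace E] {K : Set E} {L : E → ℝ} (hKc : IsClosed K)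
    (hKx : Convex ℝ K) (hK : K.Nonempty) (hLa : IsAffineOn K L) (hLc : ContinuousOn L K) {M : ℝ}
    (hLb : ∀ v ∈ K, L v ≤ M) (B : E →L[ℝ] E) {ε : ℝ} (hε : 0 < ε)
    (hB : ∀ v, ε * ‖v‖ ^ 2 ≤ ⟪B v, v⟫) :
    ∃ u ∈ K, ∀ w ∈ K, L w - L u ≤ ⟪B u, w - u⟫ := by
  set b := ‖B‖
  set ρ := ε / (b ^ 2 + 1) with hρ
  have hρ0 : 0 < ρ := by positivity
  -- With this, 1 − 2ρε + ρ²b² ≤ 1 − ρε, the square of the contraction constant.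
  have hρb : ρ * b ^ 2 ≤ ε := by
    rw [hρ, div_mul_eq_mul_div, div_le_iff₀ (by positivity)]
    nlinarith
  have hprox : ∀ z, ∃ v ∈ K, ∀ w ∈ K, ⟪z - v, w - v⟫ + (ρ * L w - ρ * L v) ≤ 0 :=
    exists_prox (L := fun v => ρ * L v) hKc hKx hK
      (fun v hv w hw t h0 h1 => by simp only [hLa v hv w hw t h0 h1]; ring)
      (hLc.const_mul ρ) (M := ρ * M) (fun v hv => mul_le_mul_of_nonneg_left (hLb v hv) hρ0.le)
  choose P hPK hP using hprox
  have hPlip : ∀ z₁ z₂, ‖P z₁ - P z₂‖ ≤ ‖z₁ - z₂‖ := fun z₁ z₂ => by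
    have h1 := hP z₁ (P z₂) (hPK z₂)
    have h2 := hP z₂ (P z₁) (hPK z₁)
    have h3 : ‖P z₁ - P z₂‖ ^ 2 ≤ ⟪z₁ - z₂, P z₁ - P z₂⟫ := by
      rw [← real_inner_self_eq_norm_sq]
      simp only [inner_sub_left, inner_sub_right] at h1 h2 ⊢
      linarith
    have h4 := h3.trans (real_inner_le_norm _ _)
    rcases (norm_nonneg (P z₁ - P z₂)).eq_or_lt with h | h
    · rw [← h]; exact norm_nonneg _
    · rw [sq] at h4
      exact le_of_mul_le_mul_right h4 h
  set S : E → E := fun u => P (u - ρ • B u)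
  have hS : ContractingWith (√(1 - ρ * ε)).toNNReal S := by
    refine ⟨?_, LipschitzWith.of_dist_le_mul fun u v => ?_⟩
    · rw [Real.toNNReal_lt_one, Real.sqrt_lt' one_pos]
      nlinarith [mul_pos hρ0 hε]
    · rw [dist_eq_norm, dist_eq_norm]
      refine (hPlip _ _).trans ?_
      rw [Real.coe_toNNReal _ (Real.sqrt_nonneg _)]
      have e : u - ρ • B u - (v - ρ • B v) = (u - v) - ρ • B (u - v) := by
        rw [map_sub]; module
      rw [e]
      set w := u - v
      have h1 : ‖w - ρ • B w‖ ^ 2 ≤ (1 - ρ * ε) * ‖w‖ ^ 2 := by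
        rw [norm_sub_sq_real, inner_smul_right, norm_smul, mul_pow, Real.norm_eq_abs, sq_abs,
          real_inner_comm]
        have h2 : ‖B w‖ ^ 2 ≤ b ^ 2 * ‖w‖ ^ 2 := by
          rw [← mul_pow]
          exact pow_le_pow_left₀ (norm_nonneg _) (B.le_opNorm w) 2
        have h3 := mul_le_mul_of_nonneg_left (hB w) hρ0.le
        have h4 : ρ ^ 2 * ‖B w‖ ^ 2 ≤ ρ * ε * ‖w‖ ^ 2 := by
          calc ρ ^ 2 * ‖B w‖ ^ 2 ≤ ρ ^ 2 * (b ^ 2 * ‖w‖ ^ 2) := by gcongr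
            _ = ρ * (ρ * b ^ 2) * ‖w‖ ^ 2 := by ring
            _ ≤ ρ * ε * ‖w‖ ^ 2 := by gcongr
        nlinarith
      have h2 := Real.abs_le_sqrt h1
      rwa [abs_of_nonneg (norm_nonneg _), Real.sqrt_mul' _ (sq_nonneg _),
        Real.sqrt_sq (norm_nonneg _)] at h2
  have : Nonempty E := ⟨hK.some⟩
  set u := hS.fixedPoint S
  have hu : P (u - ρ • B u) = u := hS.fixedPoint_isFixedPt
  refine ⟨u, hu ▸ hPK _, fun w hw => ?_⟩
  have h1 := hP (u - ρ • B u) w hw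
  rw [hu, show u - ρ • B u - u = -(ρ • B u) by abel, inner_neg_left, real_inner_smul_left] at h1
  refine le_of_mul_le_mul_left ?_ hρ0
  linarith

/-- Existence for a monotone variational inequality whose solutions are a priori bounded. -/
theorem exists_vi_of_monotone [CompleteSpace E] {K : Set E} {L : E → ℝ} (hKc : IsClosed K)
    (hKx : Convex ℝ K) (hK0 : (0 : E) ∈ K) (hLa : IsAffineOn K L) (hLc : ContinuousOn L K)
    (hL0 : L 0 = 0) {M : ℝ} (hLb : ∀ v ∈ K, L v ≤ M) (A : E →L[ℝ] E) (hA : ∀ v, 0 ≤ ⟪A v, v⟫)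
    {R : ℝ} (hR : ∀ v ∈ K, ⟪A v, v⟫ ≤ L v → ‖v‖ ≤ R) :
    ∃ u ∈ K, ∀ w ∈ K, L w - L u ≤ ⟪A u, w - u⟫ := by
  set ε : ℕ → ℝ := fun n => 1 / ((n : ℝ) + 1) with hεdef
  have hε : ∀ n, 0 < ε n := fun n => by positivity
  have hex : ∀ n, ∃ u ∈ K, ∀ w ∈ K, L w - L u ≤ ⟪A u, w - u⟫ + ε n * ⟪u, w - u⟫ := fun n => by
    obtain ⟨u, hu, h⟩ := exists_vi_of_coercive hKc hKx ⟨0, hK0⟩ hLa hLc hLb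
      (A + ε n • ContinuousLinearMap.id ℝ E) (hε n) fun v => by
        simp only [add_apply, _root_.smul_apply, ContinuousLinearMap.id_apply, inner_add_left,
          real_inner_smul_left, real_inner_self_eq_norm_sq]
        linarith [hA v]
    refine ⟨u, hu, fun w hw => ?_⟩
    have := h w hw
    simpa only [add_apply, _root_.smul_apply, ContinuousLinearMap.id_apply, inner_add_left,
          real_inner_smul_left] using this
  choose u huK hu using hex
  have hbd : ∀ n, ‖u n‖ ≤ R := fun n => hR _ (huK n) (by
    have := hu n 0 hK0
    simp only [zero_sub, inner_neg_right, hL0, real_inner_self_eq_norm_sq] at this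
    nlinarith [mul_nonneg (hε n).le (sq_nonneg ‖u n‖)])
  -- Each regularised inequality is tested with the other solution. Monotonicity of A leaves only
  -- the ε terms, so the norms grow as ε decreases; were they to drop, h4 would force the two
  -- solutions to coincide.
  have hmon : ∀ n m, n ≤ m → ‖u n - u m‖ ^ 2 ≤ ‖u m‖ ^ 2 - ‖u n‖ ^ 2 := fun n m hnm => by
    have h1 := hu n (u m) (huK m)
    have h2 := hu m (u n) (huK n)
    have h3 := hA (u n - u m)
    have hδ : ε m ≤ ε n := by simp only [hεdef]; gcongr
    have hn := hε n
    have hm := hε m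
    have e : ‖u n - u m‖ ^ 2 = ‖u n‖ ^ 2 - 2 * ⟪u n, u m⟫ + ‖u m‖ ^ 2 := norm_sub_sq_real _ _
    have hP := sq_nonneg ‖u n - u m‖
    simp only [map_sub, inner_sub_left, inner_sub_right, real_inner_self_eq_norm_sq] at h1 h2 h3
    rw [real_inner_comm (u n) (u m)] at h2
    have h4 : (ε n + ε m) * ‖u n - u m‖ ^ 2 ≤ (ε n - ε m) * (‖u m‖ ^ 2 - ‖u n‖ ^ 2) := by
      rw [e]
      linarith
    have h5 : ε n * ‖u n - u m‖ ^ 2 ≤ ε n * (‖u m‖ ^ 2 - ‖u n‖ ^ 2) := by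
      rcases le_or_gt 0 (‖u m‖ ^ 2 - ‖u n‖ ^ 2) with h | h
      · nlinarith
      · exfalso
        have : (ε n - ε m) * (‖u m‖ ^ 2 - ‖u n‖ ^ 2) ≤ 0 :=
          mul_nonpos_of_nonneg_of_nonpos (by linarith) h.le
        have h6 : ‖u n - u m‖ ^ 2 = 0 := by
          refine le_antisymm ?_ hP
          refine nonpos_of_mul_nonpos_right (h4.trans this) (by linarith)
        have h7 : u n = u m := by
          simpa [sub_eq_zero] using h6
        rw [h7, sub_self] at h
        exact lt_irrefl _ h
    exact le_of_mul_le_mul_left h5 hn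
  obtain ⟨v, hv⟩ := cauchySeq_tendsto_of_complete (cauchySeq_of_norm_sub_sq_le hbd hmon)
  have hvK : v ∈ K := hKc.mem_of_tendsto hv (Eventually.of_forall huK)
  have hL : Tendsto (fun n => L (u n)) atTop (𝓝 (L v)) :=
    (hLc v hvK).tendsto.comp (tendsto_nhdsWithin_iff.2 ⟨hv, Eventually.of_forall huK⟩)
  refine ⟨v, hvK, fun w hw => ?_⟩
  have h0 : Tendsto ε atTop (𝓝 0) := tendsto_one_div_add_atTop_nhds_zero_nat
  have h1 : Tendsto (fun n => ⟪A (u n), w - u n⟫ + ε n * ⟪u n, w - u n⟫) atTop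
      (𝓝 (⟪A v, w - v⟫ + 0 * ⟪v, w - v⟫)) :=
    (((A.continuous.tendsto v).comp hv).inner (hv.const_sub w)).add
      (h0.mul (hv.inner (hv.const_sub w)))
  rw [zero_mul, add_zero] at h1
  exact le_of_tendsto_of_tendsto' (hL.const_sub (L w)) h1 fun n => hu n w hw

end VariationalInequality

end FracGrad
end

noncomputable section

namespace FracGrad

variable {N : ℕ}

/-! ### Lagrange multipliers in the dual of `L^∞` -/

theorem ae_norm_le_norm_Linf {F : Type*} [NormedAddCommGroup F]
    (w : Lp F ∞ (volume : Measure (RN N))) : ∀ᵐ x, ‖w x‖ ≤ ‖w‖ := by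
  filter_upwards [ae_le_eLpNormEssSup (f := w) (μ := volume)] with x hx
  rw [← eLpNorm_exponent_top, ← ofReal_norm] at hx
  rw [Lp.norm_def]
  exact (ENNReal.ofReal_le_iff_le_toReal (Lp.memLp w).2.ne).1 hx

theorem LinfDual.mul_apply_ae (μ : LinfDual N) (h w : Lp ℝ ∞ (volume : Measure (RN N))) :
    ∃ q : Lp ℝ ∞ (volume : Measure (RN N)), μ.mul h w = μ q ∧ ∀ᵐ x, q x = h x * w x :=
  ⟨_, rfl, (ContinuousLinearMap.mul ℝ ℝ).coeFn_holder h w⟩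

/-- The pointwise inner product of two bounded fields. -/
def innerLinf (a b : Lp (RN N) ∞ (volume : Measure (RN N))) :
    Lp ℝ ∞ (volume : Measure (RN N)) :=
  (innerSL ℝ (E := RN N)).holderL volume ∞ ∞ ∞ a b

theorem innerLinf_ae (a b : Lp (RN N) ∞ (volume : Measure (RN N))) :
    ∀ᵐ x, innerLinf a b x = ⟪a x, b x⟫ :=
  (innerSL ℝ (E := RN N)).coeFn_holder a b

theorem LinfDual.mulVec_apply (μ : LinfDual N) (a b : Lp (RN N) ∞ (volume : Measure (RN N))) :
    μ.mulVec a b = μ (innerLinf a b) := rfl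

theorem innerLinf_comm (a b : Lp (RN N) ∞ (volume : Measure (RN N))) :
    innerLinf a b = innerLinf b a := by
  refine Lp.ext ?_
  filter_upwards [innerLinf_ae a b, innerLinf_ae b a] with x h1 h2
  rw [h1, h2, real_inner_comm]

/-- The constant function `c` in `L^∞`. -/
def constLinf (N : ℕ) (c : ℝ) : Lp ℝ ∞ (volume : Measure (RN N)) :=
  (memLp_top_const c).toLp (fun _ => c)

theorem constLinf_ae (c : ℝ) : ∀ᵐ x : RN N, constLinf N c x = c := MemLp.coeFn_toLp _

theorem LinfDual.IsNonneg.mono {μ : LinfDual N} (hμ : μ.IsNonneg)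
    {v w : Lp ℝ ∞ (volume : Measure (RN N))} (h : ∀ᵐ x, v x ≤ w x) : μ v ≤ μ w := by
  have := hμ (w - v) ((Lp.coeFn_nonneg _).1 (by
    filter_upwards [Lp.coeFn_sub w v, h] with x h1 h2
    rw [h1]
    simpa using h2))
  rw [map_sub] at this
  linarith

/-- Openness holds because the norm is the uniform one; the order cone of L² has no interior, which
is why the multiplier is sought in the dual of L^∞. -/
theorem isOpen_uniformly_neg :
    IsOpen {p : Lp ℝ ∞ (volume : Measure (RN N)) × ℝ |
      (∃ δ > 0, ∀ᵐ x, p.1 x ≤ -δ) ∧ p.2 < 0} := by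
  have h1 : IsOpen {w : Lp ℝ ∞ (volume : Measure (RN N)) | ∃ δ > 0, ∀ᵐ x, w x ≤ -δ} := by
    refine Metric.isOpen_iff.2 ?_
    rintro w ⟨δ, hδ, hw⟩
    refine ⟨δ / 2, by positivity, fun w' hw' => ⟨δ / 2, by positivity, ?_⟩⟩
    rw [Metric.mem_ball, dist_eq_norm] at hw'
    filter_upwards [hw, ae_norm_le_norm_Linf (w' - w), Lp.coeFn_sub w' w] with x h1 h2 h3
    rw [h3, Pi.sub_apply, Real.norm_eq_abs] at h2
    linarith [le_abs_self (w' x - w x)]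
  exact (h1.preimage continuous_fst).inter (isOpen_Iio.preimage continuous_snd)

theorem convex_uniformly_neg :
    Convex ℝ {p : Lp ℝ ∞ (volume : Measure (RN N)) × ℝ |
      (∃ δ > 0, ∀ᵐ x, p.1 x ≤ -δ) ∧ p.2 < 0} := by
  have h1 : Convex ℝ {w : Lp ℝ ∞ (volume : Measure (RN N)) | ∃ δ > 0, ∀ᵐ x, w x ≤ -δ} := by
    rintro w₁ ⟨δ₁, hδ₁, h₁⟩ w₂ ⟨δ₂, hδ₂, h₂⟩ a b ha hb hab
    refine ⟨min δ₁ δ₂, lt_min hδ₁ hδ₂, ?_⟩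
    filter_upwards [h₁, h₂, Lp.coeFn_add (a • w₁) (b • w₂), Lp.coeFn_smul a w₁,
      Lp.coeFn_smul b w₂] with x e1 e2 e3 e4 e5
    rw [e3, Pi.add_apply, e4, e5]
    simp only [Pi.smul_apply, smul_eq_mul]
    have := min_le_left δ₁ δ₂
    have := min_le_right δ₁ δ₂
    calc a * w₁ x + b * w₂ x ≤ a * (-min δ₁ δ₂) + b * (-min δ₁ δ₂) := by
          gcongr <;> linarith
      _ = -min δ₁ δ₂ := by rw [← add_mul, hab, one_mul]
  exact (h1.linear_preimage (LinearMap.fst ℝ _ _)).inter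
    ((convex_Iio (0 : ℝ)).linear_preimage (LinearMap.snd ℝ _ _))

/-! ### Separation and the multiplier rule. -/

variable {W : Type*} [AddCommGroup W] [Module ℝ W]

/-- The set of perturbations used in the separation argument. -/
def perturbationSet (D : W →ₗ[ℝ] Lp (RN N) ∞ (volume : Measure (RN N))) (T : W →ₗ[ℝ] ℝ)
    (g : RN N → ℝ) (u : W) : Set (Lp ℝ ∞ (volume : Measure (RN N)) × ℝ) :=
  {p | ∃ v, (∀ᵐ x, ‖D v x‖ ^ 2 - g x ^ 2 ≤ p.1 x) ∧ T u - T v ≤ p.2}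

theorem convex_perturbationSet (D : W →ₗ[ℝ] Lp (RN N) ∞ (volume : Measure (RN N)))
    (T : W →ₗ[ℝ] ℝ) (g : RN N → ℝ) (u : W) : Convex ℝ (perturbationSet D T g u) := by
  rintro p₁ ⟨v₁, h₁, k₁⟩ p₂ ⟨v₂, h₂, k₂⟩ a b ha hb hab
  refine ⟨a • v₁ + b • v₂, ?_, ?_⟩
  · filter_upwards [h₁, h₂, Lp.coeFn_add (a • p₁.1) (b • p₂.1), Lp.coeFn_smul a p₁.1,
      Lp.coeFn_smul b p₂.1, Lp.coeFn_add (a • D v₁) (b • D v₂), Lp.coeFn_smul a (D v₁),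
      Lp.coeFn_smul b (D v₂)] with x e1 e2 e3 e4 e5 e6 e7 e8
    rw [Prod.fst_add, Prod.smul_fst, Prod.smul_fst, e3, Pi.add_apply, e4, e5, map_add, map_smul,
      map_smul, e6, Pi.add_apply, e7, e8]
    simp only [Pi.smul_apply, smul_eq_mul]
    have h3 : ‖a • D v₁ x + b • D v₂ x‖ ^ 2 ≤ a * ‖D v₁ x‖ ^ 2 + b * ‖D v₂ x‖ ^ 2 := by
      have h4 : ‖a • D v₁ x + b • D v₂ x‖ ≤ a * ‖D v₁ x‖ + b * ‖D v₂ x‖ := by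
        refine (norm_add_le _ _).trans (le_of_eq ?_)
        rw [norm_smul, norm_smul, Real.norm_of_nonneg ha, Real.norm_of_nonneg hb]
      refine (pow_le_pow_left₀ (norm_nonneg _) h4 2).trans ?_
      have hb' : b = 1 - a := by linarith
      subst hb'
      nlinarith [mul_nonneg (mul_nonneg ha hb) (sq_nonneg (‖D v₁ x‖ - ‖D v₂ x‖))]
    have h5 : g x ^ 2 = a * g x ^ 2 + b * g x ^ 2 := by rw [← add_mul, hab, one_mul]
    rw [h5]
    nlinarith [mul_le_mul_of_nonneg_left e1 ha, mul_le_mul_of_nonneg_left e2 hb]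
  · simp only [map_add, map_smul, smul_eq_mul, Prod.snd_add, Prod.smul_snd]
    have : T u = a * T u + b * T u := by rw [← add_mul, hab, one_mul]
    nlinarith [mul_le_mul_of_nonneg_left k₁ ha, mul_le_mul_of_nonneg_left k₂ hb]

/-- A point both in the open negative cone and in the perturbation set would be feasible and
strictly better than u. The separating functional splits into μ on L^∞ and a scalar κ; Slater's
condition makes κ positive, and division by κ gives the Lagrangian inequality. -/
theorem exists_multiplier_aux (D : W →ₗ[ℝ] Lp (RN N) ∞ (volume : Measure (RN N)))
    (T : W →ₗ[ℝ] ℝ) {g : RN N → ℝ} {ν : ℝ} (hν : 0 < ν)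
    (hgν : ∀ᵐ x, ν ≤ g x) {u : W} (hu : ∀ᵐ x, ‖D u x‖ ≤ g x)
    (hmax : ∀ v, (∀ᵐ x, ‖D v x‖ ≤ g x) → T v ≤ T u) :
    ∃ μ : LinfDual N, μ.IsNonneg ∧ ∀ v (w : Lp ℝ ∞ (volume : Measure (RN N))),
      (∀ᵐ x, ‖D v x‖ ^ 2 - g x ^ 2 ≤ w x) → 0 ≤ μ w + (T u - T v) := by
  obtain ⟨f, c, hfO, hfC⟩ := geometric_hahn_banach_open convex_uniformly_neg
    isOpen_uniformly_neg (convex_perturbationSet D T g u) (by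
      rw [Set.disjoint_left]
      rintro p ⟨⟨δ, hδ, hp⟩, hp2⟩ ⟨v, hv, hv2⟩
      have : T v ≤ T u := hmax v (by
        filter_upwards [hp, hv, hgν] with x h1 h2 h3
        exact (sq_le_sq₀ (norm_nonneg _) (by linarith)).1 (by linarith))
      linarith)
  set μ : LinfDual N := f.comp (ContinuousLinearMap.inl ℝ _ _) with hμ
  set κ : ℝ := f (0, 1) with hκ
  have hf : ∀ w s, f (w, s) = μ w + s * κ := fun w s => by
    have : ((w, s) : Lp ℝ ∞ (volume : Measure (RN N)) × ℝ) = (w, 0) + s • (0, 1) := by simp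
    rw [this, map_add, map_smul]
    rfl
  have hneg : ∀ t : ℝ, 0 < t → (t • (constLinf N (-1), (-1 : ℝ)))
      ∈ {p : Lp ℝ ∞ (volume : Measure (RN N)) × ℝ | (∃ δ > 0, ∀ᵐ x, p.1 x ≤ -δ) ∧ p.2 < 0} :=
    fun t ht => by
    refine ⟨⟨t, ht, ?_⟩, by simpa using ht⟩
    filter_upwards [Lp.coeFn_smul t (constLinf N (-1)), constLinf_ae (N := N) (-1)] with x h1 h2
    rw [Prod.smul_fst, h1, Pi.smul_apply, h2]
    simp
  -- The negative set is a cone, so the functional has values near 0 on it: if c < 0, the factor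
  -- c/(2o) produces the value c/2 > c.
  have hc : 0 ≤ c := by
    by_contra hc
    push Not at hc
    have h1 := hfO _ (hneg 1 one_pos)
    rw [one_smul] at h1
    set o := f (constLinf N (-1), (-1 : ℝ))
    have ho : o < 0 := h1.trans hc
    have h2 := hfO _ (hneg (c / (2 * o)) (div_pos_of_neg_of_neg hc (by linarith)))
    rw [map_smul, smul_eq_mul] at h2
    have : c / (2 * o) * o = c / 2 := by
      have := ho.ne
      field_simp
    change c / (2 * o) * o < c at h2
    rw [this] at h2
    linarith
  have hC : ∀ w s, (w, s) ∈ perturbationSet D T g u → 0 ≤ μ w + s * κ := fun w s h => by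
    rw [← hf]
    exact hc.trans (hfC _ h)
  have hsq : ∀ᵐ x, ‖D u x‖ ^ 2 - g x ^ 2 ≤ 0 := by
    filter_upwards [hu] with x hx
    linarith [pow_le_pow_left₀ (norm_nonneg _) hx 2]
  have hμ0 : μ.IsNonneg := fun w hw => by
    have := hC w 0 ⟨u, by
      filter_upwards [hsq, (Lp.coeFn_nonneg _).2 hw] with x h1 h2
      exact h1.trans h2, by simp⟩
    simpa using this
  have hκ0 : 0 ≤ κ := by
    have := hC 0 1 ⟨u, by
      filter_upwards [hsq, Lp.coeFn_zero ℝ ∞ (volume : Measure (RN N))] with x h1 h2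
      rw [h2]
      exact h1, by simp⟩
    simpa using this
  have h0C : ((0 : Lp ℝ ∞ (volume : Measure (RN N))), (0 : ℝ)) ∈ perturbationSet D T g u :=
    ⟨u, by
      filter_upwards [hsq, Lp.coeFn_zero ℝ ∞ (volume : Measure (RN N))] with x h1 h2
      rw [h2]
      exact h1, by simp⟩
  have hc0 : c ≤ 0 := by simpa [hf] using hfC _ h0C
  have hone : constLinf N (-1) = -constLinf N 1 := by
    refine Lp.ext ?_
    filter_upwards [constLinf_ae (N := N) (-1), constLinf_ae (N := N) 1,
      Lp.coeFn_neg (constLinf N 1)] with x h1 h2 h3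
    rw [h1, h3, Pi.neg_apply, h2]
  -- Slater's condition: if κ = 0, the open side gives μ(1) > 0, while v = 0 with w = −ν² gives −ν²
  -- μ(1) ≥ 0.
  have hκpos : 0 < κ := by
    refine lt_of_le_of_ne hκ0 fun h => ?_
    have h1 := hfO _ (hneg 1 one_pos)
    rw [one_smul, hf, ← h, hone, map_neg] at h1
    have h2 := hC (constLinf N (-ν ^ 2)) (T u) ⟨0, by
      filter_upwards [constLinf_ae (N := N) (-ν ^ 2), hgν,
        Lp.coeFn_zero (RN N) ∞ (volume : Measure (RN N))] with x h1 h2 h3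
      rw [map_zero, h3, h1, Pi.zero_apply, norm_zero]
      nlinarith, by simp⟩
    rw [← h, mul_zero, add_zero] at h2
    have h3 : constLinf N (-ν ^ 2) = -(ν ^ 2 • constLinf N 1) := by
      refine Lp.ext ?_
      filter_upwards [constLinf_ae (N := N) (-ν ^ 2), constLinf_ae (N := N) 1,
        Lp.coeFn_neg (ν ^ 2 • constLinf N 1), Lp.coeFn_smul (ν ^ 2) (constLinf N 1)]
        with x h1 h2 h3 h4
      rw [h1, h3, Pi.neg_apply, h4, Pi.smul_apply, h2, smul_eq_mul, mul_one]
    rw [h3, map_neg, map_smul, smul_eq_mul] at h2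
    have : 0 < ν ^ 2 := by positivity
    nlinarith
  refine ⟨κ⁻¹ • μ, fun w hw => ?_, fun v w hw => ?_⟩
  · rw [_root_.smul_apply, smul_eq_mul]
    exact mul_nonneg (inv_nonneg.2 hκ0) (hμ0 w hw)
  · have h1 := mul_nonneg (inv_nonneg.2 hκ0) (hC w _ ⟨v, hw, le_rfl⟩)
    rw [mul_add, mul_comm _ κ, inv_mul_cancel_left₀ hκpos.ne'] at h1
    rwa [_root_.smul_apply, smul_eq_mul]

/-- A maximiser of a linear functional under the constraint `|D v| ≤ g` has a nonnegative Lagrange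
multiplier in the dual of `L^∞`. -/
theorem exists_multiplier (D : W →ₗ[ℝ] Lp (RN N) ∞ (volume : Measure (RN N)))
    (T : W →ₗ[ℝ] ℝ) {g : RN N → ℝ} (hg : MemLp g ∞ volume) {ν : ℝ} (hν : 0 < ν)
    (hgν : ∀ᵐ x, ν ≤ g x) {u : W} (hu : ∀ᵐ x, ‖D u x‖ ≤ g x)
    (hmax : ∀ v, (∀ᵐ x, ‖D v x‖ ≤ g x) → T v ≤ T u) :
    ∃ μ : LinfDual N, μ.IsNonneg ∧ (∀ v, μ.mulVec (D u) (D v) = T v) ∧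
      ∀ q : Lp ℝ ∞ (volume : Measure (RN N)), (∀ᵐ x, q x = g x ^ 2 - ‖D u x‖ ^ 2) → μ q = 0 := by
  obtain ⟨μ, hμ0, hC⟩ := exists_multiplier_aux D T hν hgν hu hmax
  have hsq : ∀ᵐ x, ‖D u x‖ ^ 2 - g x ^ 2 ≤ 0 := by
    filter_upwards [hu] with x hx
    linarith [pow_le_pow_left₀ (norm_nonneg _) hx 2]
  have hg2 : MemLp (fun x => g x ^ 2) ∞ volume := by
    simpa only [sq] using! hg.mul (r := ∞) hg
  set γ : Lp ℝ ∞ (volume : Measure (RN N)) := hg2.toLp _ with hγ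
  have hγae : ∀ᵐ x, γ x = g x ^ 2 := hg2.coeFn_toLp
  have hval : ∀ v, 0 ≤ μ (innerLinf (D v) (D v)) - μ γ + (T u - T v) := fun v => by
    rw [← map_sub]
    refine hC _ _ ?_
    filter_upwards [hγae, innerLinf_ae (D v) (D v), Lp.coeFn_sub (innerLinf (D v) (D v)) γ]
      with x h1 h2 h3
    rw [h3, Pi.sub_apply, h1, h2, real_inner_self_eq_norm_sq]
  -- One inequality is the Lagrangian inequality at v = u, the other is feasibility of u and
  -- positivity of μ.
  have hcomp : μ γ = μ (innerLinf (D u) (D u)) := by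
    refine le_antisymm ?_ ?_
    · simpa using hval u
    · refine hμ0.mono ?_
      filter_upwards [hγae, innerLinf_ae (D u) (D u), hsq] with x h1 h2 h3
      rw [h1, h2, real_inner_self_eq_norm_sq]
      linarith
  have hadd : ∀ v (t : ℝ), innerLinf (D (u + t • v)) (D (u + t • v))
      = innerLinf (D u) (D u) + (2 * t) • innerLinf (D u) (D v)
        + t ^ 2 • innerLinf (D v) (D v) := fun v t => by
    have h1 := innerLinf_comm (D v) (D u)
    simp only [innerLinf] at h1 ⊢
    simp only [map_add, map_smul, add_apply, _root_.smul_apply, h1]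
    module
  have hfirst : ∀ v, 2 * μ (innerLinf (D u) (D v)) = T v := fun v => by
    have key : ∀ t : ℝ, 0 ≤ t * (2 * μ (innerLinf (D u) (D v)) - T v)
        + t ^ 2 * μ (innerLinf (D v) (D v)) := fun t => by
      have := hval (u + t • v)
      rw [hadd, hcomp, map_add, map_add, map_smul, map_smul, map_add, map_smul] at this
      simp only [smul_eq_mul] at this
      linarith
    set a := 2 * μ (innerLinf (D u) (D v)) - T v with ha
    set b := μ (innerLinf (D v) (D v))
    have hb : 0 ≤ b := hμ0 _ ((Lp.coeFn_nonneg _).1 (by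
      filter_upwards [innerLinf_ae (D v) (D v)] with x hx
      rw [hx]
      exact real_inner_self_nonneg))
    -- Near the minimiser of the quadratic; the +1 avoids dividing by zero when b = 0, and the value
    -- is −a²/(b+1)².
    have h1 := key (-a / (b + 1))
    have hb1 : 0 < b + 1 := by linarith
    have h2 : -a / (b + 1) * a + (-a / (b + 1)) ^ 2 * b = -(a ^ 2 / (b + 1) ^ 2) := by
      field_simp
      ring
    rw [h2] at h1
    have h3 : a ^ 2 / (b + 1) ^ 2 = 0 := le_antisymm (by linarith) (by positivity)
    have h4 : a = 0 := by
      rcases div_eq_zero_iff.1 h3 with h | h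
      · exact pow_eq_zero_iff (two_ne_zero) |>.1 h
      · exact absurd h (by positivity)
    linarith
  -- The factor 2 comes from differentiating the square in the constraint.
  refine ⟨(2 : ℝ) • μ, fun w hw => ?_, fun v => ?_, fun q hq => ?_⟩
  · rw [_root_.smul_apply, smul_eq_mul]
    exact mul_nonneg zero_le_two (hμ0 w hw)
  · rw [LinfDual.mulVec_apply, _root_.smul_apply, smul_eq_mul, hfirst]
  · have : q = γ - innerLinf (D u) (D u) := by
      refine Lp.ext ?_
      filter_upwards [hq, hγae, innerLinf_ae (D u) (D u),
        Lp.coeFn_sub γ (innerLinf (D u) (D u))] with x h1 h2 h3 h4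
      rw [h4, Pi.sub_apply, h1, h2, h3, real_inner_self_eq_norm_sq]
    rw [this]
    simp only [_root_.smul_apply, map_sub, hcomp, sub_self]

/-- Complementarity in product form. -/
theorem LinfDual.mul_eq_zero {μ : LinfDual N} (hμ : μ.IsNonneg)
    {h q : Lp ℝ ∞ (volume : Measure (RN N))} {C : ℝ}
    (hhq : ∀ᵐ x, |h x| ≤ C * q x) (hq : μ q = 0) : μ.mul h = 0 := by
  refine ContinuousLinearMap.ext fun w => ?_
  obtain ⟨p, hp, hpx⟩ := μ.mul_apply_ae h w
  rw [hp]
  set k := C * ‖w‖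
  have hk : ∀ᵐ x, |p x| ≤ k * q x := by
    filter_upwards [hpx, hhq, ae_norm_le_norm_Linf w] with x h1 h2 h3
    rw [h1, abs_mul]
    calc |h x| * |w x| ≤ (C * q x) * ‖w‖ :=
          mul_le_mul h2 h3 (abs_nonneg _) ((abs_nonneg _).trans h2)
      _ = k * q x := by ring
  have h1 : μ p ≤ μ (k • q) := hμ.mono (by
    filter_upwards [hk, Lp.coeFn_smul k q] with x h1 h2
    rw [h2]
    exact (le_abs_self _).trans h1)
  have h2 : μ ((-k) • q) ≤ μ p := hμ.mono (by
    filter_upwards [hk, Lp.coeFn_smul (-k) q] with x h1 h2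
    rw [h2]
    simp only [Pi.smul_apply, smul_eq_mul]
    linarith [neg_abs_le (p x)])
  rw [map_smul, hq, smul_zero] at h1 h2
  exact le_antisymm h1 h2

end FracGrad
end

noncomputable section

namespace FracGrad

variable {N : ℕ}

/-! ### The space `H^σ_0(Ω)` as a closed subspace of a product of `L²` spaces -/

/-- Pairs of a square-integrable function and a square-integrable field. -/
abbrev Pair (N : ℕ) : Type :=
  WithLp 2 (Lp ℝ 2 (volume : Measure (RN N)) × Lp (RN N) 2 (volume : Measure (RN N)))

/-- An L² convergent sequence has an almost everywhere convergent subsequence. -/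
theorem isClosed_ae_mem {F : Type*} [NormedAddCommGroup F] {S : RN N → Set F}
    (hS : ∀ x, IsClosed (S x)) :
    IsClosed {w : Lp F 2 (volume : Measure (RN N)) | ∀ᵐ x, w x ∈ S x} := by
  refine IsSeqClosed.isClosed fun w w₀ hw hlim => ?_
  obtain ⟨ns, -, hns⟩ := (tendstoInMeasure_of_tendsto_Lp hlim).exists_seq_tendsto_ae
  filter_upwards [hns, ae_all_iff.2 hw] with x h1 h2
  exact (hS x).mem_of_tendsto h1 (Eventually.of_forall fun i => h2 (ns i))

theorem IsTest.testGrad_add (hN : 1 ≤ N) {α : ℝ} (hα : 0 < α) (hαN : α < N) {U : Set (RN N)}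
    {φ ψ : RN N → ℝ} (hφ : IsTest U φ) (hψ : IsTest U ψ) :
    testGrad α (φ + ψ) = testGrad α φ + testGrad α ψ := by
  have hd : ∀ j, pderiv j (φ + ψ) = fun y => pderiv j φ y + pderiv j ψ y := fun j => by
    funext y
    rw [pderiv, fderiv_add (hφ.1.differentiable (by simp)).differentiableAt
      (hψ.1.differentiable (by simp)).differentiableAt]
    rfl
  have hi : ∀ {χ : RN N → ℝ}, IsTest U χ → ∀ x, Integrable (fun y => χ y / ‖x - y‖ ^ ((N : ℝ) - α)) :=
    fun {χ} hχ x => by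
      obtain ⟨M, hM⟩ := hχ.exists_abs_le
      exact (integrable_div_norm_rpow hN (by linarith) (by linarith) hχ.integrable
        (ae_of_all _ hM) x).1
  funext x
  ext j
  simp only [testGrad_apply, hd, rieszPotential, Pi.add_apply, PiLp.add_apply, add_div]
  rw [integral_add (hi (hφ.isTest_pderiv j) x) (hi (hψ.isTest_pderiv j) x)]
  ring

theorem one_sub_lt_natCast (hN : 1 ≤ N) {σ : ℝ} (hσ0 : 0 < σ) : 1 - σ < N := by
  have : (1 : ℝ) ≤ N := by exact_mod_cast hN
  linarith

/-- The graph of the fractional gradient over `C_c^∞(Ω)`. -/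
def testGraph (hN : 1 ≤ N) {σ : ℝ} (hσ0 : 0 < σ) (hσ1 : σ < 1) (Ω : Set (RN N)) :
    Submodule ℝ (Pair N) where
  carrier := {p | ∃ φ, IsTest Ω φ ∧ p.fst =ᵐ[volume] φ ∧ p.snd =ᵐ[volume] testGrad (1 - σ) φ}
  add_mem' := by
    rintro p q ⟨φ, hφ, hp1, hp2⟩ ⟨ψ, hψ, hq1, hq2⟩
    refine ⟨φ + ψ, hφ.add hψ, (Lp.coeFn_add _ _).trans (hp1.add hq1), ?_⟩
    rw [hφ.testGrad_add hN (by linarith) (one_sub_lt_natCast hN hσ0) hψ]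
    exact (Lp.coeFn_add _ _).trans (hp2.add hq2)
  zero_mem' := by
    refine ⟨0, isTest_zero Ω, Lp.coeFn_zero _ _ _, ?_⟩
    have h := (isTest_zero Ω).testGrad_smul (1 - σ) 0
    rw [zero_smul, zero_smul] at h
    rw [h]
    exact Lp.coeFn_zero _ _ _
  smul_mem' := by
    rintro c p ⟨φ, hφ, hp1, hp2⟩
    refine ⟨c • φ, hφ.smul c, (Lp.coeFn_smul c _).trans (hp1.const_smul c), ?_⟩
    rw [hφ.testGrad_smul]
    exact (Lp.coeFn_smul c _).trans (hp2.const_smul c)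

theorem testGraph_closure_vanish (hN : 1 ≤ N) {σ : ℝ} (hσ0 : 0 < σ) (hσ1 : σ < 1) {Ω : Set (RN N)}
    {p : Pair N} (hp : p ∈ (testGraph hN hσ0 hσ1 Ω).topologicalClosure) :
    ∀ᵐ x, x ∉ Ω → p.fst x = 0 := by
  have hc : IsClosed {p : Pair N | ∀ᵐ x, p.fst x ∈ {t : ℝ | x ∉ Ω → t = 0}} :=
    (isClosed_ae_mem (S := fun x => {t : ℝ | x ∉ Ω → t = 0}) fun x => by
      by_cases hx : x ∈ Ω
      · simp [hx]
      · simp [hx]).preimage (WithLp.continuous_fst 2 _ _)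
  refine closure_minimal ?_ hc hp
  rintro q ⟨φ, hφ, hq, -⟩
  filter_upwards [hq] with x hx hxΩ
  rw [hx]
  exact image_eq_zero_of_notMem_tsupport fun h => hxΩ (hφ.2.2 h)

theorem integrable_of_memLp_two_of_vanish {Ω : Set (RN N)} (hΩo : IsOpen Ω)
    (hΩb : Bornology.IsBounded Ω) {u : RN N → ℝ} (hu : MemLp u 2 volume)
    (h0 : ∀ᵐ x, x ∉ Ω → u x = 0) : Integrable u := by
  have : IsFiniteMeasure ((volume : Measure (RN N)).restrict Ω) :=
    ⟨by rw [Measure.restrict_apply_univ]; exact hΩb.measure_lt_top⟩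
  have h1 : IntegrableOn u Ω := (hu.restrict Ω).integrable one_le_two
  refine ((integrable_indicator_iff hΩo.measurableSet).2 h1).congr ?_
  filter_upwards [h0] with x hx
  by_cases hxΩ : x ∈ Ω
  · rw [indicator_of_mem hxΩ]
  · rw [indicator_of_notMem hxΩ, hx hxΩ]

theorem inner_single_eq (x : RN N) (j : Fin N) (c : ℝ) :
    ⟪EuclideanSpace.single j c, x⟫ = c * x j := by
  rw [EuclideanSpace.inner_single_left]
  simp

/-- For a fixed test function ψ the duality identity pairs (u, F) with fixed L² elements, because
D^σψ is in L². It is therefore a closed condition, and it holds on the graph. -/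
theorem testGraph_closure_isFracGrad (hN : 1 ≤ N) {σ : ℝ} (hσ0 : 0 < σ) (hσ1 : σ < 1)
    {Ω : Set (RN N)} (hΩo : IsOpen Ω) (hΩb : Bornology.IsBounded Ω)
    {p : Pair N} (hp : p ∈ (testGraph hN hσ0 hσ1 Ω).topologicalClosure) :
    IsFracGrad σ p.fst p.snd := by
  have hi : Integrable p.fst := integrable_of_memLp_two_of_vanish hΩo hΩb (Lp.memLp _)
    (testGraph_closure_vanish hN hσ0 hσ1 hp)
  rw [isFracGrad_iff_of_integrable hN hσ0 hσ1 hi ((Lp.memLp _).locallyIntegrable one_le_two)]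
  intro ψ hψ j
  have h1 : MemLp (fun x => testGrad (1 - σ) ψ x j) 2 volume :=
    memLp_piLp_iff.1 (hψ.memLp_testGrad hN (by linarith) (by linarith)) j
  have h2 : MemLp (fun x => EuclideanSpace.single j (ψ x)) 2 (volume : Measure (RN N)) := by
    rw [memLp_piLp_iff]
    intro i
    by_cases hij : i = j
    · subst hij
      simpa using hψ.memLp 2
    · simp [hij]
  have hpair : ∀ q : Pair N, ⟪h1.toLp _, q.fst⟫ + ⟪h2.toLp _, q.snd⟫
      = (∫ x, q.fst x * testGrad (1 - σ) ψ x j) + ∫ x, q.snd x j * ψ x := fun q => by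
    rw [L2.inner_def, L2.inner_def]
    congr 1
    · refine integral_congr_ae ?_
      filter_upwards [h1.coeFn_toLp] with x hx
      rw [hx]
      simp
    · refine integral_congr_ae ?_
      filter_upwards [h2.coeFn_toLp] with x hx
      rw [hx, inner_single_eq, mul_comm]
  have hc : IsClosed {q : Pair N | ⟪h1.toLp _, q.fst⟫ + ⟪h2.toLp _, q.snd⟫ = (0 : ℝ)} := by
    refine isClosed_eq ?_ continuous_const
    have c1 := WithLp.continuous_fst 2 (Lp ℝ 2 (volume : Measure (RN N)))
      (Lp (RN N) 2 (volume : Measure (RN N)))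
    have c2 := WithLp.continuous_snd 2 (Lp ℝ 2 (volume : Measure (RN N)))
      (Lp (RN N) 2 (volume : Measure (RN N)))
    exact (continuous_const.inner c1).add (continuous_const.inner c2)
  have hmem := closure_minimal (fun q hq => ?_) hc hp
  · rw [mem_ofPred_eq, hpair] at hmem
    linarith
  · obtain ⟨φ, hφ, hq1, hq2⟩ := hq
    have := (isFracGrad_iff_of_integrable hN hσ0 hσ1 hφ.integrable
      (hφ.isFracGrad hN hσ0 hσ1).2.1).1 (hφ.isFracGrad hN hσ0 hσ1) ψ hψ j
    rw [mem_ofPred_eq, hpair]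
    have e1 : ∫ x, q.fst x * testGrad (1 - σ) ψ x j = ∫ x, φ x * testGrad (1 - σ) ψ x j := by
      refine integral_congr_ae ?_
      filter_upwards [hq1] with x hx
      rw [hx]
    have e2 : ∫ x, q.snd x j * ψ x = ∫ x, testGrad (1 - σ) φ x j * ψ x := by
      refine integral_congr_ae ?_
      filter_upwards [hq2] with x hx
      rw [hx]
    rw [e1, e2, this]
    ring

/-- Together with `MemH0.exists_pair`, this is the dictionary between H^σ_0(Ω) and a closed
subspace. Linearity of `fracGrad`, which is a chosen representative and linear only almost
everywhere, is inherited through it. -/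
theorem memH0_of_mem_closure (hN : 1 ≤ N) {σ : ℝ} (hσ0 : 0 < σ) (hσ1 : σ < 1)
    {Ω : Set (RN N)} (hΩo : IsOpen Ω) (hΩb : Bornology.IsBounded Ω)
    {p : Pair N} (hp : p ∈ (testGraph hN hσ0 hσ1 Ω).topologicalClosure)
    {u : RN N → ℝ} (hu : u =ᵐ[volume] p.fst) :
    MemH0 σ Ω u ∧ fracGrad σ u =ᵐ[volume] p.snd := by
  have hF : IsFracGrad σ u p.snd := (testGraph_closure_isFracGrad hN hσ0 hσ1 hΩo hΩb hp).congr_ae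
    hu.symm (ae_eq_refl _)
  have hgrad := hF.fracGrad_ae_eq
  refine ⟨⟨(Lp.memLp p.fst).ae_eq hu.symm, ⟨_, hF⟩, (Lp.memLp p.snd).ae_eq hgrad.symm, ?_⟩, hgrad⟩
  obtain ⟨q, hq, hlim⟩ := mem_closure_iff_seq_limit.1 (show p ∈ closure _ from hp)
  choose φ hφ hq1 hq2 using hq
  refine ⟨φ, hφ, ?_, ?_⟩
  · have h1 : Tendsto (fun n => (q n).fst) atTop (𝓝 p.fst) :=
      ((WithLp.continuous_fst 2 _ _).tendsto p).comp hlim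
    rw [Lp.tendsto_Lp_iff_tendsto_eLpNorm'] at h1
    refine h1.congr fun n => eLpNorm_congr_ae ?_
    exact (hq1 n).sub hu.symm
  · have h1 : Tendsto (fun n => (q n).snd) atTop (𝓝 p.snd) :=
      ((WithLp.continuous_snd 2 _ _).tendsto p).comp hlim
    rw [Lp.tendsto_Lp_iff_tendsto_eLpNorm'] at h1
    refine h1.congr fun n => eLpNorm_congr_ae ?_
    exact ((hq2 n).trans ((hφ n).isFracGrad hN hσ0 hσ1).fracGrad_ae_eq.symm).sub hgrad.symm

theorem MemH0.exists_pair (hN : 1 ≤ N) {σ : ℝ} (hσ0 : 0 < σ) (hσ1 : σ < 1)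
    {Ω : Set (RN N)} {u : RN N → ℝ} (hu : MemH0 σ Ω u) :
    ∃ p ∈ (testGraph hN hσ0 hσ1 Ω).topologicalClosure,
      u =ᵐ[volume] p.fst ∧ fracGrad σ u =ᵐ[volume] p.snd := by
  obtain ⟨hu2, -, hF2, φ, hφ, h1, h2⟩ := hu
  have hg : ∀ n, MemLp (testGrad (1 - σ) (φ n)) 2 volume := fun n =>
    (hφ n).memLp_testGrad hN (by linarith) (by linarith)
  refine ⟨WithLp.toLp 2 (hu2.toLp u, hF2.toLp _), ?_, hu2.coeFn_toLp.symm, hF2.coeFn_toLp.symm⟩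
  refine mem_closure_of_tendsto (f := fun n => (WithLp.toLp 2
    (((hφ n).memLp 2).toLp (φ n), (hg n).toLp _) : Pair N)) (b := atTop) ?_
    (Eventually.of_forall fun n => ⟨φ n, hφ n, ((hφ n).memLp 2).coeFn_toLp, (hg n).coeFn_toLp⟩)
  refine ((WithLp.prod_continuous_toLp 2 _ _).tendsto _).comp (Tendsto.prodMk_nhds ?_ ?_)
  · exact (Lp.tendsto_Lp_iff_tendsto_eLpNorm'' _ _ _ _).2 h1
  · refine (Lp.tendsto_Lp_iff_tendsto_eLpNorm'' _ _ _ _).2 (h2.congr fun n => eLpNorm_congr_ae ?_)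
    exact ((hφ n).isFracGrad hN hσ0 hσ1).fracGrad_ae_eq.sub (ae_eq_refl _)

theorem MemH0.add (hN : 1 ≤ N) {σ : ℝ} (hσ0 : 0 < σ) (hσ1 : σ < 1)
    {Ω : Set (RN N)} (hΩo : IsOpen Ω) (hΩb : Bornology.IsBounded Ω) {u v : RN N → ℝ}
    (hu : MemH0 σ Ω u) (hv : MemH0 σ Ω v) :
    MemH0 σ Ω (u + v) ∧ fracGrad σ (u + v) =ᵐ[volume] fracGrad σ u + fracGrad σ v := by
  obtain ⟨p, hp, hp1, hp2⟩ := hu.exists_pair hN hσ0 hσ1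
  obtain ⟨q, hq, hq1, hq2⟩ := hv.exists_pair hN hσ0 hσ1
  obtain ⟨h1, h2⟩ := memH0_of_mem_closure hN hσ0 hσ1 hΩo hΩb (add_mem hp hq)
    (u := u + v) ((hp1.add hq1).trans (Lp.coeFn_add p.fst q.fst).symm)
  exact ⟨h1, h2.trans ((Lp.coeFn_add p.snd q.snd).trans (hp2.add hq2).symm)⟩

theorem MemH0.smul (hN : 1 ≤ N) {σ : ℝ} (hσ0 : 0 < σ) (hσ1 : σ < 1)
    {Ω : Set (RN N)} (hΩo : IsOpen Ω) (hΩb : Bornology.IsBounded Ω) {u : RN N → ℝ}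
    (hu : MemH0 σ Ω u) (c : ℝ) :
    MemH0 σ Ω (c • u) ∧ fracGrad σ (c • u) =ᵐ[volume] c • fracGrad σ u := by
  obtain ⟨p, hp, hp1, hp2⟩ := hu.exists_pair hN hσ0 hσ1
  obtain ⟨h1, h2⟩ := memH0_of_mem_closure hN hσ0 hσ1 hΩo hΩb (Submodule.smul_mem _ c hp)
    (u := c • u) ((hp1.const_smul c).trans (Lp.coeFn_smul c p.fst).symm)
  exact ⟨h1, h2.trans ((Lp.coeFn_smul c p.snd).trans (hp2.const_smul c).symm)⟩

theorem MemH0.sub (hN : 1 ≤ N) {σ : ℝ} (hσ0 : 0 < σ) (hσ1 : σ < 1)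
    {Ω : Set (RN N)} (hΩo : IsOpen Ω) (hΩb : Bornology.IsBounded Ω) {u v : RN N → ℝ}
    (hu : MemH0 σ Ω u) (hv : MemH0 σ Ω v) :
    MemH0 σ Ω (u - v) ∧ fracGrad σ (u - v) =ᵐ[volume] fracGrad σ u - fracGrad σ v := by
  obtain ⟨h1, h2⟩ := hv.smul hN hσ0 hσ1 hΩo hΩb (-1)
  obtain ⟨h3, h4⟩ := hu.add hN hσ0 hσ1 hΩo hΩb h1
  have e : u + (-1 : ℝ) • v = u - v := by rw [neg_one_smul, sub_eq_add_neg]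
  rw [e] at h3 h4
  refine ⟨h3, ?_⟩
  filter_upwards [h4, h2] with x hx1 hx2
  rw [hx1, Pi.add_apply, hx2, Pi.sub_apply, Pi.smul_apply, neg_one_smul, sub_eq_add_neg]

theorem memH0_zero (hN : 1 ≤ N) {σ : ℝ} (hσ0 : 0 < σ) (hσ1 : σ < 1)
    {Ω : Set (RN N)} (hΩo : IsOpen Ω) (hΩb : Bornology.IsBounded Ω) :
    MemH0 σ Ω (0 : RN N → ℝ) ∧ fracGrad σ (0 : RN N → ℝ) =ᵐ[volume] 0 := by
  obtain ⟨h1, h2⟩ := memH0_of_mem_closure hN hσ0 hσ1 hΩo hΩb (zero_mem _)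
    (u := (0 : RN N → ℝ)) (Lp.coeFn_zero ℝ 2 volume).symm
  exact ⟨h1, h2.trans (Lp.coeFn_zero (RN N) 2 volume)⟩

theorem exists_memH0_abs_le (hN : 1 ≤ N) {σ : ℝ} (hσ0 : 0 < σ) (hσ1 : σ < 1)
    {Ω : Set (RN N)} (hΩo : IsOpen Ω) (hΩb : Bornology.IsBounded Ω) :
    ∃ C, 0 ≤ C ∧ ∀ u M, MemH0 σ Ω u → (∀ᵐ x, ‖fracGrad σ u x‖ ≤ M) → ∀ᵐ x, |u x| ≤ C * M := by
  obtain ⟨C, hC0, hC⟩ := exists_abs_le_mul_of_isFracGrad hN hσ0 hσ1 hΩo hΩb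
  refine ⟨C, hC0, fun u M hu hM => ?_⟩
  obtain ⟨p, hp, hp1, -⟩ := hu.exists_pair hN hσ0 hσ1
  have hv : ∀ᵐ x, x ∉ Ω → u x = 0 := by
    filter_upwards [hp1, testGraph_closure_vanish hN hσ0 hσ1 hp] with x h1 h2
    rwa [h1]
  exact hC u _ M (integrable_of_memLp_two_of_vanish hΩo hΩb hu.1 hv) hv (fracGrad_spec hu.2.1) hM

/-- `Υ^σ_∞(Ω)` as a vector space. -/
def upsilon (hN : 1 ≤ N) {σ : ℝ} (hσ0 : 0 < σ) (hσ1 : σ < 1)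
    {Ω : Set (RN N)} (hΩo : IsOpen Ω) (hΩb : Bornology.IsBounded Ω) :
    Submodule ℝ (RN N → ℝ) where
  carrier := {u | MemUpsilon σ Ω u}
  add_mem' := fun hu hv => by
    obtain ⟨h1, h2⟩ := hu.1.add hN hσ0 hσ1 hΩo hΩb hv.1
    exact ⟨h1, (hu.2.add hv.2).ae_eq h2.symm⟩
  zero_mem' := by
    obtain ⟨h1, h2⟩ := memH0_zero hN hσ0 hσ1 hΩo hΩb
    exact ⟨h1, MemLp.zero.ae_eq h2.symm⟩
  smul_mem' := fun c u hu => by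
    obtain ⟨h1, h2⟩ := hu.1.smul hN hσ0 hσ1 hΩo hΩb c
    exact ⟨h1, (hu.2.const_smul c).ae_eq h2.symm⟩

theorem MemUpsilon.gradLinf_ae {σ : ℝ} {Ω : Set (RN N)} {u : RN N → ℝ} (hu : MemUpsilon σ Ω u) :
    hu.gradLinf =ᵐ[volume] fracGrad σ u := MemLp.coeFn_toLp _

/-- The fractional gradient as a linear map on `Υ^σ_∞(Ω)`. -/
def upsilonGrad (hN : 1 ≤ N) {σ : ℝ} (hσ0 : 0 < σ) (hσ1 : σ < 1)
    {Ω : Set (RN N)} (hΩo : IsOpen Ω) (hΩb : Bornology.IsBounded Ω) :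
    upsilon hN hσ0 hσ1 hΩo hΩb →ₗ[ℝ] Lp (RN N) ∞ (volume : Measure (RN N)) where
  toFun u := MemUpsilon.gradLinf u.2
  map_add' u v := by
    refine Lp.ext ?_
    have h := (MemH0.add hN hσ0 hσ1 hΩo hΩb u.2.1 v.2.1).2
    filter_upwards [h, MemUpsilon.gradLinf_ae u.2, MemUpsilon.gradLinf_ae v.2,
      MemUpsilon.gradLinf_ae (u + v).2,
      Lp.coeFn_add (MemUpsilon.gradLinf u.2) (MemUpsilon.gradLinf v.2)] with x h1 h2 h3 h4 h5
    refine h4.trans (h1.trans ?_)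
    rw [h5, Pi.add_apply, Pi.add_apply, h2, h3]
  map_smul' c u := by
    refine Lp.ext ?_
    have h := (MemH0.smul hN hσ0 hσ1 hΩo hΩb u.2.1 c).2
    filter_upwards [h, MemUpsilon.gradLinf_ae u.2, MemUpsilon.gradLinf_ae (c • u).2,
      Lp.coeFn_smul c (MemUpsilon.gradLinf u.2)] with x h1 h2 h3 h4
    refine h3.trans (h1.trans ?_)
    rw [RingHom.id_apply, h4, Pi.smul_apply, Pi.smul_apply, h2]

end FracGrad
end

noncomputable section

namespace FracGrad

variable {N : ℕ}

/-! ### The bilinear form and the linear functional -/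

theorem norm_toEuclideanLin_le {B : Matrix (Fin N) (Fin N) ℝ} {c : ℝ}
    (h : ∀ ξ η : RN N, ⟪Matrix.toEuclideanLin B ξ, η⟫ ≤ c * ‖ξ‖ * ‖η‖) (ξ : RN N) :
    ‖Matrix.toEuclideanLin B ξ‖ ≤ c * ‖ξ‖ := by
  have h1 := h ξ (Matrix.toEuclideanLin B ξ)
  rw [real_inner_self_eq_norm_sq, sq] at h1
  rcases (norm_nonneg (Matrix.toEuclideanLin B ξ)).eq_or_lt with h0 | h0
  · by_cases hξ : ξ = 0
    · simp [hξ]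
    -- No sign of c is assumed; it is recovered by testing with ξ ≠ 0.
    · have h2 := h ξ ξ
      have h3 : Matrix.toEuclideanLin B ξ = 0 := norm_eq_zero.1 h0.symm
      rw [h3, inner_zero_left] at h2
      rw [← h0]
      exact nonneg_of_mul_nonneg_left h2 (norm_pos_iff.2 hξ)
  · exact le_of_mul_le_mul_right h1 h0

theorem aestronglyMeasurable_toEuclideanLin {A : RN N → Matrix (Fin N) (Fin N) ℝ}
    (hA : ∀ i j, AEMeasurable (fun x => A x i j) volume) {F : RN N → RN N}
    (hF : AEStronglyMeasurable F volume) :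
    AEStronglyMeasurable (fun x => Matrix.toEuclideanLin (A x) (F x)) volume := by
  have h1 : ∀ j, AEMeasurable (fun x => F x j) volume := fun j =>
    ((EuclideanSpace.proj (𝕜 := ℝ) j).continuous.measurable.comp_aemeasurable hF.aemeasurable)
  have h2 : AEMeasurable (fun x i => ∑ j, A x i j * F x j) volume :=
    aemeasurable_pi_lambda _ fun i => Finset.aemeasurable_fun_sum _ fun j _ => (hA i j).mul (h1 j)
  exact ((WithLp.measurable_toLp 2 _).comp_aemeasurable h2).aestronglyMeasurable

theorem memLp_toEuclideanLin {A : RN N → Matrix (Fin N) (Fin N) ℝ} (hA : IsBoundedPosDef A)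
    {F : RN N → RN N} (hF : MemLp F 2 volume) :
    MemLp (fun x => Matrix.toEuclideanLin (A x) (F x)) 2 volume := by
  obtain ⟨hm, aLow, aUp, -, -, h⟩ := hA
  refine hF.of_le_mul (c := aUp) (aestronglyMeasurable_toEuclideanLin hm hF.1) ?_
  filter_upwards [h] with x hx
  exact norm_toEuclideanLin_le (fun ξ η => (hx ξ η).2) _

theorem exists_matrixOp {A : RN N → Matrix (Fin N) (Fin N) ℝ} (hA : IsBoundedPosDef A) :
    ∃ B : Lp (RN N) 2 (volume : Measure (RN N)) →L[ℝ] Lp (RN N) 2 (volume : Measure (RN N)),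
      ∀ F, B F =ᵐ[volume] fun x => Matrix.toEuclideanLin (A x) (F x) := by
  have hmem : ∀ F : Lp (RN N) 2 (volume : Measure (RN N)),
      MemLp (fun x => Matrix.toEuclideanLin (A x) (F x)) 2 volume := fun F =>
    memLp_toEuclideanLin hA (Lp.memLp F)
  obtain ⟨-, aLow, aUp, -, -, h⟩ := hA
  refine ⟨LinearMap.mkContinuous
    { toFun := fun F => (hmem F).toLp _
      map_add' := fun F G => ?_
      map_smul' := fun c F => ?_ } aUp fun F => ?_, fun F => (hmem F).coeFn_toLp⟩
  · refine Lp.ext ?_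
    filter_upwards [(hmem (F + G)).coeFn_toLp, (hmem F).coeFn_toLp, (hmem G).coeFn_toLp,
      Lp.coeFn_add F G, Lp.coeFn_add ((hmem F).toLp _) ((hmem G).toLp _)] with x h1 h2 h3 h4 h5
    rw [h1, h5, Pi.add_apply, h2, h3, h4, Pi.add_apply, map_add]
  · refine Lp.ext ?_
    filter_upwards [(hmem (c • F)).coeFn_toLp, (hmem F).coeFn_toLp,
      Lp.coeFn_smul c F, Lp.coeFn_smul c ((hmem F).toLp _)] with x h1 h2 h3 h4
    rw [h1, RingHom.id_apply, h4, Pi.smul_apply, h2, h3, Pi.smul_apply, map_smul]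
  · refine Lp.norm_le_mul_norm_of_ae_le_mul ?_
    filter_upwards [h, (hmem F).coeFn_toLp] with x hx h1
    change ‖(hmem F).toLp _ x‖ ≤ _
    rw [h1]
    exact norm_toEuclideanLin_le (fun ξ η => (hx ξ η).2) _

theorem integrable_formDensity {A : RN N → Matrix (Fin N) (Fin N) ℝ} (hA : IsBoundedPosDef A)
    {σ : ℝ} {Ω : Set (RN N)} {u v : RN N → ℝ} (hu : MemH0 σ Ω u) (hv : MemH0 σ Ω v) :
    Integrable (formDensity σ A u v) := by
  have h1 := memLp_toEuclideanLin hA hu.2.2.1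
  have := L2.integrable_inner (𝕜 := ℝ) (h1.toLp _) (hv.2.2.1.toLp _)
  refine this.congr ?_
  filter_upwards [h1.coeFn_toLp, hv.2.2.1.coeFn_toLp] with x hx1 hx2
  rw [hx1, hx2]
  rfl

/-- Every admissible exponent is at least 1 and Ω has finite measure. Integrability of f is all that
is used later, since the competing functions are bounded. -/
theorem integrableOn_of_isTwoSharp (hN : 1 ≤ N) {σ : ℝ} (hσ0 : 0 < σ) {Ω : Set (RN N)}
    (hΩb : Bornology.IsBounded Ω) {r : ℝ} (hr : IsTwoSharp N σ r) {f : RN N → ℝ}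
    (hf : MemLp f (ENNReal.ofReal r) (volume.restrict Ω)) : IntegrableOn f Ω := by
  have : IsFiniteMeasure ((volume : Measure (RN N)).restrict Ω) :=
    ⟨by rw [Measure.restrict_apply_univ]; exact hΩb.measure_lt_top⟩
  refine hf.integrable ?_
  rw [ENNReal.one_le_ofReal]
  have hNr : (1 : ℝ) ≤ N := by exact_mod_cast hN
  rcases hr with ⟨h1, rfl⟩ | ⟨-, h⟩ | ⟨-, rfl⟩
  · rw [le_div_iff₀ (by linarith)]
    linarith
  · exact h.le
  · exact le_rfl

theorem exists_ae_abs_le {g : RN N → ℝ} (hg : MemLp g ∞ volume) : ∃ G, ∀ᵐ x, |g x| ≤ G := by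
  refine ⟨‖hg.toLp g‖, ?_⟩
  filter_upwards [ae_norm_le_norm_Linf (hg.toLp g), hg.coeFn_toLp] with x h1 h2
  rwa [h2] at h1

/-! ### Existence for the variational inequality -/

/-- The convex set of admissible pairs. -/
def pairK (hN : 1 ≤ N) {σ : ℝ} (hσ0 : 0 < σ) (hσ1 : σ < 1) (Ω : Set (RN N)) (g : RN N → ℝ) :
    Set (Pair N) :=
  {p | p ∈ (testGraph hN hσ0 hσ1 Ω).topologicalClosure ∧ ∀ᵐ x, ‖p.snd x‖ ≤ g x}

theorem isClosed_pairK (hN : 1 ≤ N) {σ : ℝ} (hσ0 : 0 < σ) (hσ1 : σ < 1) (Ω : Set (RN N))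
    (g : RN N → ℝ) : IsClosed (pairK hN hσ0 hσ1 Ω g) := by
  refine (Submodule.isClosed_topologicalClosure _).inter ?_
  exact (isClosed_ae_mem (S := fun x => {y : RN N | ‖y‖ ≤ g x}) fun x =>
    isClosed_le continuous_norm continuous_const).preimage (WithLp.continuous_snd 2 _ _)

theorem convex_pairK (hN : 1 ≤ N) {σ : ℝ} (hσ0 : 0 < σ) (hσ1 : σ < 1) (Ω : Set (RN N))
    (g : RN N → ℝ) : Convex ℝ (pairK hN hσ0 hσ1 Ω g) := by
  rintro p ⟨hp1, hp2⟩ q ⟨hq1, hq2⟩ a b ha hb hab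
  refine ⟨add_mem (Submodule.smul_mem _ a hp1) (Submodule.smul_mem _ b hq1), ?_⟩
  filter_upwards [hp2, hq2, Lp.coeFn_add (a • p.snd) (b • q.snd), Lp.coeFn_smul a p.snd,
    Lp.coeFn_smul b q.snd] with x h1 h2 h3 h4 h5
  change ‖(a • p.snd + b • q.snd) x‖ ≤ g x
  rw [h3, Pi.add_apply, h4, h5]
  refine (norm_add_le _ _).trans ?_
  rw [Pi.smul_apply, Pi.smul_apply, norm_smul, norm_smul, Real.norm_of_nonneg ha,
    Real.norm_of_nonneg hb]
  calc a * ‖p.snd x‖ + b * ‖q.snd x‖ ≤ a * g x + b * g x := by gcongr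
    _ = g x := by rw [← add_mul, hab, one_mul]

/-- The pairing of an integrable function with a bounded one is continuous along `L²` convergence
with a uniform bound. -/
theorem continuousOn_integral_mul {f : RN N → ℝ} {Ω : Set (RN N)} (hf : IntegrableOn f Ω)
    {K : Set (Pair N)} {B : ℝ} (hB : ∀ p ∈ K, ∀ᵐ x, |p.fst x| ≤ B) :
    ContinuousOn (fun p : Pair N => ∫ x in Ω, f x * p.fst x) K := by
  intro p hp
  refine tendsto_of_subseq_tendsto fun q hq => ?_
  rw [tendsto_nhdsWithin_iff] at hq
  have h1 : Tendsto (fun n => (q n).fst) atTop (𝓝 p.fst) :=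
    ((WithLp.continuous_fst 2 _ _).tendsto p).comp hq.1
  obtain ⟨ns, hns, hlim⟩ := (tendstoInMeasure_of_tendsto_Lp h1).exists_seq_tendsto_ae
  refine ⟨ns, tendsto_integral_filter_of_dominated_convergence (fun x => |f x| * B) ?_ ?_
    (hf.abs.mul_const B) ?_⟩
  · exact Eventually.of_forall fun n =>
      hf.aestronglyMeasurable.mul (Lp.aestronglyMeasurable (q (ns n)).fst).restrict
  · filter_upwards [hns.tendsto_atTop.eventually hq.2] with n hn
    filter_upwards [ae_restrict_of_ae (hB _ hn)] with x hx
    rw [norm_mul]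
    exact mul_le_mul_of_nonneg_left hx (abs_nonneg _)
  · filter_upwards [ae_restrict_of_ae hlim] with x hx
    exact hx.const_mul (f x)

theorem norm_sq_fst_le {Ω : Set (RN N)} (hΩo : IsOpen Ω) (hΩb : Bornology.IsBounded Ω)
    {w : Lp ℝ 2 (volume : Measure (RN N))} (h0 : ∀ᵐ x, x ∉ Ω → w x = 0) {B : ℝ}
    (hB : ∀ᵐ x, |w x| ≤ B) : ‖w‖ ^ 2 ≤ volume.real Ω * B ^ 2 := by
  have h1 : ‖w‖ ^ 2 = ∫ x, w x ^ 2 := by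
    rw [← real_inner_self_eq_norm_sq, L2.inner_def]
    refine integral_congr_ae (ae_of_all _ fun x => ?_)
    simp [sq]
  rw [h1]
  have h2 : ∫ x, Ω.indicator (fun _ => B ^ 2) x = volume.real Ω * B ^ 2 := by
    rw [integral_indicator hΩo.measurableSet, setIntegral_const, smul_eq_mul]
  rw [← h2]
  refine integral_mono_of_nonneg (ae_of_all _ fun _ => sq_nonneg _)
    ((integrable_indicator_iff hΩo.measurableSet).2
      (integrableOn_const hΩb.measure_lt_top.ne)) ?_
  filter_upwards [h0, hB] with x hx1 hx2
  by_cases hx : x ∈ Ω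
  · rw [indicator_of_mem hx, ← sq_abs]
    exact pow_le_pow_left₀ (abs_nonneg _) hx2 2
  · rw [indicator_of_notMem hx, hx1 hx]
    simp

/-- The gradient bound g ≤ G makes all admissible functions uniformly bounded, so v ↦ ∫_Ω f v is
finite, affine and continuous on the admissible set although f need not act continuously on L². -/
theorem exists_solvesVI (hN : 1 ≤ N) {σ : ℝ} (hσ0 : 0 < σ) (hσ1 : σ < 1)
    {Ω : Set (RN N)} (hΩo : IsOpen Ω) (hΩb : Bornology.IsBounded Ω)
    {A : RN N → Matrix (Fin N) (Fin N) ℝ} (hA : IsBoundedPosDef A) {g : RN N → ℝ} {G : ℝ}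
    (hG : ∀ᵐ x, |g x| ≤ G) (hg0 : ∀ᵐ x, 0 ≤ g x) {f : RN N → ℝ} (hf : IntegrableOn f Ω) :
    ∃ u, SolvesVI σ Ω A f g u := by
  obtain ⟨C, hC0, hC⟩ := exists_memH0_abs_le hN hσ0 hσ1 hΩo hΩb
  obtain ⟨T, hT⟩ := exists_matrixOp hA
  obtain ⟨-, aLow, aUp, hLow, -, hbd⟩ := hA
  set K := pairK hN hσ0 hσ1 Ω g
  set L : Pair N → ℝ := fun p => ∫ x in Ω, f x * p.fst x with hL
  have hB : ∀ p ∈ K, ∀ᵐ x, |p.fst x| ≤ C * G := fun p hp => by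
    obtain ⟨h1, h2⟩ := memH0_of_mem_closure hN hσ0 hσ1 hΩo hΩb hp.1 (ae_eq_refl _)
    refine hC _ G h1 ?_
    filter_upwards [h2, hp.2, hG] with x e1 e2 e3
    rw [e1]
    exact e2.trans ((le_abs_self _).trans e3)
  have hLi : ∀ p ∈ K, IntegrableOn (fun x => f x * p.fst x) Ω := fun p hp =>
    Integrable.mul_bdd (c := C * G) hf (Lp.aestronglyMeasurable p.fst).restrict
      (ae_restrict_of_ae (hB p hp))
  have hLa : IsAffineOn K L := fun v hv w hw t _ _ => by
    simp only [hL]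
    rw [← integral_const_mul, ← integral_const_mul, ← integral_add ((hLi v hv).const_mul _)
      ((hLi w hw).const_mul _)]
    refine integral_congr_ae (ae_restrict_of_ae ?_)
    filter_upwards [Lp.coeFn_add ((1 - t) • v.fst) (t • w.fst), Lp.coeFn_smul (1 - t) v.fst,
      Lp.coeFn_smul t w.fst] with x h1 h2 h3
    change f x * ((1 - t) • v.fst + t • w.fst) x = _
    rw [h1, Pi.add_apply, h2, h3]
    simp only [Pi.smul_apply, smul_eq_mul]
    ring
  have hLc : ContinuousOn L K := continuousOn_integral_mul hf hB
  set M := (∫ x in Ω, |f x|) * (C * G)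
  have hLb : ∀ v ∈ K, L v ≤ M := fun v hv => by
    simp only [hL]
    refine (integral_mono_ae (hLi v hv) (hf.abs.mul_const (C * G)) ?_).trans
      (integral_mul_const _ _).le
    filter_upwards [ae_restrict_of_ae (hB v hv)] with x hx
    calc f x * v.fst x ≤ |f x| * |v.fst x| := (le_abs_self _).trans (abs_mul _ _).le
      _ ≤ |f x| * (C * G) := mul_le_mul_of_nonneg_left hx (abs_nonneg _)
  have hK0 : (0 : Pair N) ∈ K := by
    refine ⟨zero_mem _, ?_⟩
    filter_upwards [hg0, Lp.coeFn_zero (RN N) 2 (volume : Measure (RN N))] with x h1 h2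
    change ‖(0 : Lp (RN N) 2 (volume : Measure (RN N))) x‖ ≤ g x
    rw [h2, Pi.zero_apply, norm_zero]
    exact h1
  have hL0 : L 0 = 0 := by
    have : ∀ᵐ x ∂(volume.restrict Ω), f x * (0 : Pair N).fst x = 0 := by
      filter_upwards [ae_restrict_of_ae (Lp.coeFn_zero ℝ 2 (volume : Measure (RN N)))] with x h2
      change f x * (0 : Lp ℝ 2 (volume : Measure (RN N))) x = 0
      rw [h2, Pi.zero_apply, mul_zero]
    simp only [hL]
    rw [integral_congr_ae this, integral_zero]
  -- the operator on pairs
  set 𝒜 : Pair N →L[ℝ] Pair N :=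
    (WithLp.prodContinuousLinearEquiv 2 ℝ _ _).symm.toContinuousLinearMap ∘L
      (ContinuousLinearMap.inr ℝ _ _) ∘L T ∘L (WithLp.sndL 2 ℝ _ _)
  have h𝒜 : ∀ p q : Pair N, ⟪𝒜 p, q⟫ = ∫ x, ⟪Matrix.toEuclideanLin (A x) (p.snd x), q.snd x⟫ :=
    fun p q => by
    have h1 : ⟪𝒜 p, q⟫ = ⟪T p.snd, q.snd⟫ := by
      rw [WithLp.prod_inner_apply]
      change ⟪(0 : Lp ℝ 2 (volume : Measure (RN N))), q.fst⟫ + ⟪T p.snd, q.snd⟫ = _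
      rw [inner_zero_left, zero_add]
    rw [h1, L2.inner_def]
    refine integral_congr_ae ?_
    filter_upwards [hT p.snd] with x hx
    rw [hx]
  have hcoer : ∀ p : Pair N, aLow * ‖p.snd‖ ^ 2 ≤ ⟪𝒜 p, p⟫ := fun p => by
    have h1 : ‖p.snd‖ ^ 2 = ∫ x, ‖p.snd x‖ ^ 2 := by
      rw [← real_inner_self_eq_norm_sq, L2.inner_def]
      simp only [real_inner_self_eq_norm_sq]
    rw [h𝒜, h1, ← integral_const_mul]
    have hi : Integrable (fun x => ⟪Matrix.toEuclideanLin (A x) (p.snd x), p.snd x⟫) := by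
      refine (L2.integrable_inner (𝕜 := ℝ) (T p.snd) p.snd).congr ?_
      filter_upwards [hT p.snd] with x hx
      rw [hx]
    refine integral_mono_of_nonneg (ae_of_all _ fun x => by positivity) hi ?_
    filter_upwards [hbd] with x hx using (hx (p.snd x) 0).1
  obtain ⟨p, hpK, hp⟩ := exists_vi_of_monotone (isClosed_pairK hN hσ0 hσ1 Ω g)
    (convex_pairK hN hσ0 hσ1 Ω g) hK0 hLa hLc hL0 hLb 𝒜
    (fun v => (by positivity : (0 : ℝ) ≤ aLow * ‖v.snd‖ ^ 2).trans (hcoer v))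
    -- The function component is bounded through the uniform bound on Ω, the gradient component
    -- through ellipticity.
    (R := √(volume.real Ω * (C * G) ^ 2 + M / aLow)) (fun v hv hle => by
      refine Real.le_sqrt_of_sq_le ?_
      rw [WithLp.prod_norm_sq_eq_of_L2]
      refine add_le_add (norm_sq_fst_le hΩo hΩb (testGraph_closure_vanish hN hσ0 hσ1 hv.1)
        (hB v hv)) ?_
      rw [le_div_iff₀ hLow, mul_comm]
      exact (hcoer v).trans (hle.trans (hLb v hv)))
  obtain ⟨hu, hgu⟩ := memH0_of_mem_closure hN hσ0 hσ1 hΩo hΩb hpK.1 (ae_eq_refl _)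
  refine ⟨p.fst, ⟨hu, ?_⟩, fun v hv => ?_⟩
  · filter_upwards [hgu, hpK.2] with x h1 h2
    rwa [h1]
  · obtain ⟨q, hq, hvq, hgq⟩ := hv.1.exists_pair hN hσ0 hσ1
    have hqK : q ∈ K := ⟨hq, by
      filter_upwards [hgq, hv.2] with x h1 h2
      rwa [← h1]⟩
    have h1 := hp q hqK
    have h2 : ∫ x in Ω, f x * (v x - p.fst x) = L q - L p := by
      simp only [hL]
      rw [← integral_sub (hLi q hqK) (hLi p hpK)]
      refine integral_congr_ae (ae_restrict_of_ae ?_)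
      filter_upwards [hvq] with x hx
      rw [hx]
      ring
    have h3 : ∫ x, formDensity σ A p.fst (v - p.fst) x = ⟪𝒜 p, q - p⟫ := by
      rw [h𝒜]
      refine integral_congr_ae ?_
      filter_upwards [hgu, hgq, (hv.1.sub hN hσ0 hσ1 hΩo hΩb hu).2, Lp.coeFn_sub q.snd p.snd]
        with x e1 e2 e3 e4
      have e5 : (q - p).snd x = q.snd x - p.snd x := e4
      rw [formDensity, e3, e5, Pi.sub_apply, e1, e2]
    rw [h2, h3]
    exact h1

/-! ### The Lagrange multiplier problem -/

theorem integrableOn_mul_of_memUpsilon (hN : 1 ≤ N) {σ : ℝ} (hσ0 : 0 < σ) (hσ1 : σ < 1)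
    {Ω : Set (RN N)} (hΩo : IsOpen Ω) (hΩb : Bornology.IsBounded Ω) {f : RN N → ℝ}
    (hf : IntegrableOn f Ω) {v : RN N → ℝ} (hv : MemUpsilon σ Ω v) :
    IntegrableOn (fun x => f x * v x) Ω := by
  obtain ⟨C, -, hC⟩ := exists_memH0_abs_le hN hσ0 hσ1 hΩo hΩb
  have hM : ∀ᵐ x, ‖fracGrad σ v x‖ ≤ ‖hv.gradLinf‖ := by
    filter_upwards [ae_norm_le_norm_Linf hv.gradLinf, hv.gradLinf_ae] with x h1 h2
    rwa [h2] at h1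
  exact Integrable.mul_bdd (c := C * ‖hv.gradLinf‖) hf hv.1.1.1.restrict
    (ae_restrict_of_ae (hC v _ hv.1 hM))

/-- The functional `v ↦ ∫_Ω f v - ∫ A D^σ u · D^σ v` on `Υ^σ_∞(Ω)`. -/
def residual (hN : 1 ≤ N) {σ : ℝ} (hσ0 : 0 < σ) (hσ1 : σ < 1)
    {Ω : Set (RN N)} (hΩo : IsOpen Ω) (hΩb : Bornology.IsBounded Ω)
    {A : RN N → Matrix (Fin N) (Fin N) ℝ} (hA : IsBoundedPosDef A) {f : RN N → ℝ}
    (hf : IntegrableOn f Ω) {u : RN N → ℝ} (hu : MemH0 σ Ω u) :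
    upsilon hN hσ0 hσ1 hΩo hΩb →ₗ[ℝ] ℝ where
  toFun v := (∫ x in Ω, f x * v.1 x) - ∫ x, formDensity σ A u v.1 x
  map_add' v w := by
    have h1 := integrableOn_mul_of_memUpsilon hN hσ0 hσ1 hΩo hΩb hf v.2
    have h2 := integrableOn_mul_of_memUpsilon hN hσ0 hσ1 hΩo hΩb hf w.2
    have h3 := integrable_formDensity hA hu v.2.1
    have h4 := integrable_formDensity hA hu w.2.1
    have e1 : ∫ x in Ω, f x * (v + w).1 x = (∫ x in Ω, f x * v.1 x) + ∫ x in Ω, f x * w.1 x := by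
      rw [← integral_add h1 h2]
      refine integral_congr_ae (ae_of_all _ fun x => ?_)
      exact mul_add (f x) (v.1 x) (w.1 x)
    have e2 : ∫ x, formDensity σ A u (v + w).1 x
        = (∫ x, formDensity σ A u v.1 x) + ∫ x, formDensity σ A u w.1 x := by
      rw [← integral_add h3 h4]
      refine integral_congr_ae ?_
      filter_upwards [(MemH0.add hN hσ0 hσ1 hΩo hΩb v.2.1 w.2.1).2] with x hx
      have hx' : fracGrad σ (v + w).1 x = fracGrad σ v.1 x + fracGrad σ w.1 x := hx
      simp only [formDensity, hx', inner_add_right]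
    rw [e1, e2]
    ring
  map_smul' c v := by
    have e1 : ∫ x in Ω, f x * (c • v).1 x = c * ∫ x in Ω, f x * v.1 x := by
      rw [← integral_const_mul]
      refine integral_congr_ae (ae_of_all _ fun x => ?_)
      exact mul_left_comm (f x) c (v.1 x)
    have e2 : ∫ x, formDensity σ A u (c • v).1 x = c * ∫ x, formDensity σ A u v.1 x := by
      rw [← integral_const_mul]
      refine integral_congr_ae ?_
      filter_upwards [(MemH0.smul hN hσ0 hσ1 hΩo hΩb v.2.1 c).2] with x hx
      have hx' : fracGrad σ (c • v).1 x = c • fracGrad σ v.1 x := hx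
      simp only [formDensity, hx', real_inner_smul_right]
    rw [e1, e2, RingHom.id_apply, smul_eq_mul]
    ring

end FracGrad
end

/-! ### The multiplier theorem. -/

theorem mainTheorem3 (N : ℕ) (hN : 1 ≤ N) (σ : ℝ) (hσ0 : 0 < σ) (hσ1 : σ < 1)
    (Ω : Set (FracGrad.RN N)) (hΩo : IsOpen Ω) (hΩb : Bornology.IsBounded Ω)
    (A : FracGrad.RN N → Matrix (Fin N) (Fin N) ℝ) (hA : FracGrad.IsBoundedPosDef A)
    (ν : ℝ) (hν : 0 < ν) (g : FracGrad.RN N → ℝ) (hg : MemLp g ∞ volume)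
    (hgν : ∀ᵐ x : FracGrad.RN N, ν ≤ g x)
    (r : ℝ) (hr : FracGrad.IsTwoSharp N σ r)
    (f : FracGrad.RN N → ℝ) (hf : MemLp f (ENNReal.ofReal r) (volume.restrict Ω)) :
    ∃ (lam : FracGrad.LinfDual N) (u : FracGrad.RN N → ℝ) (hu : FracGrad.MemUpsilon σ Ω u),
      -- the multiplier equation, all of whose integrals converge
      (∀ (v : FracGrad.RN N → ℝ) (hv : FracGrad.MemUpsilon σ Ω v),
        IntegrableOn (fun x => f x * v x) Ω volume ∧
        Integrable (FracGrad.formDensity σ A u v) volume ∧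
        lam.mulVec hu.gradLinf hv.gradLinf + ∫ x, FracGrad.formDensity σ A u v x
          = ∫ x in Ω, f x * v x) ∧
      -- the constraint, the sign of the multiplier, and complementarity
      (∀ᵐ x : FracGrad.RN N, ‖FracGrad.fracGrad σ u x‖ ≤ g x) ∧
      lam.IsNonneg ∧
      lam.mul ((hu.2.norm.sub hg).toLp) = 0 ∧
      -- the variational inequality
      FracGrad.SolvesVI σ Ω A f g u := by
  have hf1 := FracGrad.integrableOn_of_isTwoSharp hN hσ0 hΩb hr hf
  obtain ⟨G, hG⟩ := FracGrad.exists_ae_abs_le hg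
  obtain ⟨u, hVI⟩ := FracGrad.exists_solvesVI hN hσ0 hσ1 hΩo hΩb hA hG
    (hgν.mono fun x hx => hν.le.trans hx) hf1
  have huK := hVI.1
  have hu : FracGrad.MemUpsilon σ Ω u := ⟨huK.1, hg.mono huK.1.2.2.1.1 (by
    filter_upwards [huK.2] with x hx
    exact hx.trans (le_abs_self _))⟩
  set D := FracGrad.upsilonGrad hN hσ0 hσ1 hΩo hΩb
  set T := FracGrad.residual hN hσ0 hσ1 hΩo hΩb hA hf1 huK.1
  have hD : ∀ v, D v =ᵐ[volume] FracGrad.fracGrad σ v.1 := fun v =>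
    FracGrad.MemUpsilon.gradLinf_ae v.2
  have hDu := hD ⟨u, hu⟩
  obtain ⟨lam, hlam0, hlamT, hlamq⟩ := FracGrad.exists_multiplier D T hg hν hgν (u := ⟨u, hu⟩)
    (by filter_upwards [huK.2, hDu] with x h1 h2
        rwa [h2])
    (fun v hv => by
      have hvK : FracGrad.MemK σ Ω g v.1 := ⟨v.2.1, by
        filter_upwards [hv, hD v] with x h1 h2
        rwa [← h2]⟩
      -- The variational inequality is exactly the statement that u maximises T over admissible v.
      have h1 : T (v - ⟨u, hu⟩) ≤ 0 := sub_nonpos.2 (hVI.2 v.1 hvK)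
      rw [map_sub] at h1
      linarith)
  refine ⟨lam, u, hu, fun v hv => ⟨FracGrad.integrableOn_mul_of_memUpsilon hN hσ0 hσ1 hΩo hΩb hf1
    hv, FracGrad.integrable_formDensity hA hu.1 hv.1, ?_⟩, huK.2, hlam0, ?_, hVI⟩
  · have h1 : lam.mulVec hu.gradLinf hv.gradLinf
        = (∫ x in Ω, f x * v x) - ∫ x, FracGrad.formDensity σ A u v x := hlamT ⟨v, hv⟩
    rw [h1]
    ring
  · have hq : MemLp (fun x => g x ^ 2 - ‖FracGrad.fracGrad σ u x‖ ^ 2) ∞ volume := by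
      have h1 : MemLp (fun x => g x ^ 2) ∞ volume := by
        simpa only [sq] using! hg.mul (r := ∞) hg
      have h2 : MemLp (fun x => ‖FracGrad.fracGrad σ u x‖ ^ 2) ∞ volume := by
        simpa only [sq] using! hu.2.norm.mul (r := ∞) hu.2.norm
      exact h1.sub h2
    -- g² − |D^σu|² = (g − |D^σu|)(g + |D^σu|) ≥ ν (g − |D^σu|), whence the constant ν⁻¹.
    refine FracGrad.LinfDual.mul_eq_zero (C := ν⁻¹) hlam0 (q := hq.toLp _) ?_ (hlamq _ ?_)
    · filter_upwards [hq.coeFn_toLp, (hu.2.norm.sub hg).coeFn_toLp, huK.2, hgν] with x h1 h2 h3 h4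
      rw [h1, h2, Pi.sub_apply, abs_of_nonpos (by linarith), inv_mul_eq_div, le_div_iff₀ hν]
      have := norm_nonneg (FracGrad.fracGrad σ u x)
      nlinarith
    · filter_upwards [hq.coeFn_toLp, hDu] with x h1 h2
      rw [h1, h2]
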